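/- A graph $G=(V,E)$ is a simple undirected graph; $V$ may be infinite and vertices may have infinite degree. Let $|G|$ be its $1$-complex: the quotient of the disjoint sum of the discrete space $V$ and one copy of $[0,1]$ for each edge, in which the two ends of the copy belonging to an edge $vw$ are identified with $v$ and $w$. An \emph{arc} in a topological space is a subspace homeomorphic to $[0,1]$. A graph $G$ is \emph{$4$-ac} if any at most four points of $|G|$ lie on a common arc in $|G|$. A graph is \emph{$2$-connected} if it is connected and removing any single vertex does not disconnect it (so a single edge $K_2$ is $2$-connected). A connected graph is a \emph{chain graph} if it is the union of a linearly ordered family (possibly with just one member, possibly infinite) of nonempty subgraphs, called \emph{links}, such that only consecutive links meet and any two consecutive links have exactly one vertex in common. A link is \emph{interior} if it is neither the first nor the last one. A \emph{cut vertex} of a connected graph is a vertex whose removal disconnects the graph, and $\deg_L(v)$ is the degree of $v$ in $L$. \textbf{Theorem.} A graph $G$ is $4$-ac if and only if it is a chain graph, with a family of links such that (1) all links are $2$-connected and $4$-ac (as graphs in their own right); (2) all interior links are single edges, i.e. consist of one edge and its two ends; (3) if $v$ is a cut vertex of $G$ and $L$ is a link with $v\in L$, then $\deg_L(v)\le 2$.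 -/

import Mathlib

namespace GraphArc

/-- The disjoint sum of the vertex set `V` and one copy of `[0,1]` for every dart (edge with a
chosen direction) of `G`. -/
def PreRealization {V : Type*} (G : SimpleGraph V) : Type _ :=
  V ⊕ (Σ _ : G.Dart, unitInterval)

/-- `V` carries the discrete topology, and `V ⊕ ⨁ [0,1]` the topology of the disjoint sum. -/
instance {V : Type*} (G : SimpleGraph V) : TopologicalSpace (PreRealization G) :=
  letI : TopologicalSpace V := ⊥
  inferInstanceAs (TopologicalSpace (V ⊕ (Σ _ : G.Dart, unitInterval)))

/-- The gluing: the copy of `[0,1]` of the dart `(v, w)` has `0` attached to `v` and `1` attached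
to `w`. The two copies that belong to the two directions of one edge are identified by
`t ↦ 1 - t`, so that every edge contributes exactly one interval and none of its two directions
has to be preferred. -/
inductive Glue {V : Type*} (G : SimpleGraph V) : PreRealization G → PreRealization G → Prop
  | zero (d : G.Dart) : Glue G (Sum.inr ⟨d, 0⟩) (Sum.inl d.fst)
  | one (d : G.Dart) : Glue G (Sum.inr ⟨d, 1⟩) (Sum.inl d.snd)
  | flip (d : G.Dart) (t : unitInterval) :
      Glue G (Sum.inr ⟨d.symm, unitInterval.symm t⟩) (Sum.inr ⟨d, t⟩)

/-- The 1-complex `|G|` of the graph `G`. -/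
def Realization {V : Type*} (G : SimpleGraph V) : Type _ := Quot (Glue G)

/-- `|G|` carries the quotient topology. -/
instance {V : Type*} (G : SimpleGraph V) : TopologicalSpace (Realization G) :=
  inferInstanceAs (TopologicalSpace (Quot (Glue G)))

/-- An arc in a space is a subspace homeomorphic to `[0,1]`. -/
def IsArc {X : Type*} [TopologicalSpace X] (A : Set X) : Prop :=
  Nonempty (unitInterval ≃ₜ A)

/-- `S` is `n`-arc connected in `X`: any at most `n` points of `S` lie on a common arc of `X`. -/
def IsNArcConnectedIn {X : Type*} [TopologicalSpace X] (S : Set X) (n : ℕ) : Prop :=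
  ∀ F : Finset X, (F : Set X) ⊆ S → F.card ≤ n → ∃ A : Set X, IsArc A ∧ (F : Set X) ⊆ A

/-- The graph `G` is `n`-ac: any at most `n` points of `|G|` lie on a common arc of `|G|`. -/
def IsNAc {V : Type*} (G : SimpleGraph V) (n : ℕ) : Prop :=
  IsNArcConnectedIn (Set.univ : Set (Realization G)) n

/-- `G` is connected, and so is `G` minus any single vertex (the empty graph that remains of a
one-vertex graph is counted as not disconnected). In particular `K₂` is 2-connected. -/
def IsTwoConnected {V : Type*} (G : SimpleGraph V) : Prop :=
  G.Connected ∧ ∀ v : V, (G.induce {v}ᶜ).Preconnected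

/-- `v` is a cut vertex of the connected graph `G`: removing it leaves a disconnected graph. -/
def IsCutVertex {V : Type*} (G : SimpleGraph V) (v : V) : Prop :=
  G.Connected ∧ ¬ (G.induce {v}ᶜ).Preconnected

/-- The connected graph `G` is a chain graph with links `L n`, `n ∈ J`, where `J` is a (finite or
infinite) interval of integers. In a connected graph a linearly ordered family of nonempty links
of which only consecutive ones meet is always indexed, up to an order isomorphism, by such an
interval. (The values `L n` for `n ∉ J` play no role.) -/
structure IsChain {V : Type*} (G : SimpleGraph V) (J : Set ℤ) (L : ℤ → G.Subgraph) : Prop where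
  connected : G.Connected
  interval : J.OrdConnected
  union : ⨆ n ∈ J, L n = ⊤
  consecutive : ∀ n ∈ J, n + 1 ∈ J → ∃ v : V, (L n).verts ∩ (L (n + 1)).verts = {v}
  nonconsecutive : ∀ m ∈ J, ∀ n ∈ J, m + 1 < n → Disjoint (L m).verts (L n).verts

/-- The subgraph `H` consists of one edge and its two ends. -/
def IsSingleEdge {V : Type*} {G : SimpleGraph V} (H : G.Subgraph) : Prop :=
  ∃ (v w : V) (h : G.Adj v w), H = G.subgraphOfAdj h

end GraphArc

/-! Sufficiency. Four points in one link lie on an arc of that link. If no link contains them all,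
every link contains at most three, and an arc is assembled along the chain: in each of the two
extreme links that matter, an arc that starts at the attaching cut vertex and collects the given
points there; in between, whole single edges. All rests on `exists_arcOn_from_vertex`: in a
2-connected 4-ac graph a vertex v of degree at most two is an end of an arc through any three
points.

For degree two, the three points become vertices p₁, p₂, p₃ by subdivision, and the claim concerns
paths in a graph without cut vertices. One starts with a cycle through v and p₁ and attaches p₂ and
p₃ by fans. Either a path from v through all three appears, or there are vertices c₁, c₂ joined by
four internally disjoint paths, one through each of v, p₁, p₂, p₃. If two of these four vertices are
still connected after deletion of c₁ and c₂, the extra connection yields the path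
(`FourPaths.reaches`). If not, c₁ and c₂ separate all four from each other, which 4-ac forbids: two
points cut an arc into at most three pieces (`Param.not_pairSeparates`).

Necessity. Three facts are read off the order of points on an injective curve: deleting a vertex
leaves at most two components (`IsNAc.two_sides`); a vertex has at most two edges into what it
separates from another vertex (`IsNAc.not_three_neighbors`); a cut vertex has at most one neighbour
on the side of another cut vertex (`IsNAc.eq_of_adj_of_adj`). Fix a cut vertex v₀ and let s be the
distance from v₀, with a sign for the side. By the third fact and induction, each level between 0
and the level of a cut vertex is a single cut vertex (`IsLevel.exists_cut`). So the cut vertices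
form a finite or infinite path; its edges are links, and what lies beyond a first or last cut vertex
is an end link. An end link is attached at one vertex only, so a simple curve between two of its
points cannot leave it, and it inherits 4-ac. -/

namespace GraphArc

open Set Topology unitInterval

universe u

/-! ### Barycentric coordinates on the 1-complex -/

section Realization

variable {V : Type*} {G : SimpleGraph V} {X : Type*}

/-- The point of `|G|` that belongs to a vertex. -/
def vert (G : SimpleGraph V) (v : V) : Realization G := Quot.mk _ (Sum.inl v)

/-- The point with parameter `t` on the copy of `[0,1]` of the dart `d`. -/
def edge (d : G.Dart) (t : I) : Realization G := Quot.mk _ (Sum.inr ⟨d, t⟩)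

theorem edge_zero (d : G.Dart) : edge d 0 = vert G d.fst := Quot.sound (Glue.zero d)

theorem edge_one (d : G.Dart) : edge d 1 = vert G d.snd := Quot.sound (Glue.one d)

theorem edge_symm (d : G.Dart) (t : I) : edge d.symm (σ t) = edge d t :=
  Quot.sound (Glue.flip d t)

theorem edge_symm' (d : G.Dart) (t : I) : edge d.symm t = edge d (σ t) := by
  rw [← edge_symm d (σ t), unitInterval.symm_symm]

theorem realization_cases (x : Realization G) :
    (∃ v, x = vert G v) ∨ ∃ d t, x = edge d t := by
  induction x using Quot.ind with
  | mk a =>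
    rcases a with v | ⟨d, t⟩
    · exact Or.inl ⟨v, rfl⟩
    · exact Or.inr ⟨d, t, rfl⟩

theorem realization_cases' (x : Realization G) :
    (∃ v, x = vert G v) ∨ ∃ d t, 0 < t ∧ t < 1 ∧ x = edge d t := by
  rcases realization_cases x with h | ⟨d, t, rfl⟩
  · exact Or.inl h
  · rcases eq_or_ne t 0 with rfl | h0
    · exact Or.inl ⟨_, edge_zero d⟩
    rcases eq_or_ne t 1 with rfl | h1
    · exact Or.inl ⟨_, edge_one d⟩
    exact Or.inr ⟨d, t, unitInterval.pos_iff_ne_zero.2 h0, unitInterval.lt_one_iff_ne_one.2 h1, rfl⟩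

theorem continuous_edge (d : G.Dart) : Continuous (edge d) := by
  let _ : TopologicalSpace V := ⊥
  have h1 : Continuous (fun t : I => (⟨d, t⟩ : Σ _ : G.Dart, I)) :=
    @continuous_sigmaMk G.Dart (fun _ => I) _ d
  have h2 : Continuous (Sum.inr : (Σ _ : G.Dart, I) → V ⊕ (Σ _ : G.Dart, I)) := continuous_inr
  have h3 : Continuous (Quot.mk (Glue G)) := continuous_quot_mk
  exact h3.comp (h2.comp h1)

theorem continuous_of_edge [TopologicalSpace X] {f : Realization G → X}
    (h : ∀ d, Continuous fun t => f (edge d t)) : Continuous f := by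
  have h3 : IsQuotientMap (Quot.mk (Glue G)) := isQuotientMap_quot_mk
  refine h3.continuous_iff.2 ?_
  let _ : TopologicalSpace V := ⊥
  have : DiscreteTopology V := ⟨rfl⟩
  have : Continuous (fun x : V ⊕ (Σ _ : G.Dart, I) => f (Quot.mk (Glue G) x)) := by
    refine continuous_sum_dom.2 ⟨continuous_of_discreteTopology, ?_⟩
    exact continuous_sigma h
  exact this

/-- A map on `|G|` given by its values on vertices and on edges. -/
def lift (f : V → X) (e : G.Dart → I → X) (h0 : ∀ d, e d 0 = f d.fst) (h1 : ∀ d, e d 1 = f d.snd)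
    (hs : ∀ d t, e d.symm (σ t) = e d t) : Realization G → X :=
  Quot.lift (Sum.elim f fun p => e p.1 p.2) (by
    intro a b h
    cases h with
    | zero d => exact h0 d
    | one d => exact h1 d
    | flip d t => exact hs d t)

open Classical in
/-- The barycentric coordinate of the vertex `v`. -/
noncomputable def bary (v : V) : Realization G → ℝ :=
  lift (fun u => if u = v then 1 else 0)
    (fun d t => (1 - t) * (if d.fst = v then 1 else 0) + t * (if d.snd = v then 1 else 0))
    (by intro d; simp) (by intro d; simp) (by
      intro d t
      by_cases h1 : d.fst = v <;> by_cases h2 : d.snd = v <;> simp [SimpleGraph.Dart.symm, h1, h2])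

open Classical in
theorem bary_vert (v u : V) : bary v (vert G u) = if u = v then 1 else 0 := rfl

open Classical in
theorem bary_edge (v : V) (d : G.Dart) (t : I) : bary v (edge d t) =
    (1 - t) * (if d.fst = v then 1 else 0) + t * (if d.snd = v then 1 else 0) := rfl

theorem continuous_bary (v : V) : Continuous (bary (G := G) v) := by
  refine continuous_of_edge fun d => ?_
  simp only [bary_edge]
  fun_prop

theorem bary_vert_pos {v u : V} : 0 < bary v (vert G u) ↔ u = v := by
  rw [bary_vert]; split_ifs <;> simp_all

theorem bary_fst (d : G.Dart) (t : I) : bary d.fst (edge d t) = 1 - t := by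
  rw [bary_edge]; simp [d.adj.ne']

theorem bary_snd (d : G.Dart) (t : I) : bary d.snd (edge d t) = t := by
  rw [bary_edge]; simp [d.adj.ne]

theorem bary_of_ne {d : G.Dart} {t : I} {v : V} (h1 : d.fst ≠ v) (h2 : d.snd ≠ v) :
    bary v (edge d t) = 0 := by
  rw [bary_edge]; simp [h1, h2]

theorem bary_nonneg (v : V) (x : Realization G) : 0 ≤ bary v x := by
  rcases realization_cases x with ⟨u, rfl⟩ | ⟨d, t, rfl⟩
  · rw [bary_vert]; split_ifs <;> simp
  · rw [bary_edge]
    have := t.2.1; have := t.2.2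
    split_ifs <;> simp_all

theorem bary_edge_pos {v : V} {d : G.Dart} {t : I} (h : 0 < bary v (edge d t)) :
    d.fst = v ∨ d.snd = v := by
  by_contra! hc
  rw [bary_of_ne hc.1 hc.2] at h
  exact h.false

theorem bary_edge_pos_iff {v : V} {d : G.Dart} {t : I} (h0 : 0 < t) (h1 : t < 1) :
    0 < bary v (edge d t) ↔ d.fst = v ∨ d.snd = v := by
  refine ⟨bary_edge_pos, ?_⟩
  have h1' : (t : ℝ) < 1 := h1
  have h0' : (0 : ℝ) < t := h0
  rintro (rfl | rfl)
  · rw [bary_fst]; linarith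
  · rw [bary_snd]; exact h0'

/-- Two points of `|G|` with the same coordinates are equal. -/
theorem bary_ext {x y : Realization G} (h : ∀ v, bary v x = bary v y) : x = y := by
  rcases realization_cases' x with ⟨u, rfl⟩ | ⟨d, t, h0, h1, rfl⟩
  · rcases realization_cases' y with ⟨w, rfl⟩ | ⟨e, s, g0, g1, rfl⟩
    · have := (bary_vert_pos (G := G)).1 (h u ▸ (bary_vert_pos (G := G)).2 rfl)
      rw [this]
    · have a := (bary_edge_pos_iff g0 g1).2 (Or.inl (rfl : e.fst = e.fst))
      have b := (bary_edge_pos_iff g0 g1).2 (Or.inr (rfl : e.snd = e.snd))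
      rw [← h, bary_vert_pos] at a b
      exact absurd (a.symm.trans b) e.adj.ne
  · rcases realization_cases' y with ⟨w, rfl⟩ | ⟨e, s, g0, g1, rfl⟩
    · have a := (bary_edge_pos_iff h0 h1).2 (Or.inl (rfl : d.fst = d.fst))
      have b := (bary_edge_pos_iff h0 h1).2 (Or.inr (rfl : d.snd = d.snd))
      rw [h, bary_vert_pos] at a b
      exact absurd (a.symm.trans b) d.adj.ne
    · have a := (bary_edge_pos_iff g0 g1).2 (Or.inl (rfl : e.fst = e.fst))
      have b := (bary_edge_pos_iff g0 g1).2 (Or.inr (rfl : e.snd = e.snd))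
      rw [← h, bary_edge_pos_iff h0 h1] at a b
      have hne := e.adj.ne
      have key : e = d ∨ e = d.symm := by
        rcases a with a | a <;> rcases b with b | b
        · exact absurd (a.symm.trans b) hne
        · exact Or.inl (SimpleGraph.Dart.ext _ _ (Prod.ext a.symm b.symm))
        · exact Or.inr (SimpleGraph.Dart.ext _ _ (Prod.ext a.symm b.symm))
        · exact absurd (a.symm.trans b) hne
      rcases key with rfl | rfl
      · have := h e.snd
        rw [bary_snd, bary_snd] at this
        rw [Subtype.ext this]
      · have := h d.snd
        rw [edge_symm', bary_snd, bary_snd] at this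
        rw [edge_symm', Subtype.ext this]

/-- The coordinates form a continuous injection into a product of copies of ℝ. It need not be an
embedding when degrees are infinite, but separating points is all that is needed. -/
instance : T2Space (Realization G) :=
  T2Space.of_injective_continuous (f := fun x v => bary v x)
    (fun _ _ h => bary_ext fun v => congrFun h v) (continuous_pi fun v => continuous_bary v)

theorem vert_injective : Function.Injective (vert G) := fun _ _ h =>
  (bary_vert_pos (G := G)).1 (h ▸ (bary_vert_pos (G := G)).2 rfl)

theorem edge_injective (d : G.Dart) : Function.Injective (edge d) := fun s t h => by
  have := congrArg (bary d.snd) h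
  rw [bary_snd, bary_snd] at this
  exact Subtype.ext this

theorem exists_bary_pos (x : Realization G) : ∃ v, 0 < bary v x := by
  rcases realization_cases' x with ⟨u, rfl⟩ | ⟨d, t, h0, h1, rfl⟩
  · exact ⟨u, bary_vert_pos.2 rfl⟩
  · exact ⟨d.fst, (bary_edge_pos_iff h0 h1).2 (Or.inl rfl)⟩

/-- Two different vertices with positive coordinate are adjacent. -/
theorem adj_of_bary_pos {x : Realization G} {u v : V} (hu : 0 < bary u x) (hv : 0 < bary v x)
    (h : u ≠ v) : G.Adj u v := by
  rcases realization_cases x with ⟨w, rfl⟩ | ⟨d, t, rfl⟩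
  · rw [bary_vert_pos] at hu hv
    exact absurd (hu.symm.trans hv) h
  · rcases bary_edge_pos hu with rfl | rfl <;> rcases bary_edge_pos hv with rfl | rfl
    · exact absurd rfl h
    · exact d.adj
    · exact d.adj.symm
    · exact absurd rfl h

/-- At most two coordinates are positive. -/
theorem eq_of_bary_pos {x : Realization G} {u v w : V} (hu : 0 < bary u x) (hv : 0 < bary v x)
    (hw : 0 < bary w x) (h : u ≠ v) : w = u ∨ w = v := by
  rcases realization_cases x with ⟨w, rfl⟩ | ⟨d, t, rfl⟩
  · rw [bary_vert_pos] at hu hv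
    exact absurd (hu.symm.trans hv) h
  · rcases bary_edge_pos hu with rfl | rfl <;> rcases bary_edge_pos hv with rfl | rfl <;>
      rcases bary_edge_pos hw with rfl | rfl <;> simp_all

theorem eq_vert_of_bary {x : Realization G} {v : V} (h : ∀ u, 0 < bary u x → u = v) :
    x = vert G v := by
  rcases realization_cases' x with ⟨u, rfl⟩ | ⟨d, t, h0, h1, rfl⟩
  · rw [h u (bary_vert_pos.2 rfl)]
  · exact absurd ((h _ ((bary_edge_pos_iff h0 h1).2 (Or.inl rfl))).trans
      (h _ ((bary_edge_pos_iff h0 h1).2 (Or.inr rfl))).symm) d.adj.ne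

end Realization

/-! ### Concatenating and reparametrising arcs -/

section Arcs

variable {X : Type*} [TopologicalSpace X] {Y : Type*} [TopologicalSpace Y]

/-- `A` is the image of an injective path from `a` to `b`. -/
def ArcOn (a b : X) (A : Set X) : Prop := ∃ γ : Path a b, Function.Injective γ ∧ range γ = A

theorem ArcOn.symm {a b : X} {A : Set X} (h : ArcOn a b A) : ArcOn b a A := by
  obtain ⟨γ, hi, rfl⟩ := h
  exact ⟨γ.symm, fun s t h => unitInterval.symm_bijective.injective (hi h), Path.symm_range γ⟩

theorem ArcOn.left_mem {a b : X} {A : Set X} (h : ArcOn a b A) : a ∈ A := by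
  obtain ⟨γ, hi, rfl⟩ := h
  exact ⟨0, γ.source⟩

theorem ArcOn.right_mem {a b : X} {A : Set X} (h : ArcOn a b A) : b ∈ A := h.symm.left_mem

theorem ArcOn.map {a b : X} {A : Set X} (h : ArcOn a b A) {f : X → Y} (hf : Continuous f)
    (hi : Function.Injective f) : ArcOn (f a) (f b) (f '' A) := by
  obtain ⟨γ, hγ, rfl⟩ := h
  refine ⟨γ.map hf, ?_, ?_⟩
  · exact hi.comp hγ
  · rw [← range_comp]; rfl

theorem ArcOn.trans {a b c : X} {A B : Set X} (h : ArcOn a b A) (h' : ArcOn b c B)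
    (hAB : ∀ x ∈ A, x ∈ B → x = b) : ArcOn a c (A ∪ B) := by
  obtain ⟨γ, hγ, rfl⟩ := h
  obtain ⟨δ, hδ, rfl⟩ := h'
  refine ⟨γ.trans δ, ?_, Path.trans_range γ δ⟩
  -- A coincidence between the two halves can only be the point `b`, which `δ` takes at time 0
  -- alone; that would force `t = 1/2`, a time counted with the first half.
  have aux : ∀ s t : I, (h : (s : ℝ) ≤ 1 / 2) → ¬ (t : ℝ) ≤ 1 / 2 →
      (γ.trans δ) s = (γ.trans δ) t → s = t := by
    intro s t hs ht h
    rw [Path.trans_apply, Path.trans_apply, dif_pos hs, dif_neg ht] at h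
    have h1 := hAB _ ⟨_, rfl⟩ ⟨_, h.symm⟩
    rw [h1] at h
    nth_rewrite 1 [← δ.source] at h
    have := congrArg Subtype.val (hδ h)
    simp at this
    exact absurd (by linarith) ht
  intro s t h
  by_cases hs : (s : ℝ) ≤ 1 / 2 <;> by_cases ht : (t : ℝ) ≤ 1 / 2
  · rw [Path.trans_apply, Path.trans_apply, dif_pos hs, dif_pos ht] at h
    have := congrArg Subtype.val (hγ h)
    simp at this
    exact Subtype.ext this
  · exact aux s t hs ht h
  · exact (aux t s ht hs h.symm).symm
  · rw [Path.trans_apply, Path.trans_apply, dif_neg hs, dif_neg ht] at h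
    have := congrArg Subtype.val (hδ h)
    simp at this
    exact Subtype.ext this

theorem isArc_range [T2Space X] {f : I → X} (hf : Continuous f) (hi : Function.Injective f) :
    IsArc (range f) :=
  ⟨(hf.isClosedEmbedding hi).isEmbedding.toHomeomorph⟩

theorem ArcOn.isArc [T2Space X] {a b : X} {A : Set X} (h : ArcOn a b A) : IsArc A := by
  obtain ⟨γ, hγ, rfl⟩ := h
  exact isArc_range γ.continuous hγ

theorem IsArc.exists_param {A : Set X} (h : IsArc A) :
    ∃ f : I → X, Continuous f ∧ Function.Injective f ∧ range f = A := by
  obtain ⟨e⟩ := h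
  refine ⟨fun t => e t, continuous_subtype_val.comp e.continuous,
    Subtype.val_injective.comp e.injective, ?_⟩
  rw [show (fun t => (e t : X)) = Subtype.val ∘ e from rfl, range_comp, e.surjective.range_eq]
  simp

/-- Reparametrisation: an injective map on a nontrivial part `[s, t]` of the unit interval
parametrises an arc. -/
theorem arcOn_of_injOn {f : I → X} (hf : Continuous f) {s t : I} (hst : s < t)
    (hi : InjOn f (Icc s t)) : ArcOn (f s) (f t) (f '' Icc s t) := by
  have hst' : (s : ℝ) < t := hst
  let g : I → I := fun r => ⟨s + r * (t - s), by
    have := s.2.1; have := t.2.2; have := r.2.1; have := r.2.2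
    constructor <;> nlinarith⟩
  have hg : Continuous g := by
    apply Continuous.subtype_mk
    fun_prop
  have hgi : Function.Injective g := by
    intro a b h
    have h1 := congrArg Subtype.val h
    simp only [g] at h1
    have : ((a : ℝ) - b) * (t - s) = 0 := by linarith
    rcases mul_eq_zero.1 this with h2 | h2
    · exact Subtype.ext (by linarith)
    · linarith
  have hgr : range g = Icc s t := by
    ext r
    constructor
    · rintro ⟨a, rfl⟩
      have := a.2.1; have := a.2.2
      constructor <;> change (_ : ℝ) ≤ _ <;> simp only [g] <;> nlinarith
    · rintro ⟨h1, h2⟩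
      have h1' : (s : ℝ) ≤ r := h1
      have h2' : (r : ℝ) ≤ t := h2
      refine ⟨⟨(r - s) / (t - s), ⟨div_nonneg (by linarith) (by linarith),
        (div_le_one (by linarith)).2 (by linarith)⟩⟩, Subtype.ext ?_⟩
      simp only [g]
      rw [div_mul_cancel₀ _ (by linarith)]; ring
  have hs : g 0 = s := Subtype.ext (by simp [g])
  have ht : g 1 = t := Subtype.ext (by simp [g])
  refine ⟨⟨⟨f ∘ g, hf.comp hg⟩, by simp [hs], by simp [ht]⟩, ?_, ?_⟩
  · intro a b h
    exact hgi (hi (hgr ▸ ⟨a, rfl⟩) (hgr ▸ ⟨b, rfl⟩) h)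
  · rw [← hgr, ← range_comp]; rfl

/-- A path from inside `W` to outside `W` meets the boundary `Z` of `W`. -/
theorem hits_boundary {f : I → X} (hf : Continuous f) {W Z : Set X} (hW : IsOpen W)
    (hZ : IsOpen (W ∪ Z)ᶜ) {s t : I} (hs : f s ∈ W) (ht : f t ∉ W) :
    ∃ r ∈ uIcc s t, f r ∈ Z := by
  by_contra! hc
  have hp : IsPreconnected (f '' uIcc s t) := isPreconnected_uIcc.image f hf.continuousOn
  obtain ⟨z, _, hz1, hz2⟩ := hp W (W ∪ Z)ᶜ hW hZ (by
      rintro _ ⟨r, hr, rfl⟩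
      by_cases h : f r ∈ W
      · exact Or.inl h
      · refine Or.inr fun h' => ?_
        rcases h' with h' | h'
        · exact h h'
        · exact hc r hr h')
    ⟨_, ⟨s, left_mem_uIcc, rfl⟩, hs⟩
    ⟨_, ⟨t, right_mem_uIcc, rfl⟩, fun h' => by
      rcases h' with h' | h'
      · exact ht h'
      · exact hc t right_mem_uIcc h'⟩
  exact hz2 (Or.inl hz1)

end Arcs

/-! ### Paths recorded by their vertex sets, separation, and the fan lemma -/

section Paths

variable {V : Type*} {G : SimpleGraph V}

/-- `PathOn G a b S`: there is a path in `G` from `a` to `b` whose set of vertices is `S`. -/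
inductive PathOn (G : SimpleGraph V) : V → V → Set V → Prop
  | single (a : V) : PathOn G a a {a}
  | cons {a b c : V} {S : Set V} (h : G.Adj a b) (ha : a ∉ S) (p : PathOn G b c S) :
      PathOn G a c (insert a S)

theorem PathOn.left_mem {a b : V} {S : Set V} (h : PathOn G a b S) : a ∈ S := by
  cases h <;> simp

theorem PathOn.right_mem {a b : V} {S : Set V} (h : PathOn G a b S) : b ∈ S := by
  induction h with
  | single a => simp
  | cons h ha p ih => exact Or.inr ih

theorem PathOn.trans {a b c : V} {S T : Set V} (h : PathOn G a b S) (h' : PathOn G b c T)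
    (hd : ∀ z ∈ S, z ∈ T → z = b) : PathOn G a c (S ∪ T) := by
  induction h with
  | single a =>
    have := h'.left_mem
    rwa [show ({a} : Set V) ∪ T = T by ext; simp; grind]
  | cons h ha p ih =>
    rename_i a b d S
    rw [insert_union]
    refine PathOn.cons h ?_ (ih h' fun z hz => hd z (Or.inr hz))
    have := p.right_mem
    have := hd a (Or.inl rfl)
    grind

theorem PathOn.pair {a b : V} (h : G.Adj a b) : PathOn G a b {a, b} :=
  PathOn.cons h (by simpa using h.ne) (PathOn.single b)

theorem PathOn.symm {a b : V} {S : Set V} (h : PathOn G a b S) : PathOn G b a S := by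
  induction h with
  | single a => exact PathOn.single a
  | cons h ha p ih =>
    rename_i a b d S
    have := p.left_mem
    have h1 := ih.trans (PathOn.pair h.symm) (by
      intro z hz hz'
      rcases hz' with rfl | rfl
      · rfl
      · exact absurd hz ha)
    rwa [show S ∪ {b, a} = insert a S by ext; simp; grind] at h1

theorem PathOn.split {a b c : V} {S : Set V} (h : PathOn G a b S) (hc : c ∈ S) :
    ∃ S₁ S₂, PathOn G a c S₁ ∧ PathOn G c b S₂ ∧ S = S₁ ∪ S₂ ∧ ∀ z ∈ S₁, z ∈ S₂ → z = c := by
  induction h with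
  | single a =>
    obtain rfl : c = a := hc
    exact ⟨_, _, PathOn.single c, PathOn.single c, by simp, by simp⟩
  | cons h ha p ih =>
    rename_i a b d S
    rcases hc with rfl | hc
    · exact ⟨_, _, PathOn.single c, PathOn.cons h ha p, by simp, by simp⟩
    · obtain ⟨S₁, S₂, h1, h2, rfl, h3⟩ := ih hc
      refine ⟨insert a S₁, S₂, PathOn.cons h (fun h' => ha (Or.inl h')) h1, h2,
        insert_union.symm, ?_⟩
      rintro z (rfl | hz) hz'
      · exact absurd (Or.inr hz') ha
      · exact h3 z hz hz'

/-- The part of a path up to its first vertex in `C`. -/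
theorem PathOn.firstHit {a b : V} {S : Set V} (h : PathOn G a b S) {C : Set V} (hb : b ∈ C) :
    ∃ c ∈ C, ∃ T ⊆ S, PathOn G a c T ∧ ∀ z ∈ T, z ∈ C → z = c := by
  induction h with
  | single a => exact ⟨a, hb, _, subset_rfl, PathOn.single a, by simp⟩
  | cons h ha p ih =>
    rename_i a b d S
    by_cases haC : a ∈ C
    · exact ⟨a, haC, {a}, by simp, PathOn.single a, by simp⟩
    · obtain ⟨c, hc, T, hT, hp, hz⟩ := ih hb
      refine ⟨c, hc, insert a T, insert_subset_insert hT,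
        PathOn.cons h (fun h' => ha (hT h')) hp, ?_⟩
      rintro z (rfl | h') hzC
      · exact absurd hzC haC
      · exact hz z h' hzC

/-- `a` and `b` are joined by a walk in `G - S`. -/
def JoinedOff (G : SimpleGraph V) (S : Set V) : V → V → Prop :=
  Relation.ReflTransGen fun a b => G.Adj a b ∧ a ∉ S ∧ b ∉ S

theorem JoinedOff.symm {S : Set V} {a b : V} (h : JoinedOff G S a b) : JoinedOff G S b a := by
  induction h with
  | refl => exact Relation.ReflTransGen.refl
  | tail _ h ih => exact Relation.ReflTransGen.head ⟨h.1.symm, h.2.2, h.2.1⟩ ih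

theorem JoinedOff.trans {S : Set V} {a b c : V} (h : JoinedOff G S a b)
    (h' : JoinedOff G S b c) : JoinedOff G S a c := Relation.ReflTransGen.trans h h'

theorem JoinedOff.adj {S : Set V} {a b : V} (h : G.Adj a b) (ha : a ∉ S) (hb : b ∉ S) :
    JoinedOff G S a b := Relation.ReflTransGen.single ⟨h, ha, hb⟩

theorem JoinedOff.closed {S C : Set V} {a b : V} (h : JoinedOff G S a b)
    (hC : ∀ x y, G.Adj x y → x ∉ S → y ∉ S → x ∈ C → y ∈ C) (ha : a ∈ C) : b ∈ C := by
  induction h with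
  | refl => exact ha
  | tail _ h ih => exact hC _ _ h.1 h.2.1 h.2.2 ih

theorem JoinedOff.notMem {S : Set V} {a b : V} (h : JoinedOff G S a b) (ha : a ∉ S) : b ∉ S :=
  h.closed (C := Sᶜ) (fun _ _ _ _ h _ => h) ha

theorem JoinedOff.exists_path {S : Set V} {a b : V} (h : JoinedOff G S a b) (ha : a ∉ S) :
    ∃ T, PathOn G a b T ∧ ∀ z ∈ T, z ∉ S := by
  induction h using Relation.ReflTransGen.head_induction_on with
  | refl => exact ⟨_, PathOn.single _, by simpa using ha⟩
  | head h h' ih =>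
    rename_i a c
    obtain ⟨T, hT, hTS⟩ := ih h.2.2
    by_cases haT : a ∈ T
    · obtain ⟨T₁, T₂, -, h2, rfl, -⟩ := hT.split haT
      exact ⟨T₂, h2, fun z hz => hTS z (Or.inr hz)⟩
    · refine ⟨_, PathOn.cons h.1 haT hT, ?_⟩
      rintro z (rfl | hz)
      · exact ha
      · exact hTS z hz

/-- No vertex separates two others. -/
def NoCut (G : SimpleGraph V) : Prop := ∀ x a b, a ≠ x → b ≠ x → JoinedOff G {x} a b

/-- Two paths from `p` to `C` that have only `p` in common. -/
def HasFan (G : SimpleGraph V) (p : V) (C : Set V) : Prop :=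
  ∃ d₁ d₂ D₁ D₂, d₁ ∈ C ∧ d₂ ∈ C ∧ d₁ ≠ d₂ ∧ PathOn G p d₁ D₁ ∧ PathOn G p d₂ D₂ ∧
    (∀ z ∈ D₁, z ∈ C → z = d₁) ∧ (∀ z ∈ D₂, z ∈ C → z = d₂) ∧ ∀ z ∈ D₁, z ∈ D₂ → z = p

/-- A fan of `q` is moved to its neighbour `p`. The leg `D₁` is entered at `y` by the detour `R`,
which avoids `q`; the other leg is reached through the edge `pq`. Since `q ∉ R`, the vertex `y` is
not `q`, so the new legs share only `p`. -/
theorem hasFan_step {p q d₁ d₂ : V} {C D₁ D₂ R : Set V} (hpq : G.Adj p q) (hp : p ∉ C)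
    (h1 : d₁ ∈ C) (h2 : d₂ ∈ C) (hne : d₁ ≠ d₂) (hD1 : PathOn G q d₁ D₁) (hD2 : PathOn G q d₂ D₂)
    (hC1 : ∀ z ∈ D₁, z ∈ C → z = d₁) (hC2 : ∀ z ∈ D₂, z ∈ C → z = d₂)
    (hD : ∀ z ∈ D₁, z ∈ D₂ → z = q) {y : V} (hy : y ∈ D₁) (hR : PathOn G p y R)
    (hRD : ∀ z ∈ R, z ∈ C ∪ D₁ ∪ D₂ → z = y) (hq : q ∉ R) : HasFan G p C := by
  obtain ⟨E₁, E₂, hE1, hE2, rfl, hE⟩ := hD1.split hy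
  have hpD2 : p ∉ D₂ := by
    intro h
    have := hRD p hR.left_mem (Or.inr h)
    have := hR.left_mem
    grind
  have := hR.right_mem
  have := hE2.left_mem
  refine ⟨d₁, d₂, R ∪ E₂, insert p D₂, h1, h2, hne, hR.trans hE2 (by grind),
    PathOn.cons hpq hpD2 hD2, by grind, by grind, ?_⟩
  have : q ∉ E₂ := by
    intro h
    have := hE1.left_mem
    grind
  grind

/-- This is the case of two paths of Menger's theorem, by induction along a path from `p` to `C`:
the fan of the second vertex `q` of that path is turned into a fan of `p` with the help of a path
that avoids `q`. -/
theorem hasFan {p : V} {C : Set V} (hG : NoCut G) (hp : p ∉ C) {c c' : V} (hc : c ∈ C)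
    (hc' : c' ∈ C) (hne : c ≠ c') : HasFan G p C := by
  have key : ∀ (p e : V) (S : Set V), PathOn G p e S → e ∈ C → p ∉ C → HasFan G p C := by
    intro p e S h
    induction h with
    | single a => intro h h'; exact absurd h h'
    | cons h ha P ih =>
      rename_i p q e S
      intro he hp
      -- If `q` is in `C`, the edge `pq` is one leg, and a path from `p` to another vertex of `C`
      -- that avoids `q` contains the other.
      by_cases hq : q ∈ C
      · obtain ⟨w, hw, hwq⟩ : ∃ w ∈ C, w ≠ q := by
          by_cases hcq : c = q
          · exact ⟨c', hc', fun h => hne (hcq.trans h.symm)⟩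
          · exact ⟨c, hc, hcq⟩
        obtain ⟨T, hT, hTq⟩ := (hG q p w h.ne hwq).exists_path (by simpa using h.ne)
        obtain ⟨d, hd, R, hR, hpR, hRC⟩ := hT.firstHit hw
        refine ⟨q, d, _, R, hq, hd, ?_, PathOn.pair h, hpR, ?_, hRC, ?_⟩
        · rintro rfl
          exact hTq _ (hR hpR.right_mem) rfl
        · grind
        · rintro z (rfl | rfl) hz
          · rfl
          · exact absurd rfl (hTq _ (hR hz))
      · obtain ⟨d₁, d₂, D₁, D₂, h1, h2, hne', hD1, hD2, hC1, hC2, hD⟩ := ih he hq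
        have hd1q : d₁ ≠ q := fun h' => hq (h' ▸ h1)
        obtain ⟨T, hT, hTq⟩ := (hG q p d₁ h.ne hd1q).exists_path (by simpa using h.ne)
        obtain ⟨y, hy, R, hR, hpR, hRC⟩ :=
          hT.firstHit (C := C ∪ D₁ ∪ D₂) (Or.inl (Or.inl h1))
        have hqR : q ∉ R := fun h' => hTq _ (hR h') rfl
        by_cases hy1 : y ∈ D₁
        · exact hasFan_step h hp h1 h2 hne' hD1 hD2 hC1 hC2 hD hy1 hpR hRC hqR
        by_cases hy2 : y ∈ D₂
        · exact hasFan_step h hp h2 h1 hne'.symm hD2 hD1 hC2 hC1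
            (fun z hz hz' => hD z hz' hz) hy2 hpR (by grind) hqR
        -- The detour reaches `C` before it meets the fan of `q`, so it is a leg itself, and the
        -- edge `pq` followed by `D₁` is the other.
        have hyC : y ∈ C := by grind
        have := hD1.left_mem
        have := hD1.right_mem
        have := hpR.left_mem
        have := hpR.right_mem
        have hpD : p ∉ D₁ := by grind
        refine ⟨d₁, y, insert p D₁, R, h1, hyC, by grind, PathOn.cons h hpD hD1, hpR,
          by grind, by grind, by grind⟩
  -- `NoCut` only provides walks that avoid some vertex, so an initial path from `p` to `c` requires
  -- a third vertex; `c'` is one.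
  by_cases hpc : p = c
  · exact absurd (hpc ▸ hc) hp
  by_cases hcc : ∃ x, x ≠ p ∧ x ≠ c
  · obtain ⟨x, hx, hx'⟩ := hcc
    obtain ⟨T, hT, -⟩ := (hG x p c hx.symm hx'.symm).exists_path (by simpa using hx.symm)
    exact key p c T hT hc hp
  · push Not at hcc
    exact absurd (hcc c' fun h => hp (h ▸ hc')) hne.symm

end Paths

/-! ### Paths that start at a vertex of degree two: the case of a cycle -/

section FromVertex

variable {V : Type*} {G : SimpleGraph V}

/-- Some path of `G` that starts at `v` contains `p₁`, `p₂` and `p₃`. -/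
def Reaches (G : SimpleGraph V) (v p₁ p₂ p₃ : V) : Prop :=
  ∃ z S, PathOn G v z S ∧ p₁ ∈ S ∧ p₂ ∈ S ∧ p₃ ∈ S

theorem Reaches.perm {v p₁ p₂ p₃ : V} (h : Reaches G v p₁ p₂ p₃) : Reaches G v p₂ p₁ p₃ := by
  obtain ⟨z, S, h, h1, h2, h3⟩ := h
  exact ⟨z, S, h, h2, h1, h3⟩

theorem Reaches.perm' {v p₁ p₂ p₃ : V} (h : Reaches G v p₁ p₂ p₃) : Reaches G v p₁ p₃ p₂ := by
  obtain ⟨z, S, h, h1, h2, h3⟩ := h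
  exact ⟨z, S, h, h1, h3, h2⟩

/-- The vertex `v` has exactly the two neighbours `x` and `y`. -/
structure HasTwoNeighbors (G : SimpleGraph V) (v x y : V) : Prop where
  left : G.Adj v x
  right : G.Adj v y
  ne : x ≠ y
  eq : ∀ u, G.Adj v u → u = x ∨ u = y

theorem HasTwoNeighbors.symm {v x y : V} (h : HasTwoNeighbors G v x y) :
    HasTwoNeighbors G v y x := ⟨h.right, h.left, h.ne.symm, fun u hu => (h.eq u hu).symm⟩

variable {v x y p₁ p₂ p₃ : V}

theorem HasTwoNeighbors.reaches (hv : HasTwoNeighbors G v x y) {z : V} {S : Set V}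
    (hS : PathOn G x z S) (hvS : v ∉ S) (h1 : p₁ ∈ insert v S) (h2 : p₂ ∈ insert v S)
    (h3 : p₃ ∈ insert v S) : Reaches G v p₁ p₂ p₃ :=
  ⟨z, _, PathOn.cons hv.left hvS hS, h1, h2, h3⟩

theorem PathOn.exists_penultimate {a b : V} {S : Set V} (h : PathOn G a b S) (hab : a ≠ b) :
    ∃ u ∈ S, u ≠ b ∧ G.Adj u b := by
  induction h with
  | single a => exact absurd rfl hab
  | cons h ha p ih =>
    rename_i a b c S
    by_cases hbc : b = c
    · subst hbc
      exact ⟨a, Or.inl rfl, hab, h⟩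
    · obtain ⟨u, hu, h1, h2⟩ := ih hbc
      exact ⟨u, Or.inr hu, h1, h2⟩

/-- A leg that ended at `v` would come through `x` or `y`, which are in `C`, so it would have ended
there. Hence new vertices can be attached without touching `v`. -/
theorem HasTwoNeighbors.hasFan (hv : HasTwoNeighbors G v x y) (hG : NoCut G) {p : V} {C : Set V}
    (hvC : v ∈ C) (hx : x ∈ C) (hy : y ∈ C) (hp : p ∉ C) :
    ∃ d₁ d₂ D₁ D₂, d₁ ∈ C ∧ d₂ ∈ C ∧ d₁ ≠ d₂ ∧ PathOn G p d₁ D₁ ∧ PathOn G p d₂ D₂ ∧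
    (∀ z ∈ D₁, z ∈ C → z = d₁) ∧ (∀ z ∈ D₂, z ∈ C → z = d₂) ∧ (∀ z ∈ D₁, z ∈ D₂ → z = p) ∧
    d₁ ≠ v ∧ d₂ ≠ v := by
  obtain ⟨d₁, d₂, D₁, D₂, h1, h2, hne, hD1, hD2, hC1, hC2, hD⟩ := GraphArc.hasFan hG hp hx hy hv.ne
  have key : ∀ (d : V) (D : Set V), d ∈ C → PathOn G p d D → (∀ z ∈ D, z ∈ C → z = d) → d ≠ v := by
    rintro d D hd hD hC rfl
    obtain ⟨u, hu, hud, hadj⟩ := hD.exists_penultimate (by rintro rfl; exact hp hd)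
    rcases hv.eq u hadj.symm with rfl | rfl
    · exact hud (hC _ hu hx)
    · exact hud (hC _ hu hy)
  exact ⟨d₁, d₂, D₁, D₂, h1, h2, hne, hD1, hD2, hC1, hC2, hD, key _ _ h1 hD1 hC1,
    key _ _ h2 hD2 hC2⟩

/-- Together with `v` this path closes up to a cycle through `v` and `p`. It consists of the two
legs of a fan from `p` to `{v, x, y}`, whose ends must be `x` and `y`. -/
theorem HasTwoNeighbors.exists_path (hv : HasTwoNeighbors G v x y) (hG : NoCut G) (p : V)
    (hp : p ≠ v) : ∃ S, PathOn G x y S ∧ v ∉ S ∧ p ∈ S := by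
  by_cases hxy : p = x ∨ p = y
  · obtain ⟨S, hS, hvS⟩ := (hG v x y hv.left.ne' hv.right.ne').exists_path
      (by simpa using hv.left.ne')
    refine ⟨S, hS, fun h => hvS v h rfl, ?_⟩
    rcases hxy with rfl | rfl
    · exact hS.left_mem
    · exact hS.right_mem
  · obtain ⟨d₁, d₂, D₁, D₂, h1, h2, hne, hD1, hD2, hC1, hC2, hD, hn1, hn2⟩ :=
      hv.hasFan hG (p := p) (C := {v, x, y}) (by simp) (by simp) (by simp)
        (by simp [hp]; tauto)
    have hvD1 : v ∉ D₁ := fun h => hn1 (hC1 v h (by simp)).symm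
    have hvD2 : v ∉ D₂ := fun h => hn2 (hC2 v h (by simp)).symm
    have e1 : d₁ = x ∨ d₁ = y := by grind
    have e2 : d₂ = x ∨ d₂ = y := by grind
    have := hD1.left_mem
    rcases e1 with rfl | rfl
    · obtain rfl : d₂ = y := by grind
      exact ⟨_, hD1.symm.trans hD2 hD, by grind, by grind⟩
    · obtain rfl : d₂ = x := by grind
      exact ⟨_, hD2.symm.trans hD1 (by grind), by grind, by grind⟩

theorem HasTwoNeighbors.reaches_extend (hv : HasTwoNeighbors G v x y) {d : V} {A D : Set V}
    (hA : PathOn G x d A) (hD : PathOn G p₃ d D) (hvA : v ∉ A) (hvD : v ∉ D)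
    (hAD : ∀ z ∈ D, z ∈ A → z = d) (h1 : p₁ ∈ A) (h2 : p₂ ∈ A) : Reaches G v p₁ p₂ p₃ := by
  have := hD.left_mem
  exact hv.reaches (hA.trans hD.symm (by grind)) (by grind) (by grind) (by grind) (by grind)

/-- The cycle through `v` runs along `H`, `M`, `T`, and `p₃` sits on a handle from `d₁` to `d₂`. A
path from `v` may follow the cycle in either direction and finish on the handle, or replace `M` by
the handle. -/
theorem HasTwoNeighbors.reaches_of_handle (hv : HasTwoNeighbors G v x y) {d₁ d₂ : V}
    {D₁ D₂ H M T : Set V} (hH : PathOn G x d₁ H) (hM : PathOn G d₁ d₂ M) (hT : PathOn G d₂ y T)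
    (hHM : ∀ z ∈ H, z ∈ M → z = d₁) (hMT : ∀ z ∈ M, z ∈ T → z = d₂) (hHT : ∀ z ∈ H, z ∉ T)
    (hD1 : PathOn G p₃ d₁ D₁) (hD2 : PathOn G p₃ d₂ D₂)
    (hC1 : ∀ z ∈ D₁, z ∈ H ∪ M ∪ T → z = d₁) (hC2 : ∀ z ∈ D₂, z ∈ H ∪ M ∪ T → z = d₂)
    (hD : ∀ z ∈ D₁, z ∈ D₂ → z = p₃) (hv1 : v ∉ D₁) (hv2 : v ∉ D₂) (hvS : v ∉ H ∪ M ∪ T)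
    (h1 : p₁ ∈ H ∪ M ∪ T) (h2 : p₂ ∈ H ∪ M ∪ T) : Reaches G v p₁ p₂ p₃ := by
  have hm := hD1.left_mem
  have hHM' : PathOn G x d₂ (H ∪ M) := hH.trans hM hHM
  have hm1 := hM.left_mem
  have hm2 := hM.right_mem
  have hm3 := hT.left_mem
  have hm4 := hH.right_mem
  by_cases a : p₁ ∈ H ∪ M ∧ p₂ ∈ H ∪ M
  · exact hv.reaches_extend hHM' hD2 (by grind) hv2 (by grind) a.1 a.2
  by_cases b : p₁ ∈ M ∪ T ∧ p₂ ∈ M ∪ T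
  · exact hv.symm.reaches_extend (hM.trans hT hMT).symm hD1 (by grind) hv1 (by grind) b.1 b.2
  -- Now one of `p₁`, `p₂` lies outside `M ∪ T` and the other outside `H ∪ M`, so neither is on `M`
  -- and the handle can replace it.
  exact hv.reaches ((hH.trans hD1.symm (by grind)).trans (hD2.trans hT (by grind)) (by grind))
      (by grind) (by grind) (by grind) (by grind)

/-- A path between the two neighbours of `v` that contains `p₁` and `p₂`. -/
theorem HasTwoNeighbors.reaches_of_path (hv : HasTwoNeighbors G v x y) (hG : NoCut G) {S : Set V}
    (hS : PathOn G x y S) (hvS : v ∉ S) (h1 : p₁ ∈ S) (h2 : p₂ ∈ S) : Reaches G v p₁ p₂ p₃ := by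
  by_cases h3 : p₃ ∈ insert v S
  · exact hv.reaches hS hvS (Or.inr h1) (Or.inr h2) h3
  have hxS := hS.left_mem
  have hyS := hS.right_mem
  obtain ⟨d₁, d₂, D₁, D₂, hd1, hd2, hne, hD1, hD2, hC1, hC2, hD, hn1, hn2⟩ :=
    hv.hasFan hG (p := p₃) (C := insert v S) (by simp) (by simp [hxS]) (by simp [hyS]) h3
  have hvD1 : v ∉ D₁ := fun h => hn1 (hC1 v h (by simp)).symm
  have hvD2 : v ∉ D₂ := fun h => hn2 (hC2 v h (by simp)).symm
  replace hd1 : d₁ ∈ S := by grind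
  replace hd2 : d₂ ∈ S := by grind
  obtain ⟨H, T, hH, hT, rfl, hHT⟩ := hS.split hd1
  by_cases hd2T : d₂ ∈ T
  · obtain ⟨M, T', hM, hT', rfl, hMT⟩ := hT.split hd2T
    have hM1 := hM.left_mem
    exact hv.reaches_of_handle hH hM hT' (by grind) hMT (by grind) hD1 hD2 (by grind) (by grind)
      hD hvD1 hvD2 (by grind) (by grind) (by grind)
  · have hd2H : d₂ ∈ H := by grind
    obtain ⟨H', M, hH', hM, rfl, hMT⟩ := hH.split hd2H
    have hM1 := hM.right_mem
    exact hv.reaches_of_handle hH' hM hT hMT (by grind) (by grind) hD2 hD1 (by grind) (by grind)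
      (by grind) hvD2 hvD1 (by grind) (by grind) (by grind)

end FromVertex

/-! ### Theta graphs, four parallel paths, and the exceptional separating pair -/

section ThetaGraphs

variable {V : Type*} {G : SimpleGraph V}

/-- Two paths `P₁ ∋ p₁` and `P₂ ∋ p₂` from `c₁` to `c₂`, a path `X` from `x` to `c₁` and a path `Y`
from `y` to `c₂`, all disjoint up to `c₁` and `c₂`, and none of them through `v`. -/
structure Theta (G : SimpleGraph V) (v x y c₁ c₂ p₁ p₂ : V) (X Y P₁ P₂ : Set V) : Prop where
  hX : PathOn G x c₁ X
  hY : PathOn G y c₂ Y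
  h1 : PathOn G c₁ c₂ P₁
  h2 : PathOn G c₁ c₂ P₂
  XY : ∀ z ∈ X, z ∉ Y
  X1 : ∀ z ∈ X, z ∈ P₁ → z = c₁
  X2 : ∀ z ∈ X, z ∈ P₂ → z = c₁
  Y1 : ∀ z ∈ Y, z ∈ P₁ → z = c₂
  Y2 : ∀ z ∈ Y, z ∈ P₂ → z = c₂
  P12 : ∀ z ∈ P₁, z ∈ P₂ → z = c₁ ∨ z = c₂
  m1 : p₁ ∈ P₁
  m2 : p₂ ∈ P₂
  n1 : p₁ ≠ c₁ ∧ p₁ ≠ c₂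
  n2 : p₂ ≠ c₁ ∧ p₂ ≠ c₂
  hv : v ∉ X ∪ Y ∪ P₁ ∪ P₂

variable {v x y c₁ c₂ p₁ p₂ p₃ : V} {X Y P₁ P₂ P₃ : Set V}

theorem Theta.flip (h : Theta G v x y c₁ c₂ p₁ p₂ X Y P₁ P₂) :
    Theta G v y x c₂ c₁ p₁ p₂ Y X P₁ P₂ := by
  have := h.XY
  have := h.P12
  have := h.hv
  exact ⟨h.hY, h.hX, h.h1.symm, h.h2.symm, by grind, h.Y1, h.Y2, h.X1, h.X2, by grind, h.m1, h.m2,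
    h.n1.symm, h.n2.symm, by grind⟩

theorem Theta.swap (h : Theta G v x y c₁ c₂ p₁ p₂ X Y P₁ P₂) :
    Theta G v x y c₁ c₂ p₂ p₁ X Y P₂ P₁ := by
  have := h.XY
  have := h.P12
  have := h.hv
  exact ⟨h.hX, h.hY, h.h2, h.h1, h.XY, h.X2, h.X1, h.Y2, h.Y1, by grind, h.m2, h.m1, h.n2, h.n1,
    by grind⟩

theorem Theta.ne (h : Theta G v x y c₁ c₂ p₁ p₂ X Y P₁ P₂) : c₁ ≠ c₂ := by
  rintro rfl
  exact h.XY _ h.hX.right_mem h.hY.right_mem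

theorem Theta.exists_first (h : Theta G v x y c₁ c₂ p₁ p₂ X Y P₁ P₂) :
    ∃ B ⊆ P₂, PathOn G c₁ p₂ B ∧ c₂ ∉ B := by
  obtain ⟨A, B, hA, hB, rfl, hAB⟩ := h.h2.split h.m2
  have := hB.right_mem
  have := h.n2
  exact ⟨A, by grind, hA, by grind⟩

/-- From `d` one of the two directions along `P₂` leads through `p₂` to a branch vertex. The path
goes from `v` to the opposite branch vertex, along `P₁`, back along that piece of `P₂` to `d`, and
on to `p₃`. -/
theorem Theta.reaches_interior (h : Theta G v x y c₁ c₂ p₁ p₂ X Y P₁ P₂)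
    (hv : HasTwoNeighbors G v x y) {d : V} {D : Set V} (hD : PathOn G p₃ d D) (hvD : v ∉ D)
    (hC : ∀ z ∈ D, z ∈ X ∪ Y ∪ P₁ ∪ P₂ → z = d) (hd : d ∈ P₂) (hd1 : d ≠ c₁) (hd2 : d ≠ c₂) :
    Reaches G v p₁ p₂ p₃ := by
  have main : ∀ {x y c₁ c₂ : V} {X Y A : Set V}, Theta G v x y c₁ c₂ p₁ p₂ X Y P₁ P₂ →
      HasTwoNeighbors G v x y → (∀ z ∈ D, z ∈ X ∪ Y ∪ P₁ ∪ P₂ → z = d) →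
      PathOn G d c₂ A → A ⊆ P₂ → c₁ ∉ A → p₂ ∈ A → Reaches G v p₁ p₂ p₃ := by
    intro x y c₁ c₂ X Y A h hv hC hA hAP hc hp
    obtain ⟨hX, hY, h1, h2, XY, X1, X2, Y1, Y2, P12, m1, m2, n1, n2, hv'⟩ := h
    exact hv.reaches_extend ((hX.trans h1 X1).trans hA.symm (by grind)) hD (by grind) hvD
      (by grind) (by grind) (by grind)
  obtain ⟨A, B, hA, hB, hP, hAB⟩ := h.h2.split hd
  have hc1 := hA.left_mem
  have hc2 := hB.right_mem
  rcases (hP ▸ h.m2 : p₂ ∈ A ∪ B) with hp | hp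
  · exact main h.flip hv.symm (by grind) hA.symm (by grind) (by grind) hp
  · exact main h hv hC hB (by grind) (by grind) hp

/-- Follow `X` and `P₁` completely, then `P₂` backwards from `c₂` as far as `p₂`. -/
theorem Theta.reaches_left (h : Theta G v x y c₁ c₂ p₁ p₂ X Y P₁ P₂)
    (hv : HasTwoNeighbors G v x y) (h3 : p₃ ∈ X) : Reaches G v p₁ p₂ p₃ := by
  obtain ⟨B, hBP, hB, hc⟩ := h.flip.exists_first
  obtain ⟨hX, hY, h1, h2, XY, X1, X2, Y1, Y2, P12, m1, m2, n1, n2, hv'⟩ := h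
  have := hB.right_mem
  exact hv.reaches ((hX.trans h1 X1).trans hB (by grind)) (by grind) (by grind) (by grind)
    (by grind)

/-- The segment of `X` between `d₁` and `d₂` is replaced by the detour through `p₃`; then the route
is the one for `p₃ ∈ X`. -/
theorem Theta.reaches_left_left (h : Theta G v x y c₁ c₂ p₁ p₂ X Y P₁ P₂)
    (hv : HasTwoNeighbors G v x y) {d₁ d₂ : V} {D₁ D₂ : Set V} (hD1 : PathOn G p₃ d₁ D₁)
    (hD2 : PathOn G p₃ d₂ D₂) (hv1 : v ∉ D₁) (hv2 : v ∉ D₂)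
    (hC1 : ∀ z ∈ D₁, z ∈ X ∪ Y ∪ P₁ ∪ P₂ → z = d₁) (hC2 : ∀ z ∈ D₂, z ∈ X ∪ Y ∪ P₁ ∪ P₂ → z = d₂)
    (hD : ∀ z ∈ D₁, z ∈ D₂ → z = p₃) (hne : d₁ ≠ d₂) (hd1 : d₁ ∈ X) (hd2 : d₂ ∈ X) :
    Reaches G v p₁ p₂ p₃ := by
  obtain ⟨B, hBP, hB, hc⟩ := h.flip.exists_first
  obtain ⟨hX, hY, h1, h2, XY, X1, X2, Y1, Y2, P12, m1, m2, n1, n2, hv'⟩ := h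
  have hc1 := h1.left_mem
  have main : ∀ {d₁ d₂ : V} {D₁ D₂ H T : Set V}, PathOn G p₃ d₁ D₁ →
      PathOn G p₃ d₂ D₂ → v ∉ D₁ → v ∉ D₂ → (∀ z ∈ D₁, z ∈ X ∪ Y ∪ P₁ ∪ P₂ → z = d₁) →
      (∀ z ∈ D₂, z ∈ X ∪ Y ∪ P₁ ∪ P₂ → z = d₂) → (∀ z ∈ D₁, z ∈ D₂ → z = p₃) → d₁ ≠ d₂ →
      PathOn G x d₁ H → PathOn G d₂ c₁ T → H ⊆ X → T ⊆ X → (∀ z ∈ H, z ∉ T) →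
      Reaches G v p₁ p₂ p₃ := by
    intro d₁ d₂ D₁ D₂ H T hD1 hD2 hv1 hv2 hC1 hC2 hD hne hH hT hHX hTX hHT
    have := hB.right_mem
    have := hD1.left_mem
    have := hT.left_mem
    have := hH.right_mem
    have := hT.right_mem
    exact hv.reaches (((hH.trans hD1.symm (by grind)).trans (hD2.trans hT (by grind))
      (by grind)).trans (h1.trans hB (by grind)) (by grind)) (by grind) (by grind) (by grind)
      (by grind)
  obtain ⟨H, T, hH, hT, rfl, hHT⟩ := hX.split hd1
  by_cases hd2T : d₂ ∈ T
  · obtain ⟨M, T', hM, hT', rfl, hMT⟩ := hT.split hd2T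
    have := hM.left_mem
    exact main hD1 hD2 hv1 hv2 hC1 hC2 hD hne hH hT' (by grind) (by grind) (by grind)
  · obtain ⟨H', M, hH', hM, rfl, hMT⟩ := hH.split (by grind : d₂ ∈ H)
    have := hM.right_mem
    exact main hD2 hD1 hv2 hv1 hC2 hC1 (by grind) hne.symm hH' hT (by grind) (by grind)
      (by grind)

/-- The path leaves `X` at `d₁`, passes `p₃` to `d₂` on `Y`, turns towards `c₂`, takes `P₁` back to
`c₁` and ends on `P₂` at `p₂`. The vertex `c₁` is still free for this because `d₁ ≠ c₁`. -/
theorem Theta.reaches_left_right (h : Theta G v x y c₁ c₂ p₁ p₂ X Y P₁ P₂)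
    (hv : HasTwoNeighbors G v x y) {d₁ d₂ : V} {D₁ D₂ : Set V} (hD1 : PathOn G p₃ d₁ D₁)
    (hD2 : PathOn G p₃ d₂ D₂) (hv1 : v ∉ D₁) (hv2 : v ∉ D₂)
    (hC1 : ∀ z ∈ D₁, z ∈ X ∪ Y ∪ P₁ ∪ P₂ → z = d₁) (hC2 : ∀ z ∈ D₂, z ∈ X ∪ Y ∪ P₁ ∪ P₂ → z = d₂)
    (hD : ∀ z ∈ D₁, z ∈ D₂ → z = p₃) (hd1 : d₁ ∈ X) (hd2 : d₂ ∈ Y) (hdc : d₁ ≠ c₁) :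
    Reaches G v p₁ p₂ p₃ := by
  obtain ⟨B, hBP, hB, hc⟩ := h.exists_first
  have hne := h.ne
  obtain ⟨hX, hY, h1, h2, XY, X1, X2, Y1, Y2, P12, m1, m2, n1, n2, hv'⟩ := h
  have hc1 := hX.right_mem
  have hc2 := hY.right_mem
  have hm1 := h1.left_mem
  have hm2 := h1.right_mem
  obtain ⟨H, H', hH, hH', rfl, hHH⟩ := hX.split hd1
  obtain ⟨T', T, hT', hT, rfl, hTT⟩ := hY.split hd2
  have := hB.right_mem
  have := hD1.left_mem
  have := hH'.right_mem
  have hcH : c₁ ∉ H := by grind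
  exact hv.reaches (((hH.trans hD1.symm (by grind)).trans (hD2.trans hT (by grind))
      (by grind)).trans (h1.symm.trans hB (by grind)) (by grind)) (by grind) (by grind) (by grind)
      (by grind)

/-- Three paths from `c₁` to `c₂` through `p₁`, `p₂`, `p₃`, and a fourth one through `v`. -/
structure FourPaths (G : SimpleGraph V) (v x y c₁ c₂ p₁ p₂ p₃ : V) (X Y P₁ P₂ P₃ : Set V) :
    Prop where
  t12 : Theta G v x y c₁ c₂ p₁ p₂ X Y P₁ P₂
  t13 : Theta G v x y c₁ c₂ p₁ p₃ X Y P₁ P₃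
  t23 : Theta G v x y c₁ c₂ p₂ p₃ X Y P₂ P₃

theorem FourPaths.flip (h : FourPaths G v x y c₁ c₂ p₁ p₂ p₃ X Y P₁ P₂ P₃) :
    FourPaths G v y x c₂ c₁ p₁ p₂ p₃ Y X P₁ P₂ P₃ := ⟨h.t12.flip, h.t13.flip, h.t23.flip⟩

theorem FourPaths.perm (h : FourPaths G v x y c₁ c₂ p₁ p₂ p₃ X Y P₁ P₂ P₃) :
    FourPaths G v x y c₁ c₂ p₂ p₁ p₃ X Y P₂ P₁ P₃ := ⟨h.t12.swap, h.t23, h.t13⟩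

theorem FourPaths.perm' (h : FourPaths G v x y c₁ c₂ p₁ p₂ p₃ X Y P₁ P₂ P₃) :
    FourPaths G v x y c₁ c₂ p₁ p₃ p₂ X Y P₁ P₃ P₂ := ⟨h.t13, h.t12, h.t23.swap⟩

/-- Route: `X` to `c₁`, `P₃` to `c₂`, back along `P₁` past `p₁` to `m`, over `R` to `n`, then along
`P₂` to `p₂`. If `p₁` lies between `m` and `c₁` instead, the mirror image works. -/
theorem FourPaths.reaches₁₂ (h : FourPaths G v x y c₁ c₂ p₁ p₂ p₃ X Y P₁ P₂ P₃)
    (hv : HasTwoNeighbors G v x y) {m n : V} {R : Set V} (hR : PathOn G m n R)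
    (hm : m ∈ P₁) (hm' : m ≠ c₁ ∧ m ≠ c₂) (hn : n ∈ P₂) (hn' : n ≠ c₁ ∧ n ≠ c₂) (hvR : v ∉ R)
    (hRC : ∀ z ∈ R, z ∈ X ∪ Y ∪ P₁ ∪ P₂ ∪ P₃ → z = m ∨ z = n) : Reaches G v p₁ p₂ p₃ := by
  have main : ∀ {x y c₁ c₂ : V} {X Y A : Set V},
      FourPaths G v x y c₁ c₂ p₁ p₂ p₃ X Y P₁ P₂ P₃ → HasTwoNeighbors G v x y →
      (m ≠ c₁ ∧ m ≠ c₂) → (n ≠ c₁ ∧ n ≠ c₂) →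
      (∀ z ∈ R, z ∈ X ∪ Y ∪ P₁ ∪ P₂ ∪ P₃ → z = m ∨ z = n) →
      PathOn G m c₂ A → A ⊆ P₁ → c₁ ∉ A → p₁ ∈ A → Reaches G v p₁ p₂ p₃ := by
    intro x y c₁ c₂ X Y A h hv hm' hn' hRC hA hAP hc hp
    -- The last piece runs inside `P₂` from `n` straight to `p₂`, in whichever direction that is,
    -- and so misses both branch vertices.
    obtain ⟨N, hN, hNP, hN1, hN2⟩ : ∃ N, PathOn G n p₂ N ∧ N ⊆ P₂ ∧ c₁ ∉ N ∧ c₂ ∉ N := by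
      obtain ⟨A, B, hA, hB, hP, hAB⟩ := h.t12.h2.split hn
      have hm1 := hA.left_mem
      have hm2 := hB.right_mem
      have := h.t12.n2
      rcases (hP ▸ h.t12.m2 : p₂ ∈ A ∪ B) with hp | hp
      · obtain ⟨A', B', hA', hB', rfl, hAB'⟩ := hA.split hp
        have := hA'.left_mem
        exact ⟨B', hB'.symm, by grind, by grind, by grind⟩
      · obtain ⟨A', B', hA', hB', rfl, hAB'⟩ := hB.split hp
        have := hB'.right_mem
        exact ⟨A', hA', by grind, by grind, by grind⟩
    obtain ⟨hX, hY, h1, h2, XY, X1, X2, Y1, Y2, P12, m1, m2, n1, n2, hv'⟩ := h.t12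
    obtain ⟨-, -, -, h3, -, -, X3, -, Y3, P13, -, m3, -, n3, hv''⟩ := h.t13
    have P23 := h.t23.P12
    have := hA.right_mem
    have := hN.right_mem
    have hnA : n ∉ A := by grind
    have hmN : m ∉ N := by grind
    have hRX : ∀ z ∈ R, z ∉ X := by grind
    have hR3 : ∀ z ∈ R, z ∉ P₃ := by grind
    have s1 : PathOn G x c₂ (X ∪ P₃) := hX.trans h3 X3
    have s2 : PathOn G x m (X ∪ P₃ ∪ A) := s1.trans hA.symm (by grind)
    have s3 : PathOn G x n (X ∪ P₃ ∪ A ∪ R) := s2.trans hR (by grind)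
    exact hv.reaches (s3.trans hN (by grind)) (by grind) (by grind) (by grind) (by grind)
  obtain ⟨A, B, hA, hB, hP, hAB⟩ := h.t12.h1.split hm
  have hc1 := hA.left_mem
  have hc2 := hB.right_mem
  rcases (hP ▸ h.t12.m1 : p₁ ∈ A ∪ B) with hp | hp
  · exact main h.flip hv.symm hm'.symm hn'.symm (by grind) hA.symm (by grind) (by grind) hp
  · exact main h hv hm' hn' hRC hB (by grind) (by grind) hp

/-- Route: from `v` to `m`, over `R` to `n`, along `P₁` past `p₁` to a branch vertex, all of `P₂` to
the other one, and back on `P₃` to `p₃`. The first piece meets no branch vertex, so both are still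
available. -/
theorem FourPaths.reaches₀₁ (h : FourPaths G v x y c₁ c₂ p₁ p₂ p₃ X Y P₁ P₂ P₃)
    (hv : HasTwoNeighbors G v x y) {m n : V} {R : Set V} (hR : PathOn G m n R)
    (hm : m ∈ insert v (X ∪ Y)) (hm' : m ≠ c₁ ∧ m ≠ c₂) (hn : n ∈ P₁) (hn' : n ≠ c₁ ∧ n ≠ c₂)
    (hRC : ∀ z ∈ R, z ∈ insert v (X ∪ Y ∪ P₁ ∪ P₂ ∪ P₃) → z = m ∨ z = n) :
    Reaches G v p₁ p₂ p₃ := by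
  obtain ⟨M, hM, hMX⟩ : ∃ M, PathOn G v m M ∧
      ∀ z ∈ M, z ∈ insert v (X ∪ Y) ∧ z ≠ c₁ ∧ z ≠ c₂ := by
    have n1 : v ≠ c₁ := by rintro rfl; exact h.t12.hv (by simp [h.t12.hX.right_mem])
    have n2 : v ≠ c₂ := by rintro rfl; exact h.t12.hv (by simp [h.t12.hY.right_mem])
    have main : ∀ {x y c₁ c₂ : V} {X Y : Set V}, Theta G v x y c₁ c₂ p₁ p₂ X Y P₁ P₂ → G.Adj v x →
        v ≠ c₁ ∧ v ≠ c₂ → m ≠ c₁ → m ∈ X → ∃ M, PathOn G v m M ∧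
        ∀ z ∈ M, z ∈ insert v X ∧ z ≠ c₁ ∧ z ≠ c₂ := by
      intro x y c₁ c₂ X Y h hvx hn hm' hm
      obtain ⟨A, B, hA, hB, rfl, hAB⟩ := h.hX.split hm
      have := hB.right_mem
      have := h.hY.right_mem
      have := h.hv
      have := h.XY
      exact ⟨_, PathOn.cons hvx (by grind) hA, by grind⟩
    rcases hm with rfl | hm | hm
    · exact ⟨_, PathOn.single m, by grind⟩
    · obtain ⟨M, hM, hMX⟩ := main h.t12 hv.left ⟨n1, n2⟩ hm'.1 hm
      exact ⟨M, hM, by grind⟩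
    · obtain ⟨M, hM, hMX⟩ := main h.t12.flip hv.right ⟨n2, n1⟩ hm'.2 hm
      exact ⟨M, hM, by grind⟩
  have main : ∀ {x y c₁ c₂ : V} {X Y A : Set V},
      FourPaths G v x y c₁ c₂ p₁ p₂ p₃ X Y P₁ P₂ P₃ → 
      (∀ z ∈ M, z ∈ insert v (X ∪ Y) ∧ z ≠ c₁ ∧ z ≠ c₂) →
      (m ≠ c₁ ∧ m ≠ c₂) → (n ≠ c₁ ∧ n ≠ c₂) →
      (∀ z ∈ R, z ∈ insert v (X ∪ Y ∪ P₁ ∪ P₂ ∪ P₃) → z = m ∨ z = n) →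
      PathOn G n c₁ A → A ⊆ P₁ → c₂ ∉ A → p₁ ∈ A → Reaches G v p₁ p₂ p₃ := by
    intro x y c₁ c₂ X Y A h hMX hm' hn' hRC hA hAP hc hp
    obtain ⟨B, hBP, hB, hcB⟩ := h.t13.flip.exists_first
    obtain ⟨hX, hY, h1, h2, XY, X1, X2, Y1, Y2, P12, m1, m2, n1, n2, hv'⟩ := h.t12
    obtain ⟨-, -, -, h3, -, -, X3, -, Y3, P13, -, m3, -, n3, hv''⟩ := h.t13
    have P23 := h.t23.P12
    have := hB.right_mem
    have hmm := hM.right_mem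
    have hMA : ∀ z ∈ M, z ∉ A := by grind
    have hM2 : ∀ z ∈ M, z ∉ P₂ := by grind
    have hM3 : ∀ z ∈ M, z ∉ P₃ := by grind
    have hR2 : ∀ z ∈ R, z ∉ P₂ := by grind
    have hR3 : ∀ z ∈ R, z ∉ P₃ := by grind
    have hRA : ∀ z ∈ R, z ∈ A → z = n := by grind
    have hMR : ∀ z ∈ M, z ∈ R → z = m := by grind
    have s1 : PathOn G v n (M ∪ R) := hM.trans hR hMR
    have s2 : PathOn G v c₁ (M ∪ R ∪ A) := s1.trans hA (by grind)
    have s3 : PathOn G v c₂ (M ∪ R ∪ A ∪ P₂) := s2.trans h2 (by grind)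
    exact ⟨_, _, s3.trans hB (by grind), by grind, by grind, by grind⟩
  obtain ⟨A, B, hA, hB, hP, hAB⟩ := h.t12.h1.split hn
  have hc1 := hA.left_mem
  have hc2 := hB.right_mem
  rcases (hP ▸ h.t12.m1 : p₁ ∈ A ∪ B) with hp | hp
  · exact main h hMX hm' hn' hRC hA.symm (by grind) (by grind) hp
  · exact main h.flip (by grind) hm'.symm hn'.symm (by grind) hB (by grind) (by grind) hp

/-- A path from `A` to `B` off `S`. -/
theorem JoinedOff.exists_link {S A B : Set V} {a b : V} (h : JoinedOff G S a b) (ha : a ∈ A)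
    (hb : b ∈ B) (haS : a ∉ S) : ∃ m ∈ A, ∃ n ∈ B, ∃ R, PathOn G m n R ∧
      (∀ z ∈ R, z ∉ S) ∧ (∀ z ∈ R, z ∈ A → z = m) ∧ ∀ z ∈ R, z ∈ B → z = n := by
  obtain ⟨T, hT, hTS⟩ := h.exists_path haS
  obtain ⟨n, hn, T', hT', hp, hB⟩ := hT.firstHit hb
  obtain ⟨m, hm, R, hR, hp', hA⟩ := hp.symm.firstHit ha
  exact ⟨m, hm, n, hn, R, hp'.symm, fun z hz => hTS z (hT' (hR hz)), hA, fun z hz => hB z (hR hz)⟩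

theorem FourPaths.reaches_of_joined₀ (h : FourPaths G v x y c₁ c₂ p₁ p₂ p₃ X Y P₁ P₂ P₃)
    (hv : HasTwoNeighbors G v x y) (hj : JoinedOff G {c₁, c₂} v p₁) : Reaches G v p₁ p₂ p₃ := by
  have n1 : v ≠ c₁ := by rintro rfl; exact h.t12.hv (by simp [h.t12.hX.right_mem])
  have n2 : v ≠ c₂ := by rintro rfl; exact h.t12.hv (by simp [h.t12.hY.right_mem])
  obtain ⟨m, hm, n, hn, R, hR, hRS, hRA, hRB⟩ := hj.exists_link
    (A := insert v (X ∪ Y) \ {c₁, c₂}) (B := (P₁ ∪ P₂ ∪ P₃) \ {c₁, c₂}) (by simp [n1, n2])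
    ⟨by simp [h.t12.m1], by simp [h.t12.n1]⟩ (by simp [n1, n2])
  have key : ∀ z ∈ R, z ∈ insert v (X ∪ Y ∪ P₁ ∪ P₂ ∪ P₃) → z = m ∨ z = n := by grind
  have hm' : m ≠ c₁ ∧ m ≠ c₂ := by grind
  have hn' : n ≠ c₁ ∧ n ≠ c₂ := by grind
  rcases hn.1 with (hn1 | hn1) | hn1
  · exact h.reaches₀₁ hv hR hm.1 hm' hn1 hn' key
  · exact (h.perm.reaches₀₁ hv hR hm.1 hm' hn1 hn' (by grind)).perm
  · exact (h.perm'.perm.reaches₀₁ hv hR hm.1 hm' hn1 hn' (by grind)).perm.perm'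

theorem FourPaths.reaches_of_joined₁ (h : FourPaths G v x y c₁ c₂ p₁ p₂ p₃ X Y P₁ P₂ P₃)
    (hv : HasTwoNeighbors G v x y) (hj : JoinedOff G {c₁, c₂} p₁ p₂) : Reaches G v p₁ p₂ p₃ := by
  have hvn := h.t12.hv
  have hvn' := h.t13.hv
  -- The target includes the path through `v`, so that the link has no further contact with the four
  -- paths; where it ends decides which of the two routes applies.
  obtain ⟨m, hm, n, hn, R, hR, hRS, hRA, hRB⟩ := hj.exists_link
    (A := P₁ \ {c₁, c₂}) (B := insert v (X ∪ Y ∪ P₂ ∪ P₃) \ {c₁, c₂})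
    ⟨by simp [h.t12.m1], by simp [h.t12.n1]⟩ ⟨by simp [h.t12.m2], by simp [h.t12.n2]⟩
    (by simp [h.t12.n1])
  have key : ∀ z ∈ R, z ∈ insert v (X ∪ Y ∪ P₁ ∪ P₂ ∪ P₃) → z = m ∨ z = n := by grind
  have hm' : m ≠ c₁ ∧ m ≠ c₂ := by grind
  have hn' : n ≠ c₁ ∧ n ≠ c₂ := by grind
  by_cases hn0 : n ∈ insert v (X ∪ Y)
  · exact h.reaches₀₁ hv hR.symm hn0 hn' hm.1 hm' (by grind)
  have hvR : v ∉ R := by grind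
  by_cases hn2 : n ∈ P₂
  · exact h.reaches₁₂ hv hR hm.1 hm' hn2 hn' hvR (by grind)
  · exact (h.perm'.reaches₁₂ hv hR hm.1 hm' (by grind) hn' hvR (by grind)).perm'

/-- Removing two vertices puts `v`, `p₁`, `p₂` and `p₃` into four different components. -/
def PairSeparates (G : SimpleGraph V) (v p₁ p₂ p₃ : V) : Prop :=
  ∃ c₁ c₂, (v ∉ ({c₁, c₂} : Set V) ∧ p₁ ∉ ({c₁, c₂} : Set V) ∧ p₂ ∉ ({c₁, c₂} : Set V) ∧
    p₃ ∉ ({c₁, c₂} : Set V)) ∧ ¬ JoinedOff G {c₁, c₂} v p₁ ∧ ¬ JoinedOff G {c₁, c₂} v p₂ ∧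
    ¬ JoinedOff G {c₁, c₂} v p₃ ∧ ¬ JoinedOff G {c₁, c₂} p₁ p₂ ∧ ¬ JoinedOff G {c₁, c₂} p₁ p₃ ∧
    ¬ JoinedOff G {c₁, c₂} p₂ p₃

theorem FourPaths.reaches (h : FourPaths G v x y c₁ c₂ p₁ p₂ p₃ X Y P₁ P₂ P₃)
    (hv : HasTwoNeighbors G v x y) (hS : ¬ PairSeparates G v p₁ p₂ p₃) :
    Reaches G v p₁ p₂ p₃ := by
  have n1 : v ≠ c₁ := by rintro rfl; exact h.t12.hv (by simp [h.t12.hX.right_mem])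
  have n2 : v ≠ c₂ := by rintro rfl; exact h.t12.hv (by simp [h.t12.hY.right_mem])
  by_contra hR
  refine hS ⟨c₁, c₂, ⟨by simp [n1, n2], by simp [h.t12.n1], by simp [h.t12.n2],
    by simp [h.t13.n2]⟩, fun hj => hR ?_, fun hj => hR ?_, fun hj => hR ?_, fun hj => hR ?_,
    fun hj => hR ?_, fun hj => hR ?_⟩
  · exact h.reaches_of_joined₀ hv hj
  · exact (h.perm.reaches_of_joined₀ hv hj).perm
  · exact (h.perm'.perm.reaches_of_joined₀ hv hj).perm.perm'
  · exact h.reaches_of_joined₁ hv hj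
  · exact (h.perm'.reaches_of_joined₁ hv hj).perm'
  · exact (h.perm.perm'.reaches_of_joined₁ hv hj).perm'.perm

/-- Attach `p₃` by a fan. A leg ending inside `P₁` or `P₂`, two legs on the same one of `X` and `Y`,
or legs on both but not exactly at `c₁` and `c₂`, each give a path. What remains is a third path
from `c₁` to `c₂` through `p₃`, where `PairSeparates` decides. -/
theorem Theta.reaches (h : Theta G v x y c₁ c₂ p₁ p₂ X Y P₁ P₂) (hG : NoCut G)
    (hv : HasTwoNeighbors G v x y) (hS : ¬ PairSeparates G v p₁ p₂ p₃) :
    Reaches G v p₁ p₂ p₃ := by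
  have hvn := h.hv
  by_cases h3 : p₃ ∈ insert v (X ∪ Y ∪ P₁ ∪ P₂)
  · by_cases h30 : p₃ = v
    · subst h30
      obtain ⟨z, S, hS, g1, g2, -⟩ := h.reaches_left hv h.hX.left_mem
      exact ⟨z, S, hS, g1, g2, hS.left_mem⟩
    by_cases h3X : p₃ ∈ X
    · exact h.reaches_left hv h3X
    by_cases h3Y : p₃ ∈ Y
    · exact h.flip.reaches_left hv.symm h3Y
    have e1 : p₃ ≠ c₁ := by rintro rfl; exact h3X h.hX.right_mem
    have e2 : p₃ ≠ c₂ := by rintro rfl; exact h3Y h.hY.right_mem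
    by_cases h32 : p₃ ∈ P₂
    · exact h.reaches_interior hv (PathOn.single p₃) (by simpa using Ne.symm h30) (by simp) h32
        e1 e2
    · exact (h.swap.reaches_interior hv (PathOn.single p₃) (by simpa using Ne.symm h30) (by simp)
        (by grind) e1 e2).perm
  obtain ⟨d₁, d₂, D₁, D₂, hd1, hd2, hne, hD1, hD2, hC1, hC2, hD, hn1, hn2⟩ :=
    hv.hasFan hG (p := p₃) (C := insert v (X ∪ Y ∪ P₁ ∪ P₂)) (by simp)
      (by simp [h.hX.left_mem]) (by simp [h.hY.left_mem]) h3
  have hv1 : v ∉ D₁ := fun h => hn1 (hC1 v h (by simp)).symm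
  have hv2 : v ∉ D₂ := fun h => hn2 (hC2 v h (by simp)).symm
  have hC1' : ∀ z ∈ D₁, z ∈ X ∪ Y ∪ P₁ ∪ P₂ → z = d₁ := fun z hz hz' => hC1 z hz (Or.inr hz')
  have hC2' : ∀ z ∈ D₂, z ∈ X ∪ Y ∪ P₁ ∪ P₂ → z = d₂ := fun z hz hz' => hC2 z hz (Or.inr hz')
  have hc1 := h.hX.right_mem
  have hc2 := h.hY.right_mem
  have int : ∀ {d : V} {D : Set V}, PathOn G p₃ d D → v ∉ D →
      (∀ z ∈ D, z ∈ X ∪ Y ∪ P₁ ∪ P₂ → z = d) → d ∈ insert v (X ∪ Y ∪ P₁ ∪ P₂) → d ≠ v →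
      d ∉ X ∪ Y → Reaches G v p₁ p₂ p₃ := by
    intro d D hD hvD hC hd hdv hdXY
    by_cases hd2 : d ∈ P₂
    · exact h.reaches_interior hv hD hvD hC hd2 (by grind) (by grind)
    · exact (h.swap.reaches_interior hv hD hvD (by grind) (by grind) (by grind) (by grind)).perm
  by_cases a1 : d₁ ∉ X ∪ Y
  · exact int hD1 hv1 hC1' hd1 hn1 a1
  by_cases a2 : d₂ ∉ X ∪ Y
  · exact int hD2 hv2 hC2' hd2 hn2 a2
  push Not at a1 a2
  have lr : ∀ {d₁ d₂ : V} {D₁ D₂ : Set V}, PathOn G p₃ d₁ D₁ → PathOn G p₃ d₂ D₂ → v ∉ D₁ →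
      v ∉ D₂ → (∀ z ∈ D₁, z ∈ X ∪ Y ∪ P₁ ∪ P₂ → z = d₁) →
      (∀ z ∈ D₂, z ∈ X ∪ Y ∪ P₁ ∪ P₂ → z = d₂) → (∀ z ∈ D₁, z ∈ D₂ → z = p₃) → d₁ ∈ X →
      d₂ ∈ Y → Reaches G v p₁ p₂ p₃ := by
    intro d₁ d₂ D₁ D₂ hD1 hD2 hv1 hv2 hC1 hC2 hD hd1 hd2
    by_cases b1 : d₁ = c₁
    · by_cases b2 : d₂ = c₂
      · subst b1 b2
        have hm := hD1.left_mem
        have n3 : p₃ ≠ d₁ ∧ p₃ ≠ d₂ := by grind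
        have hp : PathOn G d₁ d₂ (D₁ ∪ D₂) := hD1.symm.trans hD2 hD
        have hvn3 : v ∉ D₁ ∪ D₂ := by grind
        have XY := h.XY
        have t13 : Theta G v x y d₁ d₂ p₁ p₃ X Y P₁ (D₁ ∪ D₂) :=
          ⟨h.hX, h.hY, h.h1, hp, h.XY, h.X1, by grind, h.Y1, by grind, by grind, h.m1, by grind,
            h.n1, n3, by grind⟩
        have t23 : Theta G v x y d₁ d₂ p₂ p₃ X Y P₂ (D₁ ∪ D₂) :=
          ⟨h.hX, h.hY, h.h2, hp, h.XY, h.X2, by grind, h.Y2, by grind, by grind, h.m2, by grind,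
            h.n2, n3, by grind⟩
        exact FourPaths.reaches ⟨h, t13, t23⟩ hv hS
      · exact h.flip.reaches_left_right hv.symm hD2 hD1 hv2 hv1 (by grind) (by grind) (by grind)
          hd2 hd1 b2
    · exact h.reaches_left_right hv hD1 hD2 hv1 hv2 hC1 hC2 hD hd1 hd2 b1
  rcases a1 with a1 | a1 <;> rcases a2 with a2 | a2
  · exact h.reaches_left_left hv hD1 hD2 hv1 hv2 hC1' hC2' hD hne a1 a2
  · exact lr hD1 hD2 hv1 hv2 hC1' hC2' hD a1 a2
  · exact lr hD2 hD1 hv2 hv1 hC2' hC1' (by grind) a2 a1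
  · exact h.flip.reaches_left_left hv.symm hD1 hD2 hv1 hv2 (by grind) (by grind) hD hne a1 a2

/-- In a graph without cut vertices, a vertex `v` of degree two is the first vertex of a path through
any three vertices, unless two vertices separate these three and `v` from each other. -/
theorem HasTwoNeighbors.reaches_of_noCut (hv : HasTwoNeighbors G v x y) (hG : NoCut G)
    (hS : ¬ PairSeparates G v p₁ p₂ p₃) : Reaches G v p₁ p₂ p₃ := by
  by_cases e1 : p₁ = v
  · subst e1
    obtain ⟨S, hS, hvS, hp⟩ : ∃ S, PathOn G x y S ∧ p₁ ∉ S ∧ p₃ ∈ insert p₁ S := by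
      by_cases e3 : p₃ = p₁
      · obtain ⟨S, hS, hvS, -⟩ := hv.exists_path hG x hv.left.ne'
        exact ⟨S, hS, hvS, by simp [e3]⟩
      · obtain ⟨S, hS, hvS, h⟩ := hv.exists_path hG p₃ e3
        exact ⟨S, hS, hvS, by simp [h]⟩
    rcases hp with hp | hp
    · obtain ⟨z, T, hT, -, h2, -⟩ :=
        hv.reaches_of_path hG (p₃ := p₂) hS hvS hS.left_mem hS.left_mem
      obtain ⟨z, T, hT, -, -, h2⟩ :=
        hv.reaches_of_path hG (p₃ := p₂) hS hvS hS.left_mem hS.left_mem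
      exact ⟨z, T, hT, hT.left_mem, h2, hp ▸ hT.left_mem⟩
    · obtain ⟨z, T, hT, h1, -, h2⟩ :=
        hv.reaches_of_path hG (p₃ := p₂) hS hvS hp hS.left_mem
      exact ⟨z, T, hT, hT.left_mem, h2, h1⟩
  by_cases e2 : p₂ = v
  · subst e2
    obtain ⟨S, hS, hvS, hp⟩ := hv.exists_path hG p₁ e1
    obtain ⟨z, T, hT, h1, -, h3⟩ := hv.reaches_of_path hG (p₃ := p₃) hS hvS hp hp
    exact ⟨z, T, hT, h1, hT.left_mem, h3⟩
  obtain ⟨S, hS, hvS, h1⟩ := hv.exists_path hG p₁ e1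
  by_cases h2 : p₂ ∈ S
  · exact hv.reaches_of_path hG hS hvS h1 h2
  obtain ⟨d₁, d₂, D₁, D₂, hd1, hd2, hne, hD1, hD2, hC1, hC2, hD, hn1, hn2⟩ :=
    hv.hasFan hG (p := p₂) (C := insert v S) (by simp) (by simp [hS.left_mem])
      (by simp [hS.right_mem]) (by simp [h2, e2])
  have hvD1 : v ∉ D₁ := fun h => hn1 (hC1 v h (by simp)).symm
  have hvD2 : v ∉ D₂ := fun h => hn2 (hC2 v h (by simp)).symm
  replace hd1 : d₁ ∈ S := by grind
  replace hd2 : d₂ ∈ S := by grind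
  -- The vertex `p₂` is attached to the cycle through `v` and `p₁`. If `p₁` is not on the bypassed
  -- segment `M`, the detour makes a cycle through `v`, `p₁` and `p₂`; otherwise there is a theta
  -- graph with branch vertices `d₁`, `d₂`.
  have main : ∀ {d₁ d₂ : V} {D₁ D₂ H M T : Set V}, PathOn G p₂ d₁ D₁ → PathOn G p₂ d₂ D₂ →
      v ∉ D₁ → v ∉ D₂ → (∀ z ∈ D₁, z ∈ insert v S → z = d₁) →
      (∀ z ∈ D₂, z ∈ insert v S → z = d₂) → (∀ z ∈ D₁, z ∈ D₂ → z = p₂) → d₁ ≠ d₂ →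
      PathOn G x d₁ H → PathOn G d₁ d₂ M → PathOn G d₂ y T → S = H ∪ M ∪ T →
      (∀ z ∈ H, z ∈ M → z = d₁) → (∀ z ∈ M, z ∈ T → z = d₂) → (∀ z ∈ H, z ∉ T) →
      Reaches G v p₁ p₂ p₃ := by
    intro d₁ d₂ D₁ D₂ H M T hD1 hD2 hv1 hv2 hC1 hC2 hD hne hH hM hT hS hHM hMT hHT
    have hm1 := hD1.left_mem
    have hm2 := hH.right_mem
    have hm3 := hT.left_mem
    have hP : PathOn G d₁ d₂ (D₁ ∪ D₂) := hD1.symm.trans hD2 hD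
    by_cases hp : p₁ ∈ H ∪ T
    · exact hv.reaches_of_path hG ((hH.trans hP (by grind)).trans hT (by grind)) (by grind)
        (by grind) (by grind)
    · have th : Theta G v x y d₁ d₂ p₁ p₂ H T M (D₁ ∪ D₂) :=
        ⟨hH, hT.symm, hM, hP, hHT, hHM, by grind, by grind, by grind, by grind, by grind, by grind,
          by grind, by grind, by grind⟩
      exact th.reaches hG hv ‹_›
  obtain ⟨H, T, hH, hT, hST, hHT⟩ := hS.split hd1
  by_cases hd2T : d₂ ∈ T
  · obtain ⟨M, T', hM, hT', rfl, hMT⟩ := hT.split hd2T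
    have hM1 := hM.left_mem
    exact main hD1 hD2 hvD1 hvD2 hC1 hC2 hD hne hH hM hT' (by rw [hST, union_assoc]) (by grind)
      hMT (by grind)
  · obtain ⟨H', M, hH', hM, rfl, hMT⟩ := hH.split (by grind : d₂ ∈ H)
    have hM1 := hM.right_mem
    exact main hD2 hD1 hvD2 hvD1 hC2 hC1 (by grind) hne.symm hH' hM hT hST hMT (by grind)
      (by grind)

end ThetaGraphs

/-! ### Curves in a space presented by a graph must meet separating vertices -/

section Param

variable {V : Type*} {G : SimpleGraph V} {X : Type*} [TopologicalSpace X]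

theorem arcOn_edge (d : G.Dart) : ArcOn (vert G d.fst) (vert G d.snd) (range (edge d)) :=
  ⟨⟨⟨edge d, continuous_edge d⟩, edge_zero d, edge_one d⟩, edge_injective d, rfl⟩

/-- The bound on the supports of the points of `A` is what lets the induction append the next edge:
a common point has only one vertex in its support. The one-vertex path is listed apart, since it
gives no arc. -/
theorem PathOn.arcOn {a c : V} {S : Set V} (h : PathOn G a c S) : (a = c ∧ S = {a}) ∨
    ∃ A, ArcOn (vert G a) (vert G c) A ∧ (∀ u ∈ S, vert G u ∈ A) ∧
      ∀ x ∈ A, ∀ u, 0 < bary u x → u ∈ S := by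
  induction h with
  | single a => exact Or.inl ⟨rfl, rfl⟩
  | cons h ha p ih =>
    rename_i a b c S
    right
    let d : G.Dart := ⟨(a, b), h⟩
    have hd : ArcOn (vert G a) (vert G b) (range (edge d)) := arcOn_edge d
    have hsupp : ∀ x ∈ range (edge d), ∀ u, 0 < bary u x → u = a ∨ u = b := by
      rintro _ ⟨t, rfl⟩ u hu
      rcases bary_edge_pos hu with h | h
      · exact Or.inl h.symm
      · exact Or.inr h.symm
    rcases ih with ⟨rfl, rfl⟩ | ⟨A, hA, h1, h2⟩
    · refine ⟨_, hd, ?_, hsupp⟩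
      rintro u (rfl | rfl)
      · exact hd.left_mem
      · exact hd.right_mem
    · refine ⟨_, hd.trans hA ?_, ?_, ?_⟩
      · intro x hx hxA
        apply eq_vert_of_bary
        intro u hu
        rcases hsupp x hx u hu with rfl | rfl
        · exact absurd (h2 x hxA u hu) ha
        · rfl
      · rintro u (rfl | hu)
        · exact Or.inl hd.left_mem
        · exact Or.inr (h1 u hu)
      · rintro x (hx | hx) u hu
        · rcases hsupp x hx u hu with rfl | rfl
          · exact Or.inl rfl
          · exact Or.inr p.left_mem
        · exact Or.inr (h2 x hx u hu)

/-- A presentation of the space `X` as the 1-complex of `G`: a bijection `φ` from `|G|` to `X` with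
continuous coordinate functions `B`. -/
structure Param (G : SimpleGraph V) (φ : Realization G → X) (B : V → X → ℝ) : Prop where
  continuous : Continuous φ
  surjective : Function.Surjective φ
  continuous_coord (v : V) : Continuous (B v)
  coord (v : V) (y : Realization G) : B v (φ y) = bary v y

theorem Param.injective {φ : Realization G → X} {B : V → X → ℝ} (h : Param G φ B) :
    Function.Injective φ := fun x y hxy => bary_ext fun v => by
  rw [← h.coord, ← h.coord, hxy]

theorem Param.refl (G : SimpleGraph V) : Param G id bary :=
  ⟨continuous_id, Function.surjective_id, continuous_bary, fun _ _ => rfl⟩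

/-- Leaving the part of the space that belongs to a set `C` of vertices whose neighbours lie in
`C ∪ S` is only possible through a vertex of `S`. -/
theorem Param.hits {φ : Realization G → X} {B : V → X → ℝ} (h : Param G φ B) {S C : Set V}
    (hCS : ∀ a ∈ C, a ∉ S) (hC : ∀ a b, G.Adj a b → a ∈ C → b ∉ S → b ∈ C) {f : I → X}
    (hf : Continuous f) {s t : I} (hs : ∃ u ∈ C, 0 < B u (f s)) (ht : ∀ u ∈ C, ¬ 0 < B u (f t)) :
    ∃ r ∈ uIcc s t, ∃ c ∈ S, f r = φ (vert G c) := by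
  -- To see that the complement is open, it is written through positive coordinates: a point outside
  -- has a positive coordinate at a vertex outside `C ∪ S`, or lies inside an edge with both ends in
  -- `S`.
  have : ((⋃ u ∈ C, {x | 0 < B u x}) ∪ {x | ∃ c ∈ S, φ (vert G c) = x})ᶜ =
      (⋃ u ∈ (C ∪ S)ᶜ, {x | 0 < B u x}) ∪
        ⋃ u ∈ S, ⋃ w ∈ S \ {u}, {x | 0 < B u x} ∩ {x | 0 < B w x} := by
    ext x
    obtain ⟨y, rfl⟩ := h.surjective x
    simp only [mem_compl_iff, mem_union, mem_iUnion, mem_ofPred_eq, h.coord, h.injective.eq_iff,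
      mem_inter_iff, exists_prop, not_or, mem_sdiff, mem_singleton_iff]
    constructor
    · rintro ⟨h1, h2⟩
      by_contra! hc
      obtain ⟨u, hu⟩ := exists_bary_pos y
      have hS : ∀ w, 0 < bary w y → w ∈ S := by
        intro w hw
        by_contra hwS
        exact (hc.1 w ⟨fun hwC => h1 ⟨w, hwC, hw⟩, hwS⟩).not_gt hw
      refine h2 ⟨u, hS u hu, (eq_vert_of_bary fun w hw => ?_).symm⟩
      by_contra hwu
      exact (hc.2 u (hS u hu) w ⟨hS w hw, hwu⟩ hu).not_gt hw
    · rintro (⟨u, ⟨huC, huS⟩, hu⟩ | ⟨u, huS, w, ⟨hwS, hwu⟩, hu, hw⟩)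
      · refine ⟨?_, ?_⟩
        · rintro ⟨w, hwC, hw⟩
          exact huC (hC w u (adj_of_bary_pos hw hu (by rintro rfl; exact huC hwC)) hwC huS)
        · rintro ⟨c, hc, rfl⟩
          exact huS (bary_vert_pos.1 hu ▸ hc)
      · refine ⟨?_, ?_⟩
        · rintro ⟨z, hzC, hz⟩
          rcases eq_of_bary_pos hu hw hz (Ne.symm hwu) with rfl | rfl
          · exact hCS _ hzC huS
          · exact hCS _ hzC hwS
        · rintro ⟨c, hc, rfl⟩
          exact hwu ((bary_vert_pos.1 hw).symm.trans (bary_vert_pos.1 hu))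
  have hopen : IsOpen ((⋃ u ∈ C, {x | 0 < B u x}) ∪ {x | ∃ c ∈ S, φ (vert G c) = x})ᶜ := by
    rw [this]
    refine IsOpen.union ?_ ?_
    · exact isOpen_biUnion fun u _ => isOpen_lt continuous_const (h.continuous_coord u)
    · exact isOpen_biUnion fun u _ => isOpen_biUnion fun w _ =>
        (isOpen_lt continuous_const (h.continuous_coord u)).inter
          (isOpen_lt continuous_const (h.continuous_coord w))
  obtain ⟨r, hr, c, hc, hrc⟩ := hits_boundary hf
    (isOpen_biUnion fun u _ => isOpen_lt continuous_const (h.continuous_coord u)) hopen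
    (s := s) (t := t) (by simpa using hs) (by simpa using ht)
  exact ⟨r, hr, c, hc, hrc.symm⟩

/-- A curve between two vertices that are separated by a set `S` of vertices meets `S`. -/
theorem Param.hits_of_not_joinedOff {φ : Realization G → X} {B : V → X → ℝ} (h : Param G φ B)
    {S : Set V} {f : I → X} (hf : Continuous f) {a b : V} {s t : I} (ha : a ∉ S)
    (hab : ¬ JoinedOff G S a b) (hs : f s = φ (vert G a)) (ht : f t = φ (vert G b)) :
    ∃ r ∈ uIcc s t, ∃ c ∈ S, f r = φ (vert G c) := by
  refine h.hits (C := {z | JoinedOff G S a z}) (fun z hz => hz.notMem ha) ?_ hf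
    ⟨a, Relation.ReflTransGen.refl, ?_⟩ ?_
  · intro x y hxy hx hy
    exact JoinedOff.trans hx (JoinedOff.adj hxy (JoinedOff.notMem hx ha) hy)
  · rw [hs, h.coord]; exact bary_vert_pos.2 rfl
  · intro u hu
    rw [ht, h.coord, bary_vert_pos]
    rintro rfl
    exact hab hu

/-- A curve that leaves an open edge meets one of its ends. -/
theorem hits_of_edge {f : I → Realization G} (hf : Continuous f) {v a : V} (hva : v ≠ a) {s t : I}
    (hs : 0 < bary v (f s) ∧ 0 < bary a (f s)) (ht : ¬ (0 < bary v (f t) ∧ 0 < bary a (f t))) :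
    ∃ r ∈ uIcc s t, f r = vert G v ∨ f r = vert G a := by
  refine hits_boundary hf (W := {x | 0 < bary v x} ∩ {x | 0 < bary a x})
    (Z := {x | x = vert G v ∨ x = vert G a})
    ((isOpen_lt continuous_const (continuous_bary v)).inter
      (isOpen_lt continuous_const (continuous_bary a))) ?_ hs ht
  have : ({x : Realization G | 0 < bary v x} ∩ {x | 0 < bary a x} ∪
      {x | x = vert G v ∨ x = vert G a})ᶜ = ⋃ u ∈ ({v, a} : Set V)ᶜ, {x | 0 < bary u x} := by
    ext x
    simp only [mem_compl_iff, mem_union, mem_iUnion, mem_ofPred_eq, mem_inter_iff, exists_prop,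
      not_or, mem_singleton_iff, mem_insert_iff]
    constructor
    · rintro ⟨h1, h2, h3⟩
      by_contra! hc
      have key : ∀ u, 0 < bary u x → u = v ∨ u = a := by
        intro u hu
        by_contra! hu'
        exact (hc u hu').not_gt hu
      by_cases hv : 0 < bary v x
      · refine h2 (eq_vert_of_bary fun u hu => (key u hu).resolve_right ?_)
        rintro rfl
        exact h1 ⟨hv, hu⟩
      · refine h3 (eq_vert_of_bary fun u hu => (key u hu).resolve_left ?_)
        rintro rfl
        exact hv hu
    · rintro ⟨u, ⟨h1, h2⟩, hu⟩
      refine ⟨?_, ?_, ?_⟩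
      · rintro ⟨h3, h4⟩
        rcases eq_of_bary_pos h3 h4 hu hva with h | h
        · exact h1 h
        · exact h2 h
      · rintro rfl
        exact h1 (bary_vert_pos.1 hu).symm
      · rintro rfl
        exact h2 (bary_vert_pos.1 hu).symm
  rw [this]
  exact isOpen_biUnion fun u _ => isOpen_lt continuous_const (continuous_bary u)

/-- No arc through the four vertices exists if two vertices separate them from each other. -/
theorem Param.not_pairSeparates {φ : Realization G → X} {B : V → X → ℝ} (h : Param G φ B)
    {f : I → X} (hf : Continuous f) (hi : Function.Injective f) {v p₁ p₂ p₃ : V}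
    (h0 : φ (vert G v) ∈ range f) (h1 : φ (vert G p₁) ∈ range f) (h2 : φ (vert G p₂) ∈ range f)
    (h3 : φ (vert G p₃) ∈ range f) : ¬ PairSeparates G v p₁ p₂ p₃ := by
  rintro ⟨c₁, c₂, ⟨n0, n1, n2, n3⟩, s01, s02, s03, s12, s13, s23⟩
  obtain ⟨t₀, h0⟩ := h0
  obtain ⟨t₁, h1⟩ := h1
  obtain ⟨t₂, h2⟩ := h2
  obtain ⟨t₃, h3⟩ := h3
  -- The curve passes `c` at most once. If it never does, any `τ` serves, and 0 is chosen.
  have time : ∀ c : V, ∃ τ, ∀ r, f r = φ (vert G c) → r = τ := by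
    intro c
    by_cases hc : ∃ τ, f τ = φ (vert G c)
    · obtain ⟨τ, hτ⟩ := hc
      exact ⟨τ, fun r hr => hi (hr.trans hτ.symm)⟩
    · exact ⟨0, fun r hr => absurd ⟨r, hr⟩ hc⟩
  obtain ⟨τ₁, hτ1⟩ := time c₁
  obtain ⟨τ₂, hτ2⟩ := time c₂
  -- Separated vertices lie in different pieces of the interval cut at `τ₁` and `τ₂`. There are at
  -- most three pieces for four vertices, which is the contradiction reached below.
  have key : ∀ {a b : V} {s t : I}, a ∉ ({c₁, c₂} : Set V) → b ∉ ({c₁, c₂} : Set V) →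
      ¬ JoinedOff G {c₁, c₂} a b → f s = φ (vert G a) → f t = φ (vert G b) →
      ¬ ((s < τ₁ ↔ t < τ₁) ∧ (s < τ₂ ↔ t < τ₂)) := by
    intro a b s t ha hb hab hs ht
    obtain ⟨r, hr, c, hc, hrc⟩ := h.hits_of_not_joinedOff hf ha hab hs ht
    have hrτ : r = τ₁ ∨ r = τ₂ := by
      rcases hc with rfl | rfl
      · exact Or.inl (hτ1 r hrc)
      · exact Or.inr (hτ2 r hrc)
    have e1 : r ≠ s := by
      rintro rfl
      exact ha (vert_injective (h.injective (hs.symm.trans hrc)) ▸ hc)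
    have e2 : r ≠ t := by
      rintro rfl
      exact hb (vert_injective (h.injective (ht.symm.trans hrc)) ▸ hc)
    rcases mem_uIcc.1 hr with ⟨g1, g2⟩ | ⟨g1, g2⟩
    · have g1' := lt_of_le_of_ne g1 e1.symm
      rcases hrτ with rfl | rfl
      · exact fun hh => (hh.1.1 g1').not_ge g2
      · exact fun hh => (hh.2.1 g1').not_ge g2
    · have g1' := lt_of_le_of_ne g1 e2.symm
      rcases hrτ with rfl | rfl
      · exact fun hh => (hh.1.2 g1').not_ge g2
      · exact fun hh => (hh.2.2 g1').not_ge g2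
  have k01 := key n0 n1 s01 h0 h1
  have k02 := key n0 n2 s02 h0 h2
  have k03 := key n0 n3 s03 h0 h3
  have k12 := key n1 n2 s12 h1 h2
  have k13 := key n1 n3 s13 h1 h3
  have k23 := key n2 n3 s23 h2 h3
  rcases le_total τ₁ τ₂ with hle | hle
  · have m : ∀ t : I, t < τ₁ → t < τ₂ := fun t ht => ht.trans_le hle
    have := m t₀
    have := m t₁
    have := m t₂
    have := m t₃
    grind
  · have m : ∀ t : I, t < τ₂ → t < τ₁ := fun t ht => ht.trans_le hle
    have := m t₀
    have := m t₁
    have := m t₂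
    have := m t₃
    grind

end Param

/-! ### Subdividing an edge does not change the space -/

section Subdivision

variable {V : Type*} {G : SimpleGraph V}

/-- The graph obtained from `G` by putting a new vertex on the edge `uw`. -/
def subdivide (G : SimpleGraph V) (u w : V) : SimpleGraph (Option V) where
  Adj
    | some a, some b => G.Adj a b ∧ ¬ (a = u ∧ b = w) ∧ ¬ (a = w ∧ b = u)
    | some a, none => a = u ∨ a = w
    | none, some a => a = u ∨ a = w
    | none, none => False
  symm := ⟨by
    rintro (_ | a) (_ | b) h
    · exact h
    · exact h
    · exact h
    · exact ⟨h.1.symm, fun h' => h.2.2 ⟨h'.2, h'.1⟩, fun h' => h.2.1 ⟨h'.2, h'.1⟩⟩⟩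
  loopless := ⟨by
    rintro (_ | a) h
    · exact h
    · exact h.1.ne rfl⟩

theorem subdivide_adj_some {u w a b : V} : (subdivide G u w).Adj (some a) (some b) ↔
    G.Adj a b ∧ ¬ (a = u ∧ b = w) ∧ ¬ (a = w ∧ b = u) := Iff.rfl

theorem subdivide_adj_none {u w a : V} :
    (subdivide G u w).Adj (some a) none ↔ a = u ∨ a = w := Iff.rfl

open Classical in
/-- The image in `|G|` of the point with parameter `t` on an edge of the subdivided graph. -/
noncomputable def subPoint (d : G.Dart) (s : I) : Option V → Option V → I → Realization G
  | some a, some b, t => if h : G.Adj a b then edge ⟨(a, b), h⟩ t else vert G a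
  | some a, none, t => if a = d.fst then edge d (s * t) else edge d (σ (σ s * t))
  | none, some a, t => if a = d.fst then edge d (s * σ t) else edge d (σ (σ s * σ t))
  | none, none, _ => vert G d.fst

/-- The image in `|G|` of a vertex of the subdivided graph. -/
def subVert (d : G.Dart) (s : I) : Option V → Realization G
  | some a => vert G a
  | none => edge d s

/-- The canonical map from the subdivided 1-complex. -/
noncomputable def subMap (d : G.Dart) (s : I) :
    Realization (subdivide G d.fst d.snd) → Realization G :=
  lift (subVert d s) (fun e t => subPoint d s e.fst e.snd t) (by
    rintro ⟨⟨_ | a, _ | b⟩, h⟩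
    · exact h.elim
    · rcases h with rfl | rfl
      · simp [subPoint, subVert]
      · simp [subPoint, subVert, d.adj.ne']
    · rcases h with rfl | rfl
      · simp [subPoint, subVert, edge_zero]
      · simp [subPoint, subVert, d.adj.ne', edge_one]
    · simp [subPoint, subVert, dif_pos (subdivide_adj_some.1 h).1, edge_zero]) (by
    rintro ⟨⟨_ | a, _ | b⟩, h⟩
    · exact h.elim
    · rcases h with rfl | rfl
      · simp [subPoint, subVert, edge_zero]
      · simp [subPoint, subVert, d.adj.ne', edge_one]
    · rcases h with rfl | rfl
      · simp [subPoint, subVert]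
      · simp [subPoint, subVert, d.adj.ne']
    · simp [subPoint, subVert, dif_pos (subdivide_adj_some.1 h).1, edge_one]) (by
    rintro ⟨⟨_ | a, _ | b⟩, h⟩ t
    · exact h.elim
    · simp [subPoint, SimpleGraph.Dart.symm]
    · simp [subPoint, SimpleGraph.Dart.symm]
    · have h1 : G.Adj a b := (subdivide_adj_some.1 h).1
      simp only [subPoint, SimpleGraph.Dart.symm, Prod.swap, dif_pos h1, dif_pos h1.symm]
      exact edge_symm ⟨(a, b), h1⟩ t)

theorem subMap_vert (d : G.Dart) (s : I) (a : Option V) :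
    subMap d s (vert _ a) = subVert d s a := rfl

theorem subMap_edge (d : G.Dart) (s : I) (e : (subdivide G d.fst d.snd).Dart) (t : I) :
    subMap d s (edge e t) = subPoint d s e.fst e.snd t := rfl

theorem continuous_subMap (d : G.Dart) (s : I) : Continuous (subMap d s) := by
  refine continuous_of_edge fun e => ?_
  simp only [subMap_edge]
  obtain ⟨⟨_ | a, _ | b⟩, h⟩ := e
  · exact h.elim
  · simp only [subPoint]
    split_ifs
    · exact (continuous_edge d).comp (by fun_prop)
    · exact (continuous_edge d).comp (by fun_prop)
  · simp only [subPoint]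
    split_ifs
    · exact (continuous_edge d).comp (by fun_prop)
    · exact (continuous_edge d).comp (by fun_prop)
  · simp only [subPoint, dif_pos (subdivide_adj_some.1 h).1]
    exact continuous_edge _

theorem surjective_subMap (d : G.Dart) (s : I) (h0 : 0 < s) (h1 : s < 1) :
    Function.Surjective (subMap d s) := by
  have h0' : (0 : ℝ) < s := h0
  have h1' : (s : ℝ) < 1 := h1
  have main : ∀ t, ∃ y, subMap d s y = edge d t := by
    intro t
    have t0 : (0 : ℝ) ≤ t := t.2.1
    have t1 : (t : ℝ) ≤ 1 := t.2.2
    rcases le_total (t : ℝ) s with hts | hts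
    · refine ⟨edge ⟨(some d.fst, none), Or.inl rfl⟩ ⟨t / s, div_nonneg t0 h0'.le,
        (div_le_one h0').2 hts⟩, ?_⟩
      rw [subMap_edge]
      simp only [subPoint, if_true]
      congr 1
      exact Subtype.ext (mul_div_cancel₀ _ h0'.ne')
    · refine ⟨edge ⟨(some d.snd, none), Or.inr rfl⟩ ⟨(1 - t) / (1 - s),
        div_nonneg (by linarith) (by linarith), (div_le_one (by linarith)).2 (by linarith)⟩, ?_⟩
      rw [subMap_edge]
      simp only [subPoint, if_neg d.adj.ne']
      congr 1
      refine Subtype.ext ?_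
      simp only [unitInterval.coe_symm_eq, Set.Icc.coe_mul]
      rw [mul_div_cancel₀ _ (by linarith)]
      ring
  intro x
  rcases realization_cases x with ⟨a, rfl⟩ | ⟨e, t, rfl⟩
  · exact ⟨vert _ (some a), rfl⟩
  · by_cases c1 : e.fst = d.fst ∧ e.snd = d.snd
    · obtain rfl : e = d := SimpleGraph.Dart.ext _ _ (Prod.ext c1.1 c1.2)
      exact main t
    by_cases c2 : e.fst = d.snd ∧ e.snd = d.fst
    · obtain rfl : e = d.symm := SimpleGraph.Dart.ext _ _ (Prod.ext c2.1 c2.2)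
      rw [edge_symm']
      exact main _
    refine ⟨edge ⟨(some e.fst, some e.snd), subdivide_adj_some.2 ⟨e.adj, c1, c2⟩⟩ t, ?_⟩
    rw [subMap_edge]
    simp only [subPoint, dif_pos e.adj]

/-- The coordinate of the new vertex. -/
noncomputable def subCoord (s : ℝ) (bu bw : ℝ) : ℝ := min (bw / s) (bu / (1 - s))

open Classical in
-- On the subdivided edge the new coordinate is a tent function with peak 1 at parameter `s`;
-- elsewhere it vanishes, as does one of the two end coordinates. The old coordinates spread the
-- weight of the new vertex as `1 - s` and `s` over the two ends, and solving for the new ones makes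
-- all of them continuous in the old ones.
theorem coord_subMap (d : G.Dart) (s : I) (h0 : 0 < s) (h1 : s < 1)
    (y : Realization (subdivide G d.fst d.snd)) :
    bary none y = subCoord s (bary d.fst (subMap d s y)) (bary d.snd (subMap d s y)) ∧
    ∀ a, bary (some a) y = bary a (subMap d s y) -
      (if a = d.fst then (1 - s) * bary none y else 0) -
      (if a = d.snd then s * bary none y else 0) := by
  have h0' : (0 : ℝ) < s := h0
  have h1' : (0 : ℝ) < 1 - s := sub_pos.2 h1
  have hne := d.adj.ne
  have hne' := d.adj.ne'
  -- The points to be checked are of two kinds: those on the subdivided edge, with parameter `t` on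
  -- `d`, handled by `huw` and `main`, and those on no half of it or at an old vertex, handled by
  -- `old`.
  have huw : ∀ (y : Realization (subdivide G d.fst d.snd)) (t : I), subMap d s y = edge d t →
      bary none y = min ((t : ℝ) / s) ((1 - t) / (1 - s)) →
      (∀ a, a ≠ d.fst → a ≠ d.snd → bary (some a) y = 0) →
      bary (some d.fst) y = 1 - t - (1 - s) * bary none y →
      bary (some d.snd) y = t - s * bary none y →
      bary none y = subCoord s (bary d.fst (subMap d s y)) (bary d.snd (subMap d s y)) ∧
    ∀ a, bary (some a) y = bary a (subMap d s y) -
      (if a = d.fst then (1 - s) * bary none y else 0) -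
      (if a = d.snd then s * bary none y else 0) := by
    intro y t hy hn ha hu hw
    rw [hy, bary_fst, bary_snd]
    refine ⟨hn, fun a => ?_⟩
    by_cases c1 : a = d.fst
    · subst c1
      rw [if_pos rfl, if_neg hne, bary_fst, hu]; ring
    by_cases c2 : a = d.snd
    · subst c2
      rw [if_neg hne', if_pos rfl, bary_snd, hw]; ring
    rw [if_neg c1, if_neg c2, bary_of_ne (Ne.symm c1) (Ne.symm c2), ha a c1 c2]; ring
  have main : ∀ (a : V) (h : (subdivide G d.fst d.snd).Adj (some a) none) (t : I),
      bary none (edge ⟨(some a, none), h⟩ t) = subCoord s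
        (bary d.fst (subMap d s (edge ⟨(some a, none), h⟩ t)))
        (bary d.snd (subMap d s (edge ⟨(some a, none), h⟩ t))) ∧
      ∀ b, bary (some b) (edge ⟨(some a, none), h⟩ t) =
        bary b (subMap d s (edge ⟨(some a, none), h⟩ t)) -
        (if b = d.fst then (1 - s) * bary none (edge ⟨(some a, none), h⟩ t) else 0) -
        (if b = d.snd then s * bary none (edge ⟨(some a, none), h⟩ t) else 0) := by
    intro a h t
    have t0 : (0 : ℝ) ≤ t := t.2.1
    have t1 : (t : ℝ) ≤ 1 := t.2.2
    have en : bary none (edge ⟨(some a, none), h⟩ t : Realization (subdivide G d.fst d.snd)) = t :=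
      bary_snd (⟨(some a, none), h⟩ : (subdivide G d.fst d.snd).Dart) t
    have ea : bary (some a) (edge ⟨(some a, none), h⟩ t : Realization (subdivide G d.fst d.snd)) =
      1 - t := bary_fst (⟨(some a, none), h⟩ : (subdivide G d.fst d.snd).Dart) t
    have eb : ∀ b, b ≠ a → bary (some b)
        (edge ⟨(some a, none), h⟩ t : Realization (subdivide G d.fst d.snd)) = 0 := by
      intro b hb
      exact bary_of_ne (by simpa using hb.symm) (by simp)
    rcases (h : a = d.fst ∨ a = d.snd) with rfl | rfl
    · refine huw _ (s * t) (by rw [subMap_edge]; simp [subPoint]) ?_ ?_ ?_ ?_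
      · rw [en, Set.Icc.coe_mul, mul_div_cancel_left₀ _ h0'.ne', min_eq_left]
        rw [le_div_iff₀ h1']; nlinarith
      · intro b c1 c2; exact eb b c1
      · rw [ea, en, Set.Icc.coe_mul]; ring
      · rw [eb _ hne', en, Set.Icc.coe_mul]; ring
    · refine huw _ (σ (σ s * t)) (by rw [subMap_edge]; simp [subPoint, hne']) ?_ ?_ ?_ ?_
      · rw [en, unitInterval.coe_symm_eq, Set.Icc.coe_mul, unitInterval.coe_symm_eq, sub_sub_cancel,
          mul_div_cancel_left₀ _ h1'.ne', min_eq_right]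
        rw [le_div_iff₀ h0']; nlinarith
      · intro b c1 c2; exact eb b c2
      · rw [eb _ hne, en, unitInterval.coe_symm_eq, Set.Icc.coe_mul, unitInterval.coe_symm_eq]; ring
      · rw [ea, en, unitInterval.coe_symm_eq, Set.Icc.coe_mul, unitInterval.coe_symm_eq]; ring
  have old : ∀ (y : Realization (subdivide G d.fst d.snd)),
      (bary none y = 0) → (∀ a, bary (some a) y = bary a (subMap d s y)) →
      (bary d.fst (subMap d s y) = 0 ∨ bary d.snd (subMap d s y) = 0) →
      bary none y = subCoord s (bary d.fst (subMap d s y)) (bary d.snd (subMap d s y)) ∧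
    ∀ a, bary (some a) y = bary a (subMap d s y) -
      (if a = d.fst then (1 - s) * bary none y else 0) -
      (if a = d.snd then s * bary none y else 0) := by
    intro y hn hs hz
    refine ⟨?_, fun a => by rw [hn, hs]; simp⟩
    rw [hn, subCoord]
    have b1 := bary_nonneg d.fst (subMap d s y)
    have b2 := bary_nonneg d.snd (subMap d s y)
    rcases hz with hz | hz
    · rw [hz, zero_div, min_eq_right (div_nonneg b2 h0'.le)]
    · rw [hz, zero_div, min_eq_left (div_nonneg b1 h1'.le)]
  rcases realization_cases y with ⟨_ | a, rfl⟩ | ⟨⟨⟨_ | a, _ | b⟩, h⟩, t, rfl⟩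
  · have := main d.fst (Or.inl rfl) 1
    rwa [show edge ⟨(some d.fst, none), Or.inl rfl⟩ 1 = vert (subdivide G d.fst d.snd) none from
      edge_one _] at this
  · refine old _ (by rw [bary_vert]; simp) (fun c => ?_) ?_
    · rw [subMap_vert, subVert, bary_vert, bary_vert]; simp
    · rw [subMap_vert, subVert, bary_vert, bary_vert]
      by_cases c : a = d.fst
      · right; simp [c, hne]
      · left; simp [c]
  · exact h.elim
  · have := main b h (σ t)
    rw [← edge_symm] at this
    simpa [SimpleGraph.Dart.symm] using this
  · exact main a h t
  · have h' := subdivide_adj_some.1 h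
    refine old _ (bary_of_ne (by simp) (by simp)) (fun c => ?_) ?_
    · rw [subMap_edge]
      simp only [subPoint, dif_pos h'.1]
      rw [bary_edge, bary_edge]
      simp
    · rw [subMap_edge]
      simp only [subPoint, dif_pos h'.1]
      by_contra! hc
      have p1 := bary_edge_pos (lt_of_le_of_ne (bary_nonneg _ _) hc.1.symm)
      have p2 := bary_edge_pos (lt_of_le_of_ne (bary_nonneg _ _) hc.2.symm)
      rcases p1 with p1 | p1 <;> rcases p2 with p2 | p2
      · exact hne (p1.symm.trans p2)
      · exact h'.2.1 ⟨p1, p2⟩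
      · exact h'.2.2 ⟨p2, p1⟩
      · exact hne (p1.symm.trans p2)

variable {X : Type*} [TopologicalSpace X]

theorem Param.exists_subdivide {φ : Realization G → X} {B : V → X → ℝ} (h : Param G φ B)
    (d : G.Dart) (s : I) (h0 : 0 < s) (h1 : s < 1) :
    ∃ B', Param (subdivide G d.fst d.snd) (φ ∘ subMap d s) B' := by
  classical
  let T : X → ℝ := fun x => subCoord s (B d.fst x) (B d.snd x)
  have hT : Continuous T := by
    have := h.continuous_coord d.fst
    have := h.continuous_coord d.snd
    simp only [T, subCoord]
    fun_prop
  refine ⟨fun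
    | none => T
    | some a => fun x => B a x - (if a = d.fst then (1 - s) * T x else 0) -
        (if a = d.snd then s * T x else 0), ⟨h.continuous.comp (continuous_subMap d s),
      h.surjective.comp (surjective_subMap d s h0 h1), ?_, ?_⟩⟩
  · rintro (_ | a)
    · exact hT
    · have := h.continuous_coord a
      simp only
      split_ifs <;> fun_prop
  · rintro (_ | a) y
    · simp only [Function.comp, T, h.coord]
      exact (coord_subMap d s h0 h1 y).1.symm
    · simp only [Function.comp, T, h.coord]
      rw [← (coord_subMap d s h0 h1 y).1]
      exact ((coord_subMap d s h0 h1 y).2 a).symm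

end Subdivision

/-! ### Subdivision creates no cut vertex and preserves degree two -/

section SubdivisionConnectivity

variable {V : Type u} {G : SimpleGraph V}

/-- If every step of a walk in `G - S` can be replaced by a walk in `H - T`, so can the walk. -/
theorem JoinedOff.map {W : Type*} {H : SimpleGraph W} {S : Set V} {T : Set W} (f : V → W)
    (hf : ∀ a b, G.Adj a b → a ∉ S → b ∉ S → JoinedOff H T (f a) (f b)) {a b : V}
    (h : JoinedOff G S a b) : JoinedOff H T (f a) (f b) := by
  induction h with
  | refl => exact Relation.ReflTransGen.refl
  | tail _ h ih => exact ih.trans (hf _ _ h.1 h.2.1 h.2.2)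

/-- If an old vertex is deleted, a use of the edge `uw` is replaced by the path through the new
vertex. If the new vertex is deleted, `u` and `w` are still joined through a third vertex `z`: from
`u` to `z` off `w`, then from `z` to `w` off `u`, neither of which uses the edge `uw`. -/
theorem noCut_subdivide (hG : NoCut G) (h3 : ∀ a b : V, ∃ c, c ≠ a ∧ c ≠ b) {u w : V}
    (huw : G.Adj u w) : NoCut (subdivide G u w) := by
  have away : ∀ {x a b : V}, x = u ∨ x = w → JoinedOff G {x} a b →
      JoinedOff (subdivide G u w) {none} (some a) (some b) := by
    intro x a b hx h
    refine h.map some fun a b hab ha hb => JoinedOff.adj ?_ (by simp) (by simp)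
    rw [subdivide_adj_some]
    refine ⟨hab, ?_, ?_⟩ <;> rintro ⟨rfl, rfl⟩ <;> rcases hx with rfl | rfl <;> simp at ha hb
  have hends : JoinedOff (subdivide G u w) {none} (some u) (some w) := by
    obtain ⟨z, hzu, hzw⟩ := h3 u w
    exact (away (Or.inr rfl) (hG w u z huw.ne hzw)).trans
      (away (Or.inl rfl) (hG u z w hzu huw.ne'))
  rintro (_ | x) p q hp hq
  · obtain ⟨a, rfl⟩ := Option.ne_none_iff_exists'.1 hp
    obtain ⟨b, rfl⟩ := Option.ne_none_iff_exists'.1 hq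
    obtain ⟨c, hca, hcb⟩ := h3 a b
    refine (hG c a b hca.symm hcb.symm).map some fun a b hab _ _ => ?_
    by_cases c1 : a = u ∧ b = w
    · rw [c1.1, c1.2]; exact hends
    by_cases c2 : a = w ∧ b = u
    · rw [c2.1, c2.2]; exact hends.symm
    exact JoinedOff.adj (subdivide_adj_some.2 ⟨hab, c1, c2⟩) (by simp) (by simp)
  · have hsome : ∀ a b, a ≠ x → b ≠ x →
        JoinedOff (subdivide G u w) {some x} (some a) (some b) := by
      intro a b ha hb
      refine (hG x a b ha hb).map some fun a b hab ha hb => ?_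
      have ha' : a ≠ x := ha
      have hb' : b ≠ x := hb
      have key : ∀ c, c = u ∨ c = w → c ≠ x →
          JoinedOff (subdivide G u w) {some x} (some c) none := fun c hc hcx =>
        JoinedOff.adj (subdivide_adj_none.2 hc) (by simpa using hcx) (by simp)
      by_cases c1 : a = u ∧ b = w
      · exact (key a (Or.inl c1.1) ha').trans (key b (Or.inr c1.2) hb').symm
      by_cases c2 : a = w ∧ b = u
      · exact (key a (Or.inr c2.1) ha').trans (key b (Or.inl c2.2) hb').symm
      exact JoinedOff.adj (subdivide_adj_some.2 ⟨hab, c1, c2⟩) (by simpa using ha')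
        (by simpa using hb')
    -- At least one end of the subdivided edge survives, and it ties the new vertex to the rest.
    obtain ⟨e, he, hex⟩ : ∃ e, (e = u ∨ e = w) ∧ e ≠ x := by
      by_cases hu : u = x
      · exact ⟨w, Or.inr rfl, fun h => huw.ne (hu.trans h.symm)⟩
      · exact ⟨u, Or.inl rfl, hu⟩
    have toE : ∀ p : Option V, p ≠ some x → JoinedOff (subdivide G u w) {some x} p (some e) := by
      rintro (_ | a) ha
      · exact (JoinedOff.adj (subdivide_adj_none.2 he) (by simpa using hex) (by simp)).symm
      · exact hsome a e (by simpa using ha) hex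
    exact (toE p hp).trans (toE q hq).symm

theorem HasTwoNeighbors.subdivide {v x y : V} (h : HasTwoNeighbors G v x y) {u w : V}
    (huw : G.Adj u w) : ∃ x' y', HasTwoNeighbors (subdivide G u w) (some v) x' y' := by
  have main : ∀ {u w x y : V}, HasTwoNeighbors G v x y → v = u → w = x → 
      ∃ x' y', HasTwoNeighbors (GraphArc.subdivide G u w) (some v) x' y' := by
    rintro u w x y h rfl rfl
    refine ⟨none, some y, subdivide_adj_none.2 (Or.inl rfl), subdivide_adj_some.2
      ⟨h.right, fun h' => h.ne h'.2.symm, fun h' => h.left.ne h'.1⟩, by simp, ?_⟩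
    rintro (_ | a) ha
    · exact Or.inl rfl
    · have ha' := subdivide_adj_some.1 ha
      rcases h.eq a ha'.1 with rfl | rfl
      · exact absurd ⟨rfl, rfl⟩ ha'.2.1
      · exact Or.inr rfl
  have hcomm : GraphArc.subdivide G u w = GraphArc.subdivide G w u := by
    ext a b
    rcases a with _ | a <;> rcases b with _ | b
    · exact Iff.rfl
    · exact or_comm
    · exact or_comm
    · rw [subdivide_adj_some, subdivide_adj_some]; tauto
  by_cases c1 : v = u
  · rcases h.eq w (c1 ▸ huw) with hw | hw
    · exact main h c1 hw
    · exact main h.symm c1 hw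
  by_cases c2 : v = w
  · rw [hcomm]
    rcases h.eq u (c2 ▸ huw.symm) with hw | hw
    · exact main h c2 hw
    · exact main h.symm c2 hw
  refine ⟨some x, some y, subdivide_adj_some.2 ⟨h.left, fun h => c1 h.1, fun h => c2 h.1⟩,
    subdivide_adj_some.2 ⟨h.right, fun h => c1 h.1, fun h => c2 h.1⟩, by simpa using h.ne, ?_⟩
  rintro (_ | a) ha
  · rcases ha with ha | ha
    · exact absurd ha c1
    · exact absurd ha c2
  · simpa using h.eq a (subdivide_adj_some.1 ha).1

theorem HasTwoNeighbors.exists_third {v x y : V} (h : HasTwoNeighbors G v x y) (a b : V) :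
    ∃ c, c ≠ a ∧ c ≠ b := by
  have := h.left.ne
  have := h.right.ne
  have := h.ne
  by_contra! hc
  have h1 := hc v
  have h2 := hc x
  have h3 := hc y
  by_cases hva : v = a <;> by_cases hxa : x = a <;> by_cases hya : y = a <;> simp_all

/-- Finitely many points of a 1-complex become vertices after subdividing. -/
theorem Param.exists_vertices {X : Type*} [TopologicalSpace X] {φ : Realization G → X}
    {B : V → X → ℝ} (h : Param G φ B) (hG : NoCut G) {v x y : V} (hv : HasTwoNeighbors G v x y)
    (F : Finset X) :
    ∃ (V' : Type u) (G' : SimpleGraph V') (φ' : Realization G' → X) (B' : V' → X → ℝ)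
      (v' x' y' : V'), Param G' φ' B' ∧ NoCut G' ∧ HasTwoNeighbors G' v' x' y' ∧
        φ' (vert G' v') = φ (vert G v) ∧ ∀ p ∈ F, ∃ a, φ' (vert G' a) = p := by
  classical
  induction F using Finset.induction_on with
  | empty => exact ⟨V, G, φ, B, v, x, y, h, hG, hv, rfl, by simp⟩
  | insert p F hp ih =>
    obtain ⟨V', G', φ', B', v', x', y', h', hG', hv', he, hF⟩ := ih
    obtain ⟨z, rfl⟩ := h'.surjective p
    rcases realization_cases' z with ⟨a, rfl⟩ | ⟨d, t, h0, h1, rfl⟩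
    · refine ⟨V', G', φ', B', v', x', y', h', hG', hv', he, ?_⟩
      intro p hp
      rcases Finset.mem_insert.1 hp with rfl | hp
      · exact ⟨a, rfl⟩
      · exact hF p hp
    · obtain ⟨B'', hB⟩ := h'.exists_subdivide d t h0 h1
      obtain ⟨x'', y'', hv''⟩ := hv'.subdivide d.adj
      refine ⟨_, _, _, B'', some v', x'', y'', hB, noCut_subdivide hG' hv'.exists_third d.adj, hv'',
        he, ?_⟩
      intro p hp
      rcases Finset.mem_insert.1 hp with rfl | hp
      · exact ⟨none, rfl⟩
      · obtain ⟨a, ha⟩ := hF p hp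
        exact ⟨some a, ha⟩

end SubdivisionConnectivity

/-! ### An arc from a vertex of degree at most two through three points -/

section ArcFromVertex

variable {V : Type u} {G : SimpleGraph V}

theorem joinedOff_of_reachable {S : Set V} {a b : V} (ha : a ∈ Sᶜ) (hb : b ∈ Sᶜ)
    (h : (G.induce Sᶜ).Reachable ⟨a, ha⟩ ⟨b, hb⟩) : JoinedOff G S a b := by
  rw [SimpleGraph.reachable_iff_reflTransGen] at h
  exact Relation.ReflTransGen.lift Subtype.val (fun x y h => ⟨h, x.2, y.2⟩) _ _ h

theorem JoinedOff.reachable {S : Set V} {a b : V} (h : JoinedOff G S a b) (ha : a ∈ Sᶜ) :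
    ∃ hb : b ∈ Sᶜ, (G.induce Sᶜ).Reachable ⟨a, ha⟩ ⟨b, hb⟩ := by
  induction h with
  | refl => exact ⟨ha, SimpleGraph.Reachable.refl _⟩
  | tail _ h ih =>
    obtain ⟨hb, h'⟩ := ih
    refine ⟨h.2.2, h'.trans (SimpleGraph.Adj.reachable ?_)⟩
    exact h.1

theorem preconnected_induce_iff {x : V} : (G.induce {x}ᶜ).Preconnected ↔
    ∀ a b, a ≠ x → b ≠ x → JoinedOff G {x} a b :=
  ⟨fun h a b ha hb => joinedOff_of_reachable (S := {x}) ha hb (h ⟨a, ha⟩ ⟨b, hb⟩),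
    fun h a b => (JoinedOff.reachable (S := {x}) (h a b a.2 b.2) a.2).2⟩

theorem preconnected_iff_joinedOff : G.Preconnected ↔ ∀ a b, JoinedOff G ∅ a b := by
  constructor
  · intro h a b
    have := (SimpleGraph.reachable_iff_reflTransGen a b).1 (h a b)
    exact Relation.ReflTransGen.mono (fun a b h => ⟨h, by simp, by simp⟩) _ _ this
  · intro h a b
    rw [SimpleGraph.reachable_iff_reflTransGen]
    exact Relation.ReflTransGen.mono (fun a b h => h.1) _ _ (h a b)

theorem IsTwoConnected.noCut (h : IsTwoConnected G) : NoCut G := fun x =>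
  preconnected_induce_iff.1 (h.2 x)

/-- A path with distinct ends in `|G|` that consists of one edge is all of `|G|` if there are no
other vertices. -/
theorem arcOn_univ {v x : V} (h : G.Adj v x) (hall : ∀ u, u = v ∨ u = x) :
    ArcOn (vert G v) (vert G x) univ := by
  let d : G.Dart := ⟨(v, x), h⟩
  have hd : ArcOn (vert G v) (vert G x) (range (edge d)) := arcOn_edge d
  convert hd
  symm
  rw [eq_univ_iff_forall]
  intro z
  rcases realization_cases z with ⟨u, rfl⟩ | ⟨e, t, rfl⟩
  · rcases hall u with rfl | rfl
    · exact hd.left_mem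
    · exact hd.right_mem
  · rcases hall e.fst with h1 | h1 <;> rcases hall e.snd with h2 | h2
    · exact absurd (h1.trans h2.symm) e.adj.ne
    · obtain rfl : e = d := SimpleGraph.Dart.ext _ _ (Prod.ext h1 h2)
      exact ⟨t, rfl⟩
    · obtain rfl : e = d.symm := SimpleGraph.Dart.ext _ _ (Prod.ext h1 h2)
      rw [edge_symm']
      exact ⟨_, rfl⟩
    · exact absurd (h1.trans h2.symm) e.adj.ne

theorem IsNAc.exists_curve {n : ℕ} (h : IsNAc G n) (F : Finset (Realization G)) (hF : F.card ≤ n) :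
    ∃ f : I → Realization G, Continuous f ∧ Function.Injective f ∧ (F : Set _) ⊆ range f := by
  obtain ⟨A, hA, hFA⟩ := h F (subset_univ _) hF
  obtain ⟨f, hf, hi, rfl⟩ := hA.exists_param
  exact ⟨f, hf, hi, hFA⟩

/-- Even the empty set of points must lie on an arc. Without edges all points are vertices, isolated
from one another, and no injective curve exists. -/
theorem IsNAc.exists_adj {n : ℕ} (h : IsNAc G n) : ∃ a b, G.Adj a b := by
  obtain ⟨f, hf, hi, -⟩ := h.exists_curve ∅ (by simp)
  by_contra! hc
  have hv : ∀ z : Realization G, ∃ v, z = vert G v := by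
    intro z
    rcases realization_cases z with h | ⟨d, -⟩
    · exact h
    · exact absurd d.adj (hc _ _)
  obtain ⟨v, hv0⟩ := hv (f 0)
  obtain ⟨r, -, c, hc', -⟩ := (Param.refl G).hits (S := ∅) (C := {v}) (by simp)
    (fun a b hab => absurd hab (hc _ _)) hf (s := 0) (t := 1)
    ⟨v, rfl, by rw [hv0]; exact bary_vert_pos.2 rfl⟩ (by
      rintro u rfl hu
      obtain ⟨w, hw⟩ := hv (f 1)
      rw [hw, bary_vert_pos] at hu
      subst hu
      exact zero_ne_one (hi (hv0.trans hw.symm)))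
  exact hc'

theorem exists_adj_of_preconnected (h : G.Preconnected) {v w : V} (hvw : v ≠ w) :
    ∃ x, G.Adj v x := by
  have h1 := preconnected_iff_joinedOff.1 h v w
  rcases Relation.ReflTransGen.cases_head h1 with h2 | ⟨x, h2, -⟩
  · exact absurd h2 hvw
  · exact ⟨x, h2.1⟩

theorem Finset.exists_subset_triple {α : Type*} [DecidableEq α] (F : Finset α) (hF : F.card ≤ 3)
    (a : α) : ∃ p q r, F ⊆ {p, q, r} := by
  interval_cases h : F.card
  · exact ⟨a, a, a, by rw [Finset.card_eq_zero.1 h]; simp⟩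
  · obtain ⟨p, rfl⟩ := Finset.card_eq_one.1 h
    exact ⟨p, p, p, by simp⟩
  · obtain ⟨p, q, -, rfl⟩ := Finset.card_eq_two.1 h
    exact ⟨p, q, q, by simp⟩
  · obtain ⟨p, q, r, -, -, -, rfl⟩ := Finset.card_eq_three.1 h
    exact ⟨p, q, r, subset_rfl⟩

/-- In a 2-connected 4-ac graph, every vertex of degree at most two is an end of an arc through any
three points. -/
theorem exists_arcOn_from_vertex (h2 : IsTwoConnected G) (h4 : IsNAc G 4) {v : V}
    (hdeg : (G.neighborSet v).encard ≤ 2) (F : Finset (Realization G)) (hF : F.card ≤ 3) :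
    ∃ b A, ArcOn (vert G v) b A ∧ (F : Set (Realization G)) ⊆ A := by
  classical
  obtain ⟨x, hx⟩ : ∃ x, G.Adj v x := by
    obtain ⟨a, b, hab⟩ := h4.exists_adj
    by_cases hva : v = a
    · exact ⟨b, hva ▸ hab⟩
    · exact exists_adj_of_preconnected h2.1.preconnected hva
  have hG := h2.noCut
  by_cases hy : ∃ y, G.Adj v y ∧ y ≠ x
  swap
  · push Not at hy
    refine ⟨vert G x, univ, arcOn_univ hx fun u => ?_, subset_univ _⟩
    by_contra! hu
    have := hG x v u hx.ne hu.2
    rcases Relation.ReflTransGen.cases_head this with h | ⟨z, hz, -⟩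
    · exact hu.1 h.symm
    · exact hz.2.2 (hy z hz.1)
  obtain ⟨y, hy, hyx⟩ := hy
  have hv : HasTwoNeighbors G v x y := by
    refine ⟨hx, hy, hyx.symm, fun u hu => ?_⟩
    by_contra! hc
    have h3 : ({u, x, y} : Set V).encard = 3 := by
      rw [Set.encard_insert_of_notMem (by simp [hc.1, hc.2]), Set.encard_pair hyx.symm]
      exact two_add_one_eq_three
    have := (Set.encard_le_encard (s := {u, x, y}) (t := G.neighborSet v) (by
      rintro z (rfl | rfl | rfl) <;> assumption)).trans hdeg
    rw [h3] at this
    exact absurd this (by decide)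
  obtain ⟨q₁, q₂, q₃, hq⟩ := Finset.exists_subset_triple F hF (vert G v)
  obtain ⟨V', G', φ, B, v', x', y', hP, hG', hv', he, hq'⟩ :=
    (Param.refl G).exists_vertices hG hv {q₁, q₂, q₃}
  obtain ⟨p₁, hp1⟩ := hq' q₁ (by simp)
  obtain ⟨p₂, hp2⟩ := hq' q₂ (by simp)
  obtain ⟨p₃, hp3⟩ := hq' q₃ (by simp)
  -- The condition `p₁ ≠ v'` keeps the path from being a single vertex, which would give no arc.
  -- When the first point is `v` itself, it lies on the arc anyway and the neighbour `x'` takes its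
  -- place.
  have main : ∀ p₁ : V', p₁ ≠ v' → ∃ b A, ArcOn (vert G v) b A ∧ φ (vert G' p₁) ∈ A ∧
      φ (vert G' p₂) ∈ A ∧ φ (vert G' p₃) ∈ A := by
    intro p₁ hne
    -- This is where 4-ac enters: an arc through the four vertices excludes a pair that separates
    -- them.
    obtain ⟨f, hf, hi, hFf⟩ := h4.exists_curve
      {φ (vert G' v'), φ (vert G' p₁), φ (vert G' p₂), φ (vert G' p₃)} Finset.card_le_four
    have hS := hP.not_pairSeparates (v := v') (p₁ := p₁) (p₂ := p₂) (p₃ := p₃) hf hi (hFf (by simp))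
      (hFf (by simp)) (hFf (by simp)) (hFf (by simp))
    obtain ⟨z, S, hzS, m1, m2, m3⟩ := hv'.reaches_of_noCut hG' hS
    rcases hzS.arcOn with ⟨-, rfl⟩ | ⟨A, hA, hSA, -⟩
    · exact absurd m1 hne
    · have := hA.map hP.continuous hP.injective
      rw [he] at this
      exact ⟨_, _, this, mem_image_of_mem _ (hSA _ m1), mem_image_of_mem _ (hSA _ m2),
        mem_image_of_mem _ (hSA _ m3)⟩
  have hend : ∀ b A, ArcOn (vert G v) b A → φ (vert G' p₁) ∈ A → φ (vert G' p₂) ∈ A →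
      φ (vert G' p₃) ∈ A → (F : Set (Realization G)) ⊆ A := by
    intro b A _ h1 h2 h3 z hz
    have := hq hz
    simp only [Finset.mem_insert, Finset.mem_singleton] at this
    rcases this with rfl | rfl | rfl
    · rwa [hp1] at h1
    · rwa [hp2] at h2
    · rwa [hp3] at h3
  by_cases hne : p₁ = v'
  · obtain ⟨b, A, hA, -, h2, h3⟩ := main x' hv'.left.ne'
    exact ⟨b, A, hA, hend b A hA (by rw [hne, he]; exact hA.left_mem) h2 h3⟩
  · obtain ⟨b, A, hA, h1, h2, h3⟩ := main p₁ hne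
    exact ⟨b, A, hA, hend b A hA h1 h2 h3⟩

end ArcFromVertex

/-! ### Maps of 1-complexes induced by maps of vertices -/

section Maps

variable {V W : Type*} {G : SimpleGraph V} {H : SimpleGraph W}

open Classical in
/-- The map between 1-complexes induced by a map of vertices that maps edges to edges or
contracts them. -/
noncomputable def mapR (f : V → W) (hf : ∀ a b, G.Adj a b → f a = f b ∨ H.Adj (f a) (f b)) :
    Realization G → Realization H :=
  lift (fun v => vert H (f v))
    (fun d t => if h : H.Adj (f d.fst) (f d.snd) then edge ⟨(f d.fst, f d.snd), h⟩ t
      else vert H (f d.fst))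
    (by
      intro d
      split_ifs with h
      · rw [edge_zero]
      · rfl)
    (by
      intro d
      split_ifs with h
      · rw [edge_one]
      · rw [(hf _ _ d.adj).resolve_right h])
    (by
      intro d t
      by_cases h : H.Adj (f d.fst) (f d.snd)
      · rw [dif_pos h, dif_pos (show H.Adj (f d.symm.fst) (f d.symm.snd) from h.symm)]
        exact edge_symm ⟨(f d.fst, f d.snd), h⟩ t
      · rw [dif_neg h, dif_neg (show ¬ H.Adj (f d.symm.fst) (f d.symm.snd) from
          fun h' => h h'.symm)]
        exact congrArg _ ((hf _ _ d.adj).resolve_right h).symm)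

variable {f : V → W} {hf : ∀ a b, G.Adj a b → f a = f b ∨ H.Adj (f a) (f b)}

theorem mapR_vert (v : V) : mapR f hf (vert G v) = vert H (f v) := rfl

theorem mapR_edge (d : G.Dart) (h : H.Adj (f d.fst) (f d.snd)) (t : I) :
    mapR f hf (edge d t) = edge ⟨(f d.fst, f d.snd), h⟩ t := dif_pos h

theorem mapR_edge_of_eq (d : G.Dart) (h : f d.fst = f d.snd) (t : I) :
    mapR f hf (edge d t) = vert H (f d.fst) :=
  dif_neg (show ¬ H.Adj (f d.fst) (f d.snd) from fun h' => h'.ne h)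

theorem continuous_mapR : Continuous (mapR f hf) := by
  refine continuous_of_edge fun d => ?_
  by_cases h : H.Adj (f d.fst) (f d.snd)
  · simp only [mapR_edge d h]
    exact continuous_edge _
  · simp only [mapR_edge_of_eq d ((hf _ _ d.adj).resolve_right h)]
    exact continuous_const

theorem bary_mapR (hi : Function.Injective f) (v : V) (x : Realization G) :
    bary (f v) (mapR f hf x) = bary v x := by
  classical
  rcases realization_cases x with ⟨u, rfl⟩ | ⟨d, t, rfl⟩
  · rw [mapR_vert, bary_vert, bary_vert]
    simp [hi.eq_iff]
  · rw [mapR_edge d ((hf _ _ d.adj).resolve_left fun h => d.adj.ne (hi h)), bary_edge, bary_edge]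
    simp [hi.eq_iff]

theorem mapR_injective (hi : Function.Injective f) : Function.Injective (mapR f hf) :=
  fun x y h => bary_ext fun v => by rw [← bary_mapR (hf := hf) hi, h, bary_mapR hi]

end Maps

/-! ### The 1-complex of a subgraph inside that of the graph -/

section Subgraphs

variable {V : Type u} {G : SimpleGraph V}

/-- The inclusion of the 1-complex of a subgraph. -/
noncomputable def incl (L : G.Subgraph) : Realization L.coe → Realization G :=
  mapR Subtype.val fun _ _ h => Or.inr (L.adj_sub h)

theorem continuous_incl (L : G.Subgraph) : Continuous (incl L) := continuous_mapR

theorem incl_injective (L : G.Subgraph) : Function.Injective (incl L) :=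
  mapR_injective Subtype.val_injective

theorem incl_vert (L : G.Subgraph) (v : L.verts) : incl L (vert _ v) = vert G v := rfl

theorem vert_mem_range_incl {L : G.Subgraph} {v : V} (h : v ∈ L.verts) :
    vert G v ∈ range (incl L) := ⟨vert _ ⟨v, h⟩, rfl⟩

theorem edge_mem_range_incl {L : G.Subgraph} {d : G.Dart} (h : L.Adj d.fst d.snd) (t : I) :
    edge d t ∈ range (incl L) :=
  ⟨edge ⟨(⟨d.fst, L.edge_vert h⟩, ⟨d.snd, L.edge_vert h.symm⟩), h⟩ t,
    mapR_edge (H := G) _ d.adj t⟩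

theorem mem_verts_of_bary_pos {L : G.Subgraph} {x : Realization G} (hx : x ∈ range (incl L))
    {u : V} (hu : 0 < bary u x) : u ∈ L.verts := by
  obtain ⟨y, rfl⟩ := hx
  rcases realization_cases y with ⟨v, rfl⟩ | ⟨d, t, rfl⟩
  · rw [incl_vert, bary_vert_pos] at hu
    exact hu ▸ v.2
  · rw [incl, mapR_edge (H := G) d (L.adj_sub d.adj)] at hu
    rcases bary_edge_pos hu with rfl | rfl
    · exact d.fst.2
    · exact d.snd.2

theorem encard_neighborSet_coe_le (L : G.Subgraph) (v : L.verts) :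
    (L.coe.neighborSet v).encard ≤ (L.neighborSet v).encard := by
  rw [← (Subtype.val_injective (p := (· ∈ L.verts))).injOn.encard_image (s := L.coe.neighborSet v)]
  apply Set.encard_le_encard
  rintro _ ⟨w, hw, rfl⟩
  exact hw

open Classical in
theorem exists_pullback (L : G.Subgraph) (F : Finset (Realization G)) :
    ∃ F' : Finset (Realization L.coe), F'.card ≤ (F.filter (· ∈ range (incl L))).card ∧
      ∀ z, incl L z ∈ F → z ∈ F' := by
  refine ⟨F.preimage (incl L) (incl_injective L).injOn, ?_, fun z hz => by simpa using hz⟩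
  refine Finset.card_le_card_of_injOn (incl L) ?_ (incl_injective L).injOn
  intro z hz
  simp only [Finset.coe_preimage, mem_preimage] at hz
  simp only [Finset.coe_filter, mem_ofPred_eq]
  exact ⟨hz, z, rfl⟩

theorem subset_image_incl {L : G.Subgraph} {F : Finset (Realization G)}
    {F' : Finset (Realization L.coe)} (h : ∀ z, incl L z ∈ F → z ∈ F') {A : Set (Realization L.coe)}
    (hA : (F' : Set _) ⊆ A) {x : Realization G} (hx : x ∈ F) (hxL : x ∈ range (incl L)) :
    x ∈ incl L '' A := by
  obtain ⟨z, rfl⟩ := hxL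
  exact ⟨z, hA (h z hx), rfl⟩

end Subgraphs

/-! ### Sufficiency: assembling an arc along the chain -/

section Sufficiency

variable {V : Type u} {G : SimpleGraph V} {J : Set ℤ} {L : ℤ → G.Subgraph}

theorem IsChain.exists_mem_range (h : IsChain G J L) (x : Realization G) :
    ∃ n ∈ J, x ∈ range (incl (L n)) := by
  rcases realization_cases x with ⟨v, rfl⟩ | ⟨d, t, rfl⟩
  · have : v ∈ (⨆ n ∈ J, L n).verts := by rw [h.union]; trivial
    simp only [SimpleGraph.Subgraph.verts_iSup, mem_iUnion] at this
    obtain ⟨n, hn, hv⟩ := this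
    exact ⟨n, hn, vert_mem_range_incl hv⟩
  · have : (⨆ n ∈ J, L n).Adj d.fst d.snd := by rw [h.union]; exact d.adj
    simp only [SimpleGraph.Subgraph.iSup_adj] at this
    obtain ⟨n, hn, hv⟩ := this
    exact ⟨n, hn, edge_mem_range_incl hv t⟩

theorem IsChain.eq_of_mem (h : IsChain G J L) {m k l : ℤ} {c x : V}
    (hc : (L m).verts ∩ (L (m + 1)).verts = {c}) (hk : k ∈ J) (hl : l ∈ J) (hkm : k ≤ m)
    (hml : m < l) (hxk : x ∈ (L k).verts) (hxl : x ∈ (L l).verts) : x = c := by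
  have hkl : ¬ k + 1 < l := fun hh => (h.nonconsecutive k hk l hl hh).le_bot ⟨hxk, hxl⟩
  obtain rfl : k = m := by omega
  obtain rfl : l = k + 1 := by omega
  have : x ∈ (L k).verts ∩ (L (k + 1)).verts := ⟨hxk, hxl⟩
  rwa [hc] at this

/-- Each of the two links is 4-ac, so it has an edge and thus a vertex other than `c`. Links up to
`m` and links after `m` share only `c`, so a walk off `c` never passes from one side to the other.
-/
theorem IsChain.isCutVertex (h : IsChain G J L) (h4 : ∀ n ∈ J, IsNAc (L n).coe 4) {m : ℤ} {c : V}
    (hm : m ∈ J) (hm' : m + 1 ∈ J) (hc : (L m).verts ∩ (L (m + 1)).verts = {c}) :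
    IsCutVertex G c := by
  refine ⟨h.connected, fun hp => ?_⟩
  rw [preconnected_induce_iff] at hp
  have ex : ∀ n ∈ J, ∃ a ∈ (L n).verts, a ≠ c := by
    intro n hn
    obtain ⟨a, b, hab⟩ := (h4 n hn).exists_adj
    by_cases hac : a.1 = c
    · exact ⟨b, b.2, fun hbc => hab.ne (Subtype.ext (hac.trans hbc.symm))⟩
    · exact ⟨a, a.2, hac⟩
  obtain ⟨a, ha, hac⟩ := ex m hm
  obtain ⟨b, hb, hbc⟩ := ex (m + 1) hm'
  have hb' : b ∈ {x | ∃ k ∈ J, k ≤ m ∧ x ∈ (L k).verts} := by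
    refine (hp a b hac hbc).closed ?_ ⟨m, hm, le_rfl, ha⟩
    rintro x y hxy hx hy ⟨k, hk, hkm, hxk⟩
    have : (⨆ n ∈ J, L n).Adj x y := by rw [h.union]; exact hxy
    simp only [SimpleGraph.Subgraph.iSup_adj] at this
    obtain ⟨l, hl, hxyl⟩ := this
    rcases le_or_gt l m with hlm | hlm
    · exact ⟨l, hl, hlm, (L l).edge_vert hxyl.symm⟩
    · exact absurd (h.eq_of_mem hc hk hl hkm hlm hxk ((L l).edge_vert hxyl)) hx
  obtain ⟨k, hk, hkm, hbk⟩ := hb'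
  exact hbc (h.eq_of_mem hc hk hm' hkm (by omega) hbk hb)

/-- Each point gets one link containing it; `m` and `n` are the extreme indices chosen. Every link
strictly between them is interior, hence a single edge. -/
theorem isNAc_of_isChain (h : IsChain G J L)
    (h1 : ∀ n ∈ J, IsTwoConnected (L n).coe ∧ IsNAc (L n).coe 4)
    (h2 : ∀ n ∈ J, n - 1 ∈ J → n + 1 ∈ J → IsSingleEdge (L n))
    (h3 : ∀ v : V, IsCutVertex G v → ∀ n ∈ J, v ∈ (L n).verts →
      ((L n).neighborSet v).encard ≤ 2) : IsNAc G 4 := by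
  classical
  intro F _ hF
  by_cases hone : ∃ n ∈ J, ∀ x ∈ F, x ∈ range (incl (L n))
  · obtain ⟨n, hn, hFn⟩ := hone
    obtain ⟨F', hF', hF''⟩ := exists_pullback (L n) F
    obtain ⟨f, hf, hi, hFf⟩ := (h1 n hn).2.exists_curve F'
      ((hF'.trans (Finset.card_filter_le _ _)).trans hF)
    refine ⟨_, isArc_range ((continuous_incl (L n)).comp hf) ((incl_injective (L n)).comp hi), ?_⟩
    intro x hx
    rw [range_comp]
    exact subset_image_incl hF'' hFf hx (hFn x hx)
  have hFne : F.Nonempty := by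
    by_contra hF0
    rw [Finset.not_nonempty_iff_eq_empty] at hF0
    subst hF0
    obtain ⟨v⟩ := h.connected.nonempty
    obtain ⟨n, hn, -⟩ := h.exists_mem_range (vert G v)
    exact hone ⟨n, hn, by simp⟩
  choose k hkJ hk using h.exists_mem_range
  obtain ⟨x₁, hx1, hmin⟩ := Finset.exists_min_image F k hFne
  obtain ⟨x₂, hx2, hmax⟩ := Finset.exists_max_image F k hFne
  set m := k x₁ with hm
  set n := k x₂ with hn
  have hmJ : m ∈ J := hkJ _
  have hnJ : n ∈ J := hkJ _
  have hmn : m < n := by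
    rcases (hmin x₂ hx2).lt_or_eq with hlt | heq
    · exact hlt
    · refine absurd ⟨m, hmJ, fun x hx => ?_⟩ hone
      have e : k x = m := le_antisymm ((hmax x hx).trans heq.ge) (hmin x hx)
      exact e ▸ hk x
  have hJ : ∀ j, m ≤ j → j ≤ n → j ∈ J := fun j hj hj' => h.interval.out hmJ hnJ ⟨hj, hj'⟩
  have hcex : ∀ j, ∃ c, m ≤ j → j < n → (L j).verts ∩ (L (j + 1)).verts = {c} := by
    intro j
    by_cases hj : m ≤ j ∧ j < n
    · obtain ⟨c, hc⟩ := h.consecutive j (hJ j hj.1 (by omega)) (hJ (j + 1) (by omega) (by omega))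
      exact ⟨c, fun _ _ => hc⟩
    · obtain ⟨v⟩ := h.connected.nonempty
      exact ⟨v, fun h h' => absurd ⟨h, h'⟩ hj⟩
  choose c hc using hcex
  have hcl : ∀ j, m ≤ j → j < n → c j ∈ (L j).verts := fun j hj hj' =>
    (show c j ∈ (L j).verts ∩ (L (j + 1)).verts by rw [hc j hj hj']; rfl).1
  have hcr : ∀ j, m ≤ j → j < n → c j ∈ (L (j + 1)).verts := fun j hj hj' =>
    (show c j ∈ (L j).verts ∩ (L (j + 1)).verts by rw [hc j hj hj']; rfl).2
  have hcut : ∀ j, m ≤ j → j < n → IsCutVertex G (c j) := fun j hj hj' =>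
    h.isCutVertex (fun n hn => (h1 n hn).2) (hJ j hj (by omega)) (hJ _ (by omega) (by omega))
      (hc j hj hj')
  -- an arc in a link that starts at a cut vertex
  have harc : ∀ j i, j ∈ J → m ≤ i → i < n → c i ∈ (L j).verts →
      ∃ b A, ArcOn (vert G (c i)) b A ∧ A ⊆ range (incl (L j)) ∧
        ∀ x ∈ F, x ∈ range (incl (L j)) → x ∈ A := by
    intro j i hj hi hi' hcj
    obtain ⟨F', hF', hF''⟩ := exists_pullback (L j) F
    -- No link contains all of the at most four points, so at most three are in this one. That is
    -- the number an arc starting at a given vertex can collect.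
    have hlt : (F.filter (· ∈ range (incl (L j)))).card < F.card := by
      refine Finset.card_lt_card (Finset.filter_ssubset.2 ?_)
      by_contra! hcon
      exact hone ⟨j, hj, hcon⟩
    obtain ⟨b, A, hA, hFA⟩ := exists_arcOn_from_vertex (h1 j hj).1 (h1 j hj).2
      (v := ⟨c i, hcj⟩) ((encard_neighborSet_coe_le _ _).trans (h3 _ (hcut i hi hi') j hj hcj)) F'
      (by omega)
    exact ⟨_, _, hA.map (continuous_incl (L j)) (incl_injective (L j)), image_subset_range _ _,
      fun x hx hxL => subset_image_incl hF'' hFA hx hxL⟩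
  have hmeet : ∀ j, m ≤ j → j < n → ∀ k ∈ J, k ≤ j → ∀ x, x ∈ range (incl (L k)) →
      x ∈ range (incl (L (j + 1))) → x = vert G (c j) := fun j hj hj' k hk hkj x hx hx' =>
    eq_vert_of_bary fun u hu => h.eq_of_mem (hc j hj hj') hk (hJ _ (by omega) (by omega))
      hkj (by omega) (mem_verts_of_bary_pos hx hu) (mem_verts_of_bary_pos hx' hu)
  have step : ∀ j, m ≤ j → j < n → ∃ a A, ArcOn a (vert G (c j)) A ∧
      (∀ x ∈ A, ∃ k, m ≤ k ∧ k ≤ j ∧ x ∈ range (incl (L k))) ∧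
      ∀ x ∈ F, ∀ k, m ≤ k → k ≤ j → x ∈ range (incl (L k)) → x ∈ A := by
    intro j hj
    induction j, hj using Int.leInduction with
    | base =>
      intro hlt
      obtain ⟨b, A, hA, hAL, hFA⟩ := harc m m hmJ le_rfl hlt (hcl m le_rfl hlt)
      refine ⟨b, A, hA.symm, fun x hx => ⟨m, le_rfl, le_rfl, hAL hx⟩, fun x hx k hk hk' hxk => ?_⟩
      obtain rfl : k = m := by omega
      exact hFA x hx hxk
    | succ j hj ih =>
      intro hlt
      obtain ⟨a, A, hA, hAL, hFA⟩ := ih (by omega)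
      obtain ⟨v, w, hvw, hL⟩ := h2 (j + 1) (hJ _ (by omega) (by omega))
        (hJ _ (by omega) (by omega)) (hJ _ (by omega) (by omega))
      have m1 := hcr j hj (by omega)
      have m2 := hcl (j + 1) (by omega) hlt
      -- Otherwise the links `j` and `j + 2` would meet. Hence the two cut vertices are the two ends
      -- of the edge in between, which can be appended whole.
      have hne : c j ≠ c (j + 1) := by
        intro heq
        exact (h.nonconsecutive j (hJ _ (by omega) (by omega)) (j + 1 + 1)
          (hJ _ (by omega) (by omega)) (by omega)).le_bot
          ⟨hcl j hj (by omega), heq ▸ hcr (j + 1) (by omega) hlt⟩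
      have hverts : ∀ z, z ∈ (L (j + 1)).verts → z = v ∨ z = w := by
        intro z hz
        rw [hL] at hz
        simpa using hz
      have hadj : (L (j + 1)).Adj (c j) (c (j + 1)) := by
        rw [hL, SimpleGraph.subgraphOfAdj_adj]
        rcases hverts _ m1 with e1 | e1 <;> rcases hverts _ m2 with e2 | e2
        · exact absurd (e1.trans e2.symm) hne
        · rw [e1, e2]
        · rw [e1, e2, Sym2.eq_swap]
        · exact absurd (e1.trans e2.symm) hne
      have hall : ∀ z : (L (j + 1)).verts, z = ⟨c j, m1⟩ ∨ z = ⟨c (j + 1), m2⟩ := by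
        rintro ⟨z, hz⟩
        simp only [Subtype.mk.injEq]
        have := hverts _ m1
        have := hverts _ m2
        have := hverts _ hz
        grind
      have hB := (arcOn_univ (G := (L (j + 1)).coe) (v := ⟨c j, m1⟩) (x := ⟨c (j + 1), m2⟩) hadj
        hall).map (continuous_incl _) (incl_injective _)
      rw [image_univ] at hB
      refine ⟨a, _, hA.trans hB ?_, ?_, ?_⟩
      · intro x hx hx'
        obtain ⟨k, hk, hk', hxk⟩ := hAL x hx
        exact hmeet j hj (by omega) k (hJ k hk (by omega)) hk' x hxk hx'
      · rintro x (hx | hx)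
        · obtain ⟨k, hk, hk', hxk⟩ := hAL x hx
          exact ⟨k, hk, by omega, hxk⟩
        · exact ⟨j + 1, by omega, le_rfl, hx⟩
      · intro x hx k hk hk' hxk
        rcases hk'.lt_or_eq with hlt' | rfl
        · exact Or.inl (hFA x hx k hk (by omega) hxk)
        · exact Or.inr hxk
  obtain ⟨a, A, hA, hAL, hFA⟩ := step (n - 1) (by omega) (by omega)
  have hcn := hcr (n - 1) (by omega) (by omega)
  rw [sub_add_cancel] at hcn
  obtain ⟨b, B, hB, hBL, hFB⟩ := harc n (n - 1) hnJ (by omega) (by omega) hcn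
  refine ⟨A ∪ B, (hA.trans hB ?_).isArc, ?_⟩
  · intro x hx hx'
    obtain ⟨k, hk, hk', hxk⟩ := hAL x hx
    refine hmeet (n - 1) (by omega) (by omega) k (hJ k hk (by omega)) hk' x hxk ?_
    rw [sub_add_cancel]
    exact hBL hx'
  · intro x hx
    rcases (hmax x hx).lt_or_eq with hlt | heq
    · exact Or.inl (hFA x hx (k x) (hmin x hx) (by omega) (hk x))
    · exact Or.inr (hFB x hx (heq ▸ hk x))

end Sufficiency

/-! ### Order of points on a line -/

section Order

variable {α : Type*} [LinearOrder α]

theorem uIcc_same_side {b r s t : α} (hb : b ≠ r) (hs : s ≠ r) (ht : t ≠ r) (h1 : r ∈ uIcc b s)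
    (h2 : r ∈ uIcc b t) : (r < s ∧ r < t) ∨ (s < r ∧ t < r) := by
  rw [mem_uIcc] at h1 h2
  grind

/-- Of three points on the same side of `r`, the one in the middle separates the other two, and
`r` does not lie between those. -/
theorem false_of_middle {b r t₁ t₂ t₃ : α} (hb : b ≠ r) (n1 : t₁ ≠ r) (n2 : t₂ ≠ r) (n3 : t₃ ≠ r)
    (h1 : r ∈ uIcc b t₁) (h2 : r ∈ uIcc b t₂) (h3 : r ∈ uIcc b t₃) (n12 : t₁ ≠ t₂) (n13 : t₁ ≠ t₃)
    (n23 : t₂ ≠ t₃) (m1 : t₂ < t₁ → t₁ < t₃ → t₂ ≤ r ∧ r ≤ t₃)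
    (m1' : t₃ < t₁ → t₁ < t₂ → t₃ ≤ r ∧ r ≤ t₂) (m2 : t₁ < t₂ → t₂ < t₃ → t₁ ≤ r ∧ r ≤ t₃)
    (m2' : t₃ < t₂ → t₂ < t₁ → t₃ ≤ r ∧ r ≤ t₁) (m3 : t₁ < t₃ → t₃ < t₂ → t₁ ≤ r ∧ r ≤ t₂)
    (m3' : t₂ < t₃ → t₃ < t₁ → t₂ ≤ r ∧ r ≤ t₁) : False := by
  have e : (r < t₁ ∧ r < t₂ ∧ r < t₃) ∨ (t₁ < r ∧ t₂ < r ∧ t₃ < r) := by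
    rcases uIcc_same_side hb n1 n2 h1 h2 with h | h <;>
      rcases uIcc_same_side hb n1 n3 h1 h3 with h' | h'
    · exact Or.inl ⟨h.1, h.2, h'.2⟩
    · exact absurd (h.1.trans h'.1) (lt_irrefl _)
    · exact absurd (h.1.trans h'.1) (lt_irrefl _)
    · exact Or.inr ⟨h.1, h.2, h'.2⟩
  have k : ∀ x y : α, (x = t₁ ∨ x = t₂ ∨ x = t₃) → (y = t₁ ∨ y = t₂ ∨ y = t₃) →
      ¬ (x ≤ r ∧ r ≤ y) := by
    intro x y hx hy h
    rcases e with ⟨e1, e2, e3⟩ | ⟨e1, e2, e3⟩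
    · refine h.1.not_gt ?_
      rcases hx with hx | hx | hx <;> rw [hx] <;> assumption
    · refine h.2.not_gt ?_
      rcases hy with hy | hy | hy <;> rw [hy] <;> assumption
  rcases lt_or_gt_of_ne n12 with g12 | g12 <;> rcases lt_or_gt_of_ne n13 with g13 | g13 <;>
    rcases lt_or_gt_of_ne n23 with g23 | g23
  · exact k _ _ (by simp) (by simp) (m2 g12 g23)
  · exact k _ _ (by simp) (by simp) (m3 g13 g23)
  · exact absurd (g12.trans (g23.trans g13)) (lt_irrefl _)
  · exact k _ _ (by simp) (by simp) (m1' g13 g12)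
  · exact k _ _ (by simp) (by simp) (m1 g12 g13)
  · exact absurd (g12.trans (g13.trans g23)) (lt_irrefl _)
  · exact k _ _ (by simp) (by simp) (m3' g23 g13)
  · exact k _ _ (by simp) (by simp) (m2' g23 g12)

end Order

/-! ### Necessity: obstructions read off the order of points on a curve -/

section Obstructions

variable {V : Type u} {G : SimpleGraph V}

/-- The midpoint of an edge. -/
noncomputable def mid (d : G.Dart) : Realization G := edge d ⟨1 / 2, by norm_num, by norm_num⟩

theorem bary_mid_pos {d : G.Dart} {v : V} : 0 < bary v (mid d) ↔ d.fst = v ∨ d.snd = v := by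
  refine bary_edge_pos_iff ?_ ?_
  · change (0 : ℝ) < 1 / 2
    norm_num
  · change (1 / 2 : ℝ) < 1
    norm_num

/-- A curve that passes through the midpoint of an edge passes through either end of it. -/
theorem hits_of_mid {f : I → Realization G} (hf : Continuous f) (hi : Function.Injective f)
    {d : G.Dart} {s t r : I} (hst : s < t) (htr : t < r) (ht : f t = mid d)
    (hs : ¬ (0 < bary d.fst (f s) ∧ 0 < bary d.snd (f s)))
    (hr : ¬ (0 < bary d.fst (f r) ∧ 0 < bary d.snd (f r))) :
    ∃ q, s ≤ q ∧ q ≤ r ∧ f q = vert G d.fst := by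
  have hpos : 0 < bary d.fst (f t) ∧ 0 < bary d.snd (f t) := by
    rw [ht, bary_mid_pos, bary_mid_pos]; simp
  obtain ⟨q₁, h1, h1'⟩ := hits_of_edge hf d.adj.ne hpos hs
  obtain ⟨q₂, h2, h2'⟩ := hits_of_edge hf d.adj.ne hpos hr
  rw [uIcc_of_ge hst.le] at h1
  rw [uIcc_of_le htr.le] at h2
  rcases h1' with h1' | h1'
  · exact ⟨q₁, h1.1, h1.2.trans htr.le, h1'⟩
  rcases h2' with h2' | h2'
  · exact ⟨q₂, hst.le.trans h2.1, h2.2, h2'⟩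
  -- Otherwise the curve meets the end `d.snd` both before and after the midpoint. By injectivity
  -- these two times agree with `t`, but `f t` is not a vertex.
  obtain rfl : q₁ = q₂ := hi (h1'.trans h2'.symm)
  obtain rfl : q₁ = t := le_antisymm h1.2 h2.1
  rw [h1', bary_vert_pos] at hpos
  exact absurd hpos.1.symm d.adj.ne

/-- A curve from a vertex to the midpoint of an edge meets every vertex that separates them. -/
theorem hits_of_not_joinedOff_mid {f : I → Realization G} (hf : Continuous f) {v b : V}
    (hb : b ≠ v) {d : G.Dart} {s t : I} (h1 : ¬ JoinedOff G {v} b d.fst)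
    (h2 : ¬ JoinedOff G {v} b d.snd) (hs : f s = vert G b) (ht : f t = mid d) :
    ∃ r ∈ uIcc s t, f r = vert G v := by
  have hb' : b ∉ ({v} : Set V) := hb
  obtain ⟨r, hr, c, rfl, hc⟩ := (Param.refl G).hits (S := {v}) (C := {z | JoinedOff G {v} b z})
    (fun z hz => hz.notMem hb')
    (fun x y hxy hx hy => JoinedOff.trans hx (JoinedOff.adj hxy (JoinedOff.notMem hx hb') hy)) hf
    (s := s) (t := t) ⟨b, Relation.ReflTransGen.refl, by rw [hs]; exact bary_vert_pos.2 rfl⟩ (by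
      intro u hu hpos
      rw [ht, bary_mid_pos] at hpos
      rcases hpos with rfl | rfl
      · exact h1 hu
      · exact h2 hu)
  exact ⟨r, hr, hc⟩

theorem hits_of_not_joinedOff_vert {f : I → Realization G} (hf : Continuous f) {v a b : V}
    (ha : a ≠ v) {s t : I} (h : ¬ JoinedOff G {v} a b) (hs : f s = vert G a)
    (ht : f t = vert G b) : ∃ r ∈ uIcc s t, f r = vert G v := by
  obtain ⟨r, hr, c, rfl, hc⟩ := (Param.refl G).hits_of_not_joinedOff hf
    (show a ∉ ({v} : Set V) from ha) h hs ht
  exact ⟨r, hr, hc⟩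

theorem IsNAc.connected (h : IsNAc G 4) : G.Connected := by
  classical
  have : Nonempty V := ⟨h.exists_adj.choose⟩
  refine ⟨preconnected_iff_joinedOff.2 fun a b => ?_⟩
  by_contra hab
  obtain ⟨f, hf, hi, hF⟩ := h.exists_curve {vert G a, vert G b} (Finset.card_le_two.trans (by simp))
  obtain ⟨s, hs⟩ := hF (show vert G a ∈ _ by simp)
  obtain ⟨t, ht⟩ := hF (show vert G b ∈ _ by simp)
  obtain ⟨r, -, c, hc, -⟩ := (Param.refl G).hits_of_not_joinedOff hf (by simp) hab hs ht
  exact hc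

/-- Removing a vertex from a 4-ac graph leaves at most two components. -/
theorem IsNAc.two_sides (h : IsNAc G 4) {v x₁ x₂ x₃ : V} (h1 : x₁ ≠ v) (h2 : x₂ ≠ v) (h3 : x₃ ≠ v) :
    JoinedOff G {v} x₁ x₂ ∨ JoinedOff G {v} x₁ x₃ ∨ JoinedOff G {v} x₂ x₃ := by
  classical
  by_contra! hc
  obtain ⟨h12, h13, h23⟩ := hc
  obtain ⟨f, hf, hi, hF⟩ := h.exists_curve {vert G x₁, vert G x₂, vert G x₃}
    (Finset.card_le_three.trans (by simp))
  obtain ⟨t₁, ht1⟩ := hF (show vert G x₁ ∈ _ by simp)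
  obtain ⟨t₂, ht2⟩ := hF (show vert G x₂ ∈ _ by simp)
  obtain ⟨t₃, ht3⟩ := hF (show vert G x₃ ∈ _ by simp)
  obtain ⟨r, hr, hrv⟩ := hits_of_not_joinedOff_vert hf h1 h12 ht1 ht2
  obtain ⟨r', hr', hrv'⟩ := hits_of_not_joinedOff_vert hf h1 h13 ht1 ht3
  obtain ⟨r'', hr'', hrv''⟩ := hits_of_not_joinedOff_vert hf h2 h23 ht2 ht3
  -- All three crossings of `v` happen at the same time, and three times cannot lie pairwise on
  -- opposite sides of it.
  obtain rfl : r' = r := hi (hrv'.trans hrv.symm)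
  obtain rfl : r'' = r' := hi (hrv''.trans hrv'.symm)
  have n1 : t₁ ≠ r'' := by rintro rfl; exact h1 (vert_injective (ht1.symm.trans hrv))
  have n2 : t₂ ≠ r'' := by rintro rfl; exact h2 (vert_injective (ht2.symm.trans hrv))
  have n3 : t₃ ≠ r'' := by rintro rfl; exact h3 (vert_injective (ht3.symm.trans hrv))
  rw [mem_uIcc] at hr hr' hr''
  grind

/-- In a 4-ac graph, every vertex has at most two edges to a part that it separates from another
vertex. -/
theorem IsNAc.not_three_neighbors (h : IsNAc G 4) {v b a₁ a₂ a₃ : V} (hb : b ≠ v)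
    (h1 : G.Adj v a₁) (h2 : G.Adj v a₂) (h3 : G.Adj v a₃) (h12 : a₁ ≠ a₂) (h13 : a₁ ≠ a₃)
    (h23 : a₂ ≠ a₃) (n1 : ¬ JoinedOff G {v} b a₁) (n2 : ¬ JoinedOff G {v} b a₂)
    (n3 : ¬ JoinedOff G {v} b a₃) : False := by
  classical
  let d : ∀ a, G.Adj v a → G.Dart := fun a h => ⟨(v, a), h⟩
  obtain ⟨f, hf, hi, hF⟩ := h.exists_curve
    {vert G b, mid (d a₁ h1), mid (d a₂ h2), mid (d a₃ h3)} Finset.card_le_four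
  obtain ⟨tb, htb⟩ := hF (show vert G b ∈ _ by simp)
  obtain ⟨t₁, ht1⟩ := hF (show mid (d a₁ h1) ∈ _ by simp)
  obtain ⟨t₂, ht2⟩ := hF (show mid (d a₂ h2) ∈ _ by simp)
  obtain ⟨t₃, ht3⟩ := hF (show mid (d a₃ h3) ∈ _ by simp)
  have nv : ¬ JoinedOff G {v} b v := fun h => h.notMem (show b ∉ ({v} : Set V) from hb) rfl
  obtain ⟨r₁, hr1, e1⟩ := hits_of_not_joinedOff_mid hf hb (d := d a₁ h1) nv n1 htb ht1
  obtain ⟨r₂, hr2, e2⟩ := hits_of_not_joinedOff_mid hf hb (d := d a₂ h2) nv n2 htb ht2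
  obtain ⟨r₃, hr3, e3⟩ := hits_of_not_joinedOff_mid hf hb (d := d a₃ h3) nv n3 htb ht3
  obtain rfl : r₁ = r₂ := hi (e1.trans e2.symm)
  obtain rfl : r₁ = r₃ := hi (e1.trans e3.symm)
  have nb : tb ≠ r₁ := by rintro rfl; exact hb (vert_injective (htb.symm.trans e1))
  have out : ∀ (a a' : V) (h : G.Adj v a) (h' : G.Adj v a') (t : I), a ≠ a' → f t = mid (d a h) →
      ¬ (0 < bary (d a' h').fst (f t) ∧ 0 < bary (d a' h').snd (f t)) := by
    rintro a a' h h' t haa ht ⟨-, hpos⟩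
    rw [ht, bary_mid_pos] at hpos
    rcases hpos with hpos | hpos
    · exact h'.ne hpos
    · exact haa hpos
  have dist : ∀ (a a' : V) (h : G.Adj v a) (h' : G.Adj v a') (t t' : I), a ≠ a' → f t = mid (d a h) →
      f t' = mid (d a' h') → t ≠ t' := by
    rintro a a' h h' t t' haa ht ht' rfl
    refine out a a' h h' t haa ht ?_
    rw [ht', bary_mid_pos, bary_mid_pos]; simp
  have ne : ∀ (a : V) (h : G.Adj v a) (t : I), f t = mid (d a h) → t ≠ r₁ := by
    rintro a h t ht rfl
    have : 0 < bary a (mid (d a h)) := bary_mid_pos.2 (Or.inr rfl)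
    rw [← ht, e1, bary_vert_pos] at this
    exact h.ne this
  -- The midpoint in the middle is traversed along its whole edge, so `v` is passed between the
  -- other two. Yet all three midpoints come on the same side of the passage through `v`, the one
  -- away from `b`.
  have main : ∀ (a a' a'' : V) (h : G.Adj v a) (h' : G.Adj v a') (h'' : G.Adj v a'') (t t' t'' : I),
      a ≠ a' → a'' ≠ a' → f t = mid (d a h) → f t' = mid (d a' h') → f t'' = mid (d a'' h'') →
      t < t' → t' < t'' → t ≤ r₁ ∧ r₁ ≤ t'' := by
    intro a a' a'' h h' h'' t t' t'' ha ha' ht ht' ht'' hlt hlt'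
    obtain ⟨q, hq1, hq2, hq⟩ := hits_of_mid hf hi hlt hlt' ht' (out a a' h h' t ha ht)
      (out a'' a' h'' h' t'' ha' ht'')
    obtain rfl : q = r₁ := hi (hq.trans e1.symm)
    exact ⟨hq1, hq2⟩
  exact false_of_middle nb (ne _ _ _ ht1) (ne _ _ _ ht2) (ne _ _ _ ht3) hr1 hr2 hr3
    (dist _ _ h1 h2 t₁ t₂ h12 ht1 ht2) (dist _ _ h1 h3 t₁ t₃ h13 ht1 ht3)
    (dist _ _ h2 h3 t₂ t₃ h23 ht2 ht3) (main _ _ _ h2 h1 h3 _ _ _ h12.symm h13.symm ht2 ht1 ht3)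
    (main _ _ _ h3 h1 h2 _ _ _ h13.symm h12.symm ht3 ht1 ht2)
    (main _ _ _ h1 h2 h3 _ _ _ h12 h23.symm ht1 ht2 ht3)
    (main _ _ _ h3 h2 h1 _ _ _ h23.symm h12 ht3 ht2 ht1)
    (main _ _ _ h1 h3 h2 _ _ _ h13 h23 ht1 ht3 ht2) (main _ _ _ h2 h3 h1 _ _ _ h23 h13 ht2 ht3 ht1)

/-- If `u` and `w` are cut vertices of a 4-ac graph, then `u` has at most one neighbour on the side
of `w`. -/
theorem IsNAc.eq_of_adj_of_adj (h : IsNAc G 4) {u w b b' a₁ a₂ : V} (huw : u ≠ w) (hb : b ≠ u)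
    (hb' : b' ≠ w) (nb : ¬ JoinedOff G {u} b w) (nb' : ¬ JoinedOff G {w} b' u) (h1 : G.Adj u a₁)
    (h2 : G.Adj u a₂) (j1 : JoinedOff G {u} a₁ w) (j2 : JoinedOff G {u} a₂ w) : a₁ = a₂ := by
  classical
  by_contra h12
  let d : ∀ a, G.Adj u a → G.Dart := fun a h => ⟨(u, a), h⟩
  obtain ⟨f, hf, hi, hF⟩ := h.exists_curve
    {vert G b, vert G b', mid (d a₁ h1), mid (d a₂ h2)} Finset.card_le_four
  obtain ⟨tb, htb⟩ := hF (show vert G b ∈ _ by simp)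
  obtain ⟨tb', htb'⟩ := hF (show vert G b' ∈ _ by simp)
  obtain ⟨t₁, ht1⟩ := hF (show mid (d a₁ h1) ∈ _ by simp)
  obtain ⟨t₂, ht2⟩ := hF (show mid (d a₂ h2) ∈ _ by simp)
  have nu : ¬ JoinedOff G {u} b u := fun h => h.notMem (show b ∉ ({u} : Set V) from hb) rfl
  have nw : ¬ JoinedOff G {w} b' w := fun h => h.notMem (show b' ∉ ({w} : Set V) from hb') rfl
  have na : ∀ a, G.Adj u a → ¬ JoinedOff G {w} b' a := by
    intro a ha hj
    by_cases haw : a = w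
    · exact nw (haw ▸ hj)
    · exact nb' (hj.trans (JoinedOff.adj ha.symm haw huw))
  obtain ⟨r₁, hr1, e1⟩ := hits_of_not_joinedOff_mid hf hb (d := d a₁ h1) nu
    (fun h => nb (h.trans j1)) htb ht1
  obtain ⟨r₂, hr2, e2⟩ := hits_of_not_joinedOff_mid hf hb (d := d a₂ h2) nu
    (fun h => nb (h.trans j2)) htb ht2
  obtain ⟨q₁, hq1, g1⟩ := hits_of_not_joinedOff_mid hf hb' (d := d a₁ h1) nb' (na _ h1) htb' ht1
  obtain ⟨q₂, hq2, g2⟩ := hits_of_not_joinedOff_mid hf hb' (d := d a₂ h2) nb' (na _ h2) htb' ht2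
  obtain rfl : r₁ = r₂ := hi (e1.trans e2.symm)
  obtain rfl : q₁ = q₂ := hi (g1.trans g2.symm)
  obtain ⟨r₃, hr3, e3⟩ := hits_of_not_joinedOff_vert hf hb nb htb g1
  obtain rfl : r₁ = r₃ := hi (e1.trans e3.symm)
  have n1 : tb ≠ r₁ := by rintro rfl; exact hb (vert_injective (htb.symm.trans e1))
  have n2 : tb' ≠ q₁ := by rintro rfl; exact hb' (vert_injective (htb'.symm.trans g1))
  have n3 : r₁ ≠ q₁ := by rintro rfl; exact huw (vert_injective (e1.symm.trans g1))
  have out : ∀ (a a' : V) (h : G.Adj u a) (h' : G.Adj u a') (t : I), a ≠ a' → f t = mid (d a h) →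
      ¬ (0 < bary (d a' h').fst (f t) ∧ 0 < bary (d a' h').snd (f t)) := by
    rintro a a' h h' t haa ht ⟨-, hpos⟩
    rw [ht, bary_mid_pos] at hpos
    rcases hpos with hpos | hpos
    · exact h'.ne hpos
    · exact haa hpos
  have outw : ∀ (a' : V) (h' : G.Adj u a'),
      ¬ (0 < bary (d a' h').fst (f q₁) ∧ 0 < bary (d a' h').snd (f q₁)) := by
    rintro a' h' ⟨hpos, -⟩
    rw [g1, bary_vert_pos] at hpos
    exact huw hpos.symm
  have nv : ∀ (a : V) (h : G.Adj u a) (t : I) (v : V), f t = mid (d a h) → f t ≠ vert G v := by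
    intro a h t v ht ht'
    have e1 : 0 < bary u (f t) := by rw [ht]; exact bary_mid_pos.2 (Or.inl rfl)
    have e2 : 0 < bary a (f t) := by rw [ht]; exact bary_mid_pos.2 (Or.inr rfl)
    rw [ht', bary_vert_pos] at e1 e2
    exact h.ne (e1.symm.trans e2)
  have m1 : t₁ ≠ r₁ := by rintro rfl; exact nv _ _ _ _ ht1 e1
  have m2 : t₂ ≠ r₁ := by rintro rfl; exact nv _ _ _ _ ht2 e1
  have m3 : t₁ ≠ q₁ := by rintro rfl; exact nv _ _ _ _ ht1 g1
  have m4 : t₂ ≠ q₁ := by rintro rfl; exact nv _ _ _ _ ht2 g1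
  have m5 : t₁ ≠ t₂ := by
    rintro rfl
    refine out a₁ a₂ h1 h2 t₁ h12 ht1 ?_
    rw [ht2, bary_mid_pos, bary_mid_pos]; simp
  have main : ∀ (a : V) (h : G.Adj u a) (s t r : I), f t = mid (d a h) → s < t → t < r →
      ¬ (0 < bary (d a h).fst (f s) ∧ 0 < bary (d a h).snd (f s)) →
      ¬ (0 < bary (d a h).fst (f r) ∧ 0 < bary (d a h).snd (f r)) → s ≤ r₁ ∧ r₁ ≤ r := by
    intro a h s t r ht hst htr hs hr
    obtain ⟨q, hq1, hq2, hq⟩ := hits_of_mid hf hi hst htr ht hs hr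
    obtain rfl : q = r₁ := hi (hq.trans e1.symm)
    exact ⟨hq1, hq2⟩
  -- Seen from `b'`, both midpoints lie beyond `w`, so `w` is not passed between them.
  have hq : ∀ t t' : I, t ≠ q₁ → t' ≠ q₁ → q₁ ∈ uIcc tb' t → q₁ ∈ uIcc tb' t' → t < q₁ → q₁ < t' →
      False := by
    intro t t' ht ht' g g' hlt hlt'
    rcases uIcc_same_side n2 ht ht' g g' with hh | hh
    · exact hlt.not_gt hh.1
    · exact hlt'.not_gt hh.2
  -- Both midpoints and `w` come on one side of `u`. If a midpoint is the middle one, its edge is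
  -- traversed and `u` is passed there; that `w` is in the middle is excluded by `hq`.
  exact false_of_middle n1 m1 m2 n3.symm hr1 hr2 hr3 m5 m3 m4
    (fun g g' => main _ h1 _ _ _ ht1 g g' (out _ _ h2 h1 t₂ (Ne.symm h12) ht2) (outw _ _))
    (fun g g' => main _ h1 _ _ _ ht1 g g' (outw _ _) (out _ _ h2 h1 t₂ (Ne.symm h12) ht2))
    (fun g g' => main _ h2 _ _ _ ht2 g g' (out _ _ h1 h2 t₁ h12 ht1) (outw _ _))
    (fun g g' => main _ h2 _ _ _ ht2 g g' (outw _ _) (out _ _ h1 h2 t₁ h12 ht1))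
    (fun g g' => (hq _ _ m3 m4 hq1 hq2 g g').elim) (fun g g' => (hq _ _ m4 m3 hq2 hq1 g g').elim)

end Obstructions

/-! ### Parts of the graph that are attached at a single vertex -/

section Retract

variable {V : Type u} {G : SimpleGraph V}

/-- With this left inverse, curves in `|G|` are brought into the 1-complex of `L` by a continuous
map, and no comparison of its topology with the subspace topology is needed. -/
theorem mapR_incl {L : G.Subgraph} {f : V → L.verts}
    (hf : ∀ a b, G.Adj a b → f a = f b ∨ L.coe.Adj (f a) (f b)) (hfL : ∀ x : L.verts, f x = x)
    (z : Realization L.coe) : mapR f hf (incl L z) = z := by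
  rcases realization_cases z with ⟨v, rfl⟩ | ⟨d, t, rfl⟩
  · rw [incl_vert, mapR_vert, hfL]
  · have h : L.coe.Adj (f d.fst) (f d.snd) := by rw [hfL, hfL]; exact d.adj
    rw [incl, mapR_edge (H := G) d (L.adj_sub d.adj), mapR_edge _ h]
    congr 1
    exact SimpleGraph.Dart.ext _ _ (Prod.ext (hfL _) (hfL _))

theorem exists_bary_pos_of_notMem_range {X : Set V} {y : Realization G}
    (hy : y ∉ range (incl ((⊤ : G.Subgraph).induce X))) : ∃ u ∉ X, 0 < bary u y := by
  rcases realization_cases' y with ⟨v, rfl⟩ | ⟨d, t, h0, h1, rfl⟩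
  · exact ⟨v, fun h => hy (vert_mem_range_incl h), bary_vert_pos.2 rfl⟩
  · by_contra! hc
    have key : ∀ u, d.fst = u ∨ d.snd = u → u ∈ X := fun u hu => by
      by_contra h
      exact (hc u h).not_gt ((bary_edge_pos_iff h0 h1).2 hu)
    exact hy (edge_mem_range_incl
      (L := (⊤ : G.Subgraph).induce X) (d := d) ⟨key _ (Or.inl rfl), key _ (Or.inr rfl), d.adj⟩ t)

variable {X : Set V} {c : V}

/-- The retraction onto the graph induced by `X` that sends everything else to `c`. -/
noncomputable def retract (hc : c ∈ X) (x : V) : ((⊤ : G.Subgraph).induce X).verts :=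
  open Classical in if h : x ∈ X then ⟨x, h⟩ else ⟨c, hc⟩

theorem retract_of_mem (hc : c ∈ X) {x : V} (h : x ∈ X) : retract (G := G) hc x = ⟨x, h⟩ :=
  dif_pos h

theorem retract_of_notMem (hc : c ∈ X) {x : V} (h : x ∉ X) : retract (G := G) hc x = ⟨c, hc⟩ :=
  dif_neg h

theorem retract_coe (hc : c ∈ X) (x : ((⊤ : G.Subgraph).induce X).verts) :
    retract (G := G) hc x = x := retract_of_mem hc x.2

theorem retract_adj (hc : c ∈ X) (hX : ∀ x ∈ X, x ≠ c → ∀ y, G.Adj x y → y ∈ X) (a b : V)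
    (hab : G.Adj a b) : retract (G := G) hc a = retract hc b ∨
      ((⊤ : G.Subgraph).induce X).coe.Adj (retract hc a) (retract hc b) := by
  have aux : ∀ a b, G.Adj a b → a ∈ X → b ∉ X → a = c := fun a b hab ha hb => by
    by_contra h
    exact hb (hX a ha h b hab)
  by_cases ha : a ∈ X <;> by_cases hb : b ∈ X
  · rw [retract_of_mem hc ha, retract_of_mem hc hb]
    exact Or.inr ⟨ha, hb, hab⟩
  · left
    rw [retract_of_mem hc ha, retract_of_notMem hc hb]
    exact Subtype.ext (aux a b hab ha hb)
  · left
    rw [retract_of_notMem hc ha, retract_of_mem hc hb]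
    exact Subtype.ext (aux b a hab.symm hb ha).symm
  · left
    rw [retract_of_notMem hc ha, retract_of_notMem hc hb]

/-- Between two points of the part of `|G|` spanned by `X`, a simple curve cannot leave this part,
if `X` can only be left through one vertex. -/
theorem mem_range_of_mem_Icc (hc : c ∈ X) (hX : ∀ x ∈ X, x ≠ c → ∀ y, G.Adj x y → y ∈ X)
    {f : I → Realization G} (hf : Continuous f) (hi : Function.Injective f) {s t r : I}
    (hs : f s ∈ range (incl ((⊤ : G.Subgraph).induce X)))
    (ht : f t ∈ range (incl ((⊤ : G.Subgraph).induce X))) (hr : r ∈ Icc s t) :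
    f r ∈ range (incl ((⊤ : G.Subgraph).induce X)) := by
  by_contra hy
  obtain ⟨u, hu, hup⟩ := exists_bary_pos_of_notMem_range hy
  have key : ∀ q, f q ∈ range (incl ((⊤ : G.Subgraph).induce X)) →
      ∃ p ∈ uIcc r q, f p = vert G c := by
    intro q hq
    obtain ⟨p, hp, c', hc', h⟩ := (Param.refl G).hits (C := Xᶜ) (S := {c}) (f := f) (s := r) (t := q)
      (fun a ha hac => ha (hac ▸ hc))
      (fun a b hab ha hb hbX => ha (hX b hbX hb a hab.symm)) hf ⟨u, hu, hup⟩
      (fun w hw hwp => hw (mem_verts_of_bary_pos hq hwp))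
    rw [mem_singleton_iff.1 hc'] at h
    exact ⟨p, hp, h⟩
  obtain ⟨p, hp, h⟩ := key s hs
  obtain ⟨q, hq, h'⟩ := key t ht
  obtain rfl := hi (h.trans h'.symm)
  rw [uIcc_of_ge hr.1] at hp
  rw [uIcc_of_le hr.2] at hq
  obtain rfl := le_antisymm hp.2 hq.1
  exact hy (h ▸ vert_mem_range_incl hc)

/-- Take an arc of `|G|` through the points and cut it down to the stretch from the first to the
last of them. To leave `X` and return it would have to pass `c` twice, so this stretch stays in the
part over `X`. -/
theorem IsNAc.induce (h : IsNAc G 4) (hc : c ∈ X)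
    (hX : ∀ x ∈ X, x ≠ c → ∀ y, G.Adj x y → y ∈ X) (hne : ∃ x ∈ X, x ≠ c) :
    IsNAc ((⊤ : G.Subgraph).induce X).coe 4 := by
  classical
  set L := (⊤ : G.Subgraph).induce X with hL
  intro F _ hF
  -- Two distinct points are needed to keep that stretch from degenerating to a point; if `F` has at
  -- most one, two vertices of `X` are added, within the bound of four.
  obtain ⟨F', hFF', hF', p, hp, q, hq, hpq⟩ : ∃ F' : Finset (Realization L.coe), F ⊆ F' ∧
      F'.card ≤ 4 ∧ ∃ p ∈ F', ∃ q ∈ F', p ≠ q := by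
    by_cases h1 : 1 < F.card
    · exact ⟨F, subset_rfl, hF, Finset.one_lt_card.1 h1⟩
    · obtain ⟨x, hx, hxc⟩ := hne
      refine ⟨insert (vert L.coe ⟨c, hc⟩) (insert (vert L.coe ⟨x, hx⟩) F), ?_, ?_, _,
        Finset.mem_insert_self _ _, _, Finset.mem_insert_of_mem (Finset.mem_insert_self _ _), ?_⟩
      · exact (Finset.subset_insert _ _).trans (Finset.subset_insert _ _)
      · have h2 := Finset.card_insert_le (vert L.coe ⟨c, hc⟩) (insert (vert L.coe ⟨x, hx⟩) F)
        have h3 := Finset.card_insert_le (vert L.coe ⟨x, hx⟩) F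
        omega
      · intro he
        exact hxc (congrArg Subtype.val (vert_injective he)).symm
  obtain ⟨f, hf, hi, hFf⟩ := h.exists_curve (F'.image (incl L)) (Finset.card_image_le.trans hF')
  have ex : ∀ z ∈ F', ∃ r, f r = incl L z := fun z hz =>
    hFf (Finset.mem_coe.2 (Finset.mem_image_of_mem _ hz))
  choose! τ hτ using ex
  obtain ⟨s, hs, hs'⟩ := Finset.exists_min_image F' τ ⟨p, hp⟩
  obtain ⟨t, ht, ht'⟩ := Finset.exists_max_image F' τ ⟨p, hp⟩
  have hst : τ s < τ t := by
    refine lt_of_le_of_ne ((hs' p hp).trans (ht' p hp)) fun he => hpq ?_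
    have : τ p = τ q :=
      ((ht' p hp).trans (he ▸ hs' q hq)).antisymm ((ht' q hq).trans (he ▸ hs' p hp))
    exact incl_injective L (by rw [← hτ p hp, ← hτ q hq, this])
  have hin : ∀ r ∈ Icc (τ s) (τ t), f r ∈ range (incl L) := fun r hr =>
    mem_range_of_mem_Icc hc hX hf hi ⟨s, (hτ s hs).symm⟩ ⟨t, (hτ t ht).symm⟩ hr
  have hg := mapR_incl (retract_adj hc hX) (retract_coe hc)
  have inj : InjOn (mapR (retract hc) (retract_adj hc hX) ∘ f) (Icc (τ s) (τ t)) := by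
    intro a ha b hb hab
    obtain ⟨z, hz⟩ := hin a ha
    obtain ⟨w, hw⟩ := hin b hb
    simp only [Function.comp_apply, ← hz, ← hw] at hab
    rw [hg, hg] at hab
    exact hi (by rw [← hz, ← hw, hab])
  refine ⟨_, (arcOn_of_injOn (continuous_mapR.comp hf) hst inj).isArc, fun z hz => ?_⟩
  have hz' := hFF' hz
  refine ⟨τ z, ⟨hs' z hz', ht' z hz'⟩, ?_⟩
  rw [Function.comp_apply, hτ z hz', hg]

/-- Walks of the whole graph are pushed into `X` by the retraction. Deleting `v ≠ c` does not
disconnect `G`. Deleting `c` leaves at most two components, one of which contains `b` and no vertex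
of `X`, so the rest of `X` lies in the other. -/
theorem IsNAc.isTwoConnected_induce (h : IsNAc G 4) (hc : c ∈ X)
    (hX : ∀ x ∈ X, x ≠ c → ∀ y, G.Adj x y → y ∈ X) (hb : ∃ b, b ∉ X)
    (hcut : ∀ x ∈ X, IsCutVertex G x → x = c) :
    IsTwoConnected ((⊤ : G.Subgraph).induce X).coe := by
  set L := (⊤ : G.Subgraph).induce X with hL
  obtain ⟨b, hb⟩ := hb
  have hbc : b ≠ c := fun h => hb (h ▸ hc)
  have : Nonempty L.verts := ⟨⟨c, hc⟩⟩
  refine ⟨⟨preconnected_iff_joinedOff.2 fun x y => ?_⟩, fun v => preconnected_induce_iff.2 ?_⟩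
  · have := (preconnected_iff_joinedOff.1 h.connected.preconnected x y).map (H := L.coe) (T := ∅)
      (retract hc) fun a b hab _ _ => ?_
    · rwa [retract_coe, retract_coe] at this
    · rcases retract_adj hc hX a b hab with h | h
      · rw [h]; exact Relation.ReflTransGen.refl
      · exact JoinedOff.adj h (by simp) (by simp)
  · intro x y hx hy
    have hx' : (x : V) ≠ v := fun h => hx (Subtype.ext h)
    have hy' : (y : V) ≠ v := fun h => hy (Subtype.ext h)
    have hj : JoinedOff G {(v : V)} x y := by
      by_cases hv : (v : V) = c
      · have hn : ∀ z ∈ X, z ≠ c → ¬ JoinedOff G {(v : V)} b z := fun z hz hzc hj =>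
          hj.closed (C := Xᶜ) (fun p q hpq _ hq hp hqX => hp (hX q hqX (hv ▸ hq) p hpq.symm)) hb hz
        rcases h.two_sides (hv ▸ hbc) hx' hy' with h | h | h
        · exact absurd h (hn x x.2 (hv ▸ hx'))
        · exact absurd h (hn y y.2 (hv ▸ hy'))
        · exact h
      · have : ¬ IsCutVertex G v := fun h' => hv (hcut v v.2 h')
        simp only [IsCutVertex, not_and, not_not] at this
        exact preconnected_induce_iff.1 (this h.connected) x y hx' hy'
    have := hj.map (H := L.coe) (T := {v}) (retract hc) fun p q hpq hp hq => ?_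
    · rwa [retract_coe, retract_coe] at this
    · rcases retract_adj hc hX p q hpq with h | h
      · rw [h]; exact Relation.ReflTransGen.refl
      -- A retracted step stays off `v`: a vertex outside `X` could only be sent to `v` if `v = c`,
      -- and then its neighbour is also outside `X`, so the step would be contracted.
      · have aux : ∀ p q, G.Adj p q → p ∉ ({(v : V)} : Set V) → q ∉ ({(v : V)} : Set V) →
            L.coe.Adj (retract hc p) (retract hc q) → retract (G := G) hc p ≠ v := by
          intro p q hpq hp hq h he
          by_cases hpX : p ∈ X
          · rw [retract_of_mem hc hpX] at he
            exact hp (congrArg Subtype.val he)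
          · rw [retract_of_notMem hc hpX] at he
            have hqX : q ∉ X := fun hqX => hpX (hX q hqX (fun hqc => hq (by
              rw [hqc, ← he]; rfl)) p hpq.symm)
            rw [retract_of_notMem hc hpX, retract_of_notMem hc hqX] at h
            exact h.ne rfl
        exact JoinedOff.adj h (aux p q hpq hp hq h) (aux q p hpq.symm hq hp h.symm)

theorem IsNAc.encard_neighborSet_induce_le (h : IsNAc G 4) (hc : c ∈ X)
    (hX : ∀ x ∈ X, x ≠ c → ∀ y, G.Adj x y → y ∈ X) (hb : ∃ b, b ∉ X) :
    (((⊤ : G.Subgraph).induce X).neighborSet c).encard ≤ 2 := by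
  obtain ⟨b, hb⟩ := hb
  have hbc : b ≠ c := fun h => hb (h ▸ hc)
  by_contra! hlt
  have h3 : (3 : ℕ∞) ≤ (((⊤ : G.Subgraph).induce X).neighborSet c).encard :=
    Order.add_one_le_of_lt hlt
  obtain ⟨T, hT, hT3⟩ := Set.exists_subset_encard_eq h3
  obtain ⟨x, y, z, hxy, hxz, hyz, rfl⟩ := Set.encard_eq_three.1 hT3
  have key : ∀ w ∈ ({x, y, z} : Set V), G.Adj c w ∧ ¬ JoinedOff G {c} b w := fun w hw => by
    obtain ⟨-, hwX, hcw⟩ := hT hw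
    refine ⟨hcw, fun hj => ?_⟩
    exact hj.closed (C := Xᶜ) (fun p q hpq _ hq hp hqX => hp (hX q hqX hq p hpq.symm)) hb hwX
  have hx := key x (by simp)
  have hy := key y (by simp)
  have hz := key z (by simp)
  exact h.not_three_neighbors hbc hx.1 hy.1 hz.1 hxy hxz hyz hx.2 hy.2 hz.2

end Retract

/-! ### Single edges as links -/

section Edge

variable {V : Type u} {G : SimpleGraph V} {p q : V}

theorem induce_pair_eq (h : G.Adj p q) :
    (⊤ : G.Subgraph).induce {p, q} = G.subgraphOfAdj h := by
  ext a b
  · simp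
  · simp only [SimpleGraph.Subgraph.induce_adj, SimpleGraph.Subgraph.top_adj,
      SimpleGraph.subgraphOfAdj_adj, mem_insert_iff, mem_singleton_iff, Sym2.eq_iff]
    constructor
    · rintro ⟨rfl | rfl, rfl | rfl, h'⟩
      · exact absurd rfl h'.ne
      · simp
      · simp
      · exact absurd rfl h'.ne
    · rintro (⟨rfl, rfl⟩ | ⟨rfl, rfl⟩)
      · exact ⟨by simp, by simp, h⟩
      · exact ⟨by simp, by simp, h.symm⟩

theorem isTwoConnected_induce_pair (h : G.Adj p q) :
    IsTwoConnected ((⊤ : G.Subgraph).induce {p, q}).coe := by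
  set L := (⊤ : G.Subgraph).induce {p, q} with hL
  have : Nonempty L.verts := ⟨⟨p, by simp [hL]⟩⟩
  refine ⟨⟨preconnected_iff_joinedOff.2 fun x y => ?_⟩, fun v => preconnected_induce_iff.2 ?_⟩
  · by_cases hxy : x = y
    · rw [hxy]; exact Relation.ReflTransGen.refl
    · refine JoinedOff.adj ?_ (by simp) (by simp)
      obtain ⟨x, hx⟩ := x
      obtain ⟨y, hy⟩ := y
      refine ⟨hx, hy, ?_⟩
      rcases hx with rfl | rfl <;> rcases hy with rfl | rfl
      · exact absurd rfl hxy
      · exact h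
      · exact h.symm
      · exact absurd rfl hxy
  · rintro ⟨x, hx⟩ ⟨y, hy⟩ hxv hyv
    obtain ⟨v, hv⟩ := v
    have : x = y := by
      have h1 : x ≠ v := fun h => hxv (Subtype.ext h)
      have h2 : y ≠ v := fun h => hyv (Subtype.ext h)
      rcases hx with rfl | rfl <;> rcases hy with rfl | rfl <;> rcases hv with rfl | rfl <;>
        first | rfl | exact absurd rfl h1 | exact absurd rfl h2
    subst this
    exact Relation.ReflTransGen.refl

theorem isNAc_induce_pair (h : G.Adj p q) (n : ℕ) :
    IsNAc ((⊤ : G.Subgraph).induce {p, q}).coe n := by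
  intro F _ _
  refine ⟨univ, (arcOn_univ (G := ((⊤ : G.Subgraph).induce {p, q}).coe)
    (v := ⟨p, by simp⟩) (x := ⟨q, by simp⟩) ⟨by simp, by simp, h⟩ ?_).isArc, subset_univ _⟩
  rintro ⟨u, rfl | rfl⟩
  · exact Or.inl rfl
  · exact Or.inr rfl

theorem encard_neighborSet_induce_pair_le (v : V) :
    (((⊤ : G.Subgraph).induce {p, q}).neighborSet v).encard ≤ 2 :=
  (Set.encard_le_encard (t := {p, q}) fun _ h => h.2.1).trans
    ((Set.encard_insert_le _ _).trans_eq (by rw [Set.encard_singleton]; norm_num))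

end Edge

/-! ### The whole graph as its only link -/

section Univ

variable {V : Type u} {G : SimpleGraph V}

theorem IsTwoConnected.induce_univ (h : IsTwoConnected G) :
    IsTwoConnected ((⊤ : G.Subgraph).induce univ).coe := by
  set L := (⊤ : G.Subgraph).induce univ with hL
  obtain ⟨hc, hv⟩ := h
  obtain ⟨x⟩ := hc.nonempty
  have : Nonempty L.verts := ⟨⟨x, trivial⟩⟩
  let f : V → L.verts := fun x => ⟨x, trivial⟩
  refine ⟨⟨preconnected_iff_joinedOff.2 fun x y => ?_⟩, fun v => preconnected_induce_iff.2 ?_⟩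
  · exact (preconnected_iff_joinedOff.1 hc.preconnected x y).map (H := L.coe) f fun a b h _ _ =>
      JoinedOff.adj ⟨trivial, trivial, h⟩ (by simp) (by simp)
  · intro x y hx hy
    have hne : ∀ a : V, a ∉ ({(v : V)} : Set V) → f a ∉ ({v} : Set L.verts) := fun a ha h' =>
      ha (congrArg Subtype.val (mem_singleton_iff.1 h'))
    exact (preconnected_induce_iff.1 (hv v) x y (fun h => hx (Subtype.ext h))
      (fun h => hy (Subtype.ext h))).map (H := L.coe) f fun a b h ha hb =>
      JoinedOff.adj ⟨trivial, trivial, h⟩ (hne a ha) (hne b hb)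

theorem IsNAc.induce_univ {n : ℕ} (h : IsNAc G n) :
    IsNAc ((⊤ : G.Subgraph).induce univ).coe n := by
  classical
  set L := (⊤ : G.Subgraph).induce univ with hL
  let f : V → L.verts := fun x => ⟨x, trivial⟩
  have hf : ∀ a b, G.Adj a b → f a = f b ∨ L.coe.Adj (f a) (f b) := fun a b h =>
    Or.inr ⟨trivial, trivial, h⟩
  intro F _ hF
  obtain ⟨γ, hγ, hi, hFγ⟩ := h.exists_curve (F.image (incl L)) (Finset.card_image_le.trans hF)
  refine ⟨range (mapR f hf ∘ γ), isArc_range (continuous_mapR.comp hγ)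
    ((mapR_injective fun a b h => congrArg Subtype.val h).comp hi), fun z hz => ?_⟩
  obtain ⟨r, hr⟩ := hFγ (Finset.mem_coe.2 (Finset.mem_image_of_mem _ hz))
  exact ⟨r, by rw [Function.comp_apply, hr, mapR_incl hf fun _ => rfl]⟩

end Univ

/-! ### Levels: signed distance from a cut vertex -/

section Level

variable {V : Type u} {G : SimpleGraph V}

/-- A signed distance from the vertex `v₀`, positive on one side of `v₀` and negative on the
other. -/
structure IsLevel (G : SimpleGraph V) (s : V → ℤ) (v₀ : V) : Prop where
  zero (x : V) : s x = 0 ↔ x = v₀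
  adj (x y : V) : G.Adj x y → s x ≤ s y + 1
  pos (x : V) : 0 < s x → ∃ y, G.Adj x y ∧ s y = s x - 1
  neg (x : V) : s x < 0 → ∃ y, G.Adj x y ∧ s y = s x + 1
  exists_pos : ∃ x, 0 < s x
  exists_neg : ∃ x, s x < 0

theorem IsCutVertex.exists_not_joinedOff {v : V} (h : IsCutVertex G v) :
    ∃ a b, a ≠ v ∧ b ≠ v ∧ ¬ JoinedOff G {v} a b := by
  by_contra! hc
  exact h.2 (preconnected_induce_iff.2 hc)

theorem IsCutVertex.exists_isLevel {v₀ : V} (h : IsCutVertex G v₀) :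
    ∃ s : V → ℤ, IsLevel G s v₀ := by
  classical
  obtain ⟨a, b, ha, hb, hab⟩ := h.exists_not_joinedOff
  have hG := h.1
  have hd0 : ∀ x, x ≠ v₀ → 0 < G.dist v₀ x := fun x hx => hG.pos_dist_of_ne hx.symm
  have hstep : ∀ x, x ≠ v₀ → ∃ y, G.Adj x y ∧ G.dist v₀ y + 1 = G.dist v₀ x := by
    intro x hx
    obtain ⟨p, hp⟩ := hG.exists_walk_length_eq_dist x v₀
    cases p with
    | nil => exact absurd rfl hx
    | @cons _ y _ hxy q =>
      refine ⟨y, hxy, ?_⟩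
      have h1 := SimpleGraph.dist_le q
      have h2 := hG.dist_triangle (u := x) (v := y) (w := v₀)
      have h3 := SimpleGraph.dist_eq_one_iff_adj.2 hxy
      rw [SimpleGraph.Walk.length_cons] at hp
      rw [SimpleGraph.dist_comm (u := v₀) (v := y), SimpleGraph.dist_comm (u := v₀) (v := x)]
      omega
  have hadj : ∀ x y, G.Adj x y → G.dist v₀ x ≤ G.dist v₀ y + 1 := by
    intro x y hxy
    have h2 := hG.dist_triangle (u := v₀) (v := y) (w := x)
    have h3 := SimpleGraph.dist_eq_one_iff_adj.2 hxy.symm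
    omega
  have hside : ∀ x y, G.Adj x y → x ≠ v₀ → y ≠ v₀ →
      (JoinedOff G {v₀} a x ↔ JoinedOff G {v₀} a y) := fun x y hxy hx hy =>
    ⟨fun h => h.trans (JoinedOff.adj hxy hx hy), fun h => h.trans (JoinedOff.adj hxy.symm hy hx)⟩
  have h00 : G.dist v₀ v₀ = 0 := SimpleGraph.dist_self
  -- The sign is positive on the component of `a` in `G - v₀` and negative on all other components.
  -- It changes along no edge off `v₀`, so `s` changes by at most 1 along every edge.
  refine ⟨fun x => if JoinedOff G {v₀} a x then (G.dist v₀ x : ℤ) else -(G.dist v₀ x : ℤ),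
    ?_, ?_, ?_, ?_, ⟨a, ?_⟩, ⟨b, ?_⟩⟩
  · intro x
    constructor
    · intro hx
      by_contra hne
      have := hd0 x hne
      split_ifs at hx <;> omega
    · rintro rfl
      simp
  · intro x y hxy
    have h1 := hadj x y hxy
    have h2 := hadj y x hxy.symm
    by_cases hx : x = v₀
    · subst hx
      split_ifs <;> omega
    by_cases hy : y = v₀
    · subst hy
      split_ifs <;> omega
    have := hside x y hxy hx hy
    by_cases hj : JoinedOff G {v₀} a x
    · rw [if_pos hj, if_pos (this.1 hj)]
      omega
    · rw [if_neg hj, if_neg (fun h => hj (this.2 h))]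
      omega
  · intro x hx
    have hx0 : x ≠ v₀ := by
      rintro rfl
      simp at hx
    have hj : JoinedOff G {v₀} a x := by
      by_contra hj
      rw [if_neg hj] at hx
      omega
    obtain ⟨y, hxy, hy⟩ := hstep x hx0
    refine ⟨y, hxy, ?_⟩
    rw [if_pos hj]
    by_cases hy0 : y = v₀
    · subst hy0
      split_ifs <;> omega
    · rw [if_pos ((hside x y hxy hx0 hy0).1 hj)]
      omega
  · intro x hx
    have hx0 : x ≠ v₀ := by
      rintro rfl
      simp at hx
    have hj : ¬ JoinedOff G {v₀} a x := by
      intro hj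
      rw [if_pos hj] at hx
      omega
    obtain ⟨y, hxy, hy⟩ := hstep x hx0
    refine ⟨y, hxy, ?_⟩
    rw [if_neg hj]
    by_cases hy0 : y = v₀
    · subst hy0
      split_ifs <;> omega
    · rw [if_neg fun h => hj ((hside x y hxy hx0 hy0).2 h)]
      omega
  · rw [if_pos (show JoinedOff G {v₀} a a from Relation.ReflTransGen.refl)]
    exact_mod_cast hd0 a ha
  · rw [if_neg hab]
    have := hd0 b hb
    omega

variable {s : V → ℤ} {v₀ : V}

theorem IsLevel.symm (hs : IsLevel G s v₀) : IsLevel G (fun x => -s x) v₀ where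
  zero x := by rw [neg_eq_zero, hs.zero]
  adj x y h := by have := hs.adj y x h.symm; omega
  pos x h := by
    obtain ⟨y, hy, h'⟩ := hs.neg x (by omega)
    exact ⟨y, hy, by omega⟩
  neg x h := by
    obtain ⟨y, hy, h'⟩ := hs.pos x (by omega)
    exact ⟨y, hy, by omega⟩
  exists_pos := hs.exists_neg.imp fun _ h => by omega
  exists_neg := hs.exists_pos.imp fun _ h => by omega

/-- A level that consists of one vertex separates the levels below from the levels above. -/
theorem IsLevel.not_joinedOff (hs : IsLevel G s v₀) {c : V} {k : ℤ} (hc : ∀ z, s z = k ↔ z = c)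
    {b w : V} (hb : s b < k) (hw : k < s w) : ¬ JoinedOff G {c} b w := by
  intro h
  refine hw.not_gt (h.closed (C := {z | s z < k}) (fun x y hxy _ hy hx => ?_) hb)
  have h1 := hs.adj y x hxy.symm
  have h2 : s y ≠ k := fun h => hy ((hc y).1 h)
  change s x < k at hx
  change s y < k
  omega

theorem IsLevel.exists_eq (hs : IsLevel G s v₀) {k : ℤ} (hk : 0 ≤ k) (m : ℕ) {w : V}
    (hw : s w = k + m) : ∃ z, s z = k := by
  induction m generalizing w with
  | zero => exact ⟨w, by simpa using hw⟩
  | succ m ih =>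
    obtain ⟨y, -, hy⟩ := hs.pos w (by omega)
    exact ih (w := y) (by push_cast at hw; omega)

/-- Induction on the level. If level `k` is the single vertex `c`, every vertex of level `k + 1` is
a neighbour of `c` on the side of the cut vertex `w`, and `IsNAc.eq_of_adj_of_adj` leaves room for
only one. -/
theorem IsLevel.exists_cut_aux (hs : IsLevel G s v₀) (h : IsNAc G 4) (h0 : IsCutVertex G v₀) {w : V}
    (hw : IsCutVertex G w) (k : ℕ) (hk : (k : ℤ) ≤ s w) :
    ∃ c, IsCutVertex G c ∧ ∀ z, s z = k ↔ z = c := by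
  induction k with
  | zero => exact ⟨v₀, h0, fun z => by simpa using hs.zero z⟩
  | succ k ih =>
    push_cast at hk ⊢
    obtain ⟨c, -, hc⟩ := ih (by omega)
    obtain ⟨b, hb⟩ := hs.exists_neg
    have hsc : s c = k := (hc c).2 rfl
    have hcw : c ≠ w := by rintro rfl; omega
    have hbc : b ≠ c := by rintro rfl; omega
    -- Deleting `c` leaves at most two components. One contains `b`, below `c`; hence all that lies
    -- above level `k` is in the other, with `w`.
    have hj : ∀ z, (k : ℤ) < s z → JoinedOff G {c} z w := by
      intro z hz
      have hzc : z ≠ c := by rintro rfl; omega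
      rcases h.two_sides hbc hzc hcw.symm with h' | h' | h'
      · exact absurd h' (hs.not_joinedOff hc (by omega) hz)
      · exact absurd h' (hs.not_joinedOff hc (by omega) (by omega))
      · exact h'
    obtain ⟨b', hb'w, hb'⟩ : ∃ b', b' ≠ w ∧ ¬ JoinedOff G {w} b' c := by
      obtain ⟨x, y, hx, hy, hxy⟩ := hw.exists_not_joinedOff
      by_cases hxc : JoinedOff G {w} x c
      · exact ⟨y, hy, fun h => hxy (hxc.trans h.symm)⟩
      · exact ⟨x, hx, hxc⟩
    have hadj : ∀ z, s z = k + 1 → G.Adj c z := by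
      intro z hz
      obtain ⟨y, hzy, hy⟩ := hs.pos z (by omega)
      obtain rfl := (hc y).1 (by omega)
      exact hzy.symm
    obtain ⟨d, hd⟩ := hs.exists_eq (k := k + 1) (by omega) (s w - (k + 1)).toNat (w := w) (by omega)
    have hd' : ∀ z, s z = k + 1 ↔ z = d := by
      refine fun z => ⟨fun hz => ?_, fun hz => hz ▸ hd⟩
      exact h.eq_of_adj_of_adj hcw hbc hb'w (hs.not_joinedOff hc (by omega) (by omega)) hb'
        (hadj z hz) (hadj d hd) (hj z (by omega)) (hj d (by omega))
    refine ⟨d, ?_, hd'⟩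
    -- Either `d` is the given cut vertex `w`, or it is a full level strictly between those of `v₀`
    -- and `w` and so separates them.
    by_cases hdw : d = w
    · exact hdw ▸ hw
    · have hwk : s w ≠ k + 1 := fun h => hdw ((hd' w).1 h).symm
      have hv0 := (hs.zero v₀).2 rfl
      refine ⟨h.connected, fun hp => hs.not_joinedOff hd' (b := v₀) (w := w) (by omega) (by omega)
        (preconnected_induce_iff.1 hp v₀ w ?_ (Ne.symm hdw))⟩
      rintro rfl
      omega

theorem IsLevel.exists_cut (hs : IsLevel G s v₀) (h : IsNAc G 4) (h0 : IsCutVertex G v₀) {w : V}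
    (hw : IsCutVertex G w) {k : ℤ} (hk : 0 ≤ k ∧ k ≤ s w ∨ s w ≤ k ∧ k ≤ 0) :
    ∃ c, IsCutVertex G c ∧ ∀ z, s z = k ↔ z = c := by
  rcases hk with ⟨h1, h2⟩ | ⟨h1, h2⟩
  · lift k to ℕ using h1
    exact hs.exists_cut_aux h h0 hw k h2
  · obtain ⟨c, hc, hc'⟩ := hs.symm.exists_cut_aux h h0 hw (-k).toNat (by omega)
    refine ⟨c, hc, fun z => ?_⟩
    rw [← hc' z]
    omega

/-- Steps towards level 0 shrink the absolute level and stay below `c`, so they cannot hit `c`. -/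
theorem IsLevel.joinedOff (hs : IsLevel G s v₀) {c : V} (hc : 0 < s c) (m : ℕ) {z : V}
    (hm : (s z).natAbs = m) (hz : s z < s c) : JoinedOff G {c} z v₀ := by
  have ne : ∀ x, s x < s c → x ∉ ({c} : Set V) := by
    rintro x hx rfl
    exact hx.false
  induction m generalizing z with
  | zero =>
    rw [(hs.zero z).1 (by omega)]
    exact Relation.ReflTransGen.refl
  | succ m ih =>
    have key : ∀ y, G.Adj z y → s y < s c → (s y).natAbs = m → JoinedOff G {c} z v₀ :=
      fun y hy h1 h2 => (JoinedOff.adj hy (ne z hz) (ne y h1)).trans (ih h2 h1)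
    rcases lt_trichotomy (s z) 0 with h | h | h
    · obtain ⟨y, hy, hy'⟩ := hs.neg z h
      exact key y hy (by omega) (by omega)
    · omega
    · obtain ⟨y, hy, hy'⟩ := hs.pos z h
      exact key y hy (by omega) (by omega)

/-- The properties required of the links of a chain. -/
structure IsGoodLink (G : SimpleGraph V) (L : G.Subgraph) : Prop where
  isTwoConnected : IsTwoConnected L.coe
  isNAc : IsNAc L.coe 4
  encard_le (v : V) : IsCutVertex G v → v ∈ L.verts → (L.neighborSet v).encard ≤ 2

theorem isGoodLink_induce_pair {p q : V} (hpq : G.Adj p q) :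
    IsGoodLink G ((⊤ : G.Subgraph).induce {p, q}) :=
  ⟨isTwoConnected_induce_pair hpq, isNAc_induce_pair hpq 4,
    fun v _ _ => encard_neighborSet_induce_pair_le v⟩

theorem IsLevel.isGoodLink (hs : IsLevel G s v₀) (h : IsNAc G 4) {c : V} (hcut : IsCutVertex G c)
    {n : ℤ} (hn : 0 ≤ n) (hc : ∀ z, s z = n ↔ z = c) (hmax : ∀ w, IsCutVertex G w → s w ≤ n) :
    IsGoodLink G ((⊤ : G.Subgraph).induce {x | n ≤ s x}) := by
  have hsc : s c = n := (hc c).2 rfl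
  have hcX : c ∈ {x | n ≤ s x} := hsc.ge
  have hX : ∀ x ∈ {x | n ≤ s x}, x ≠ c → ∀ y, G.Adj x y → y ∈ {x | n ≤ s x} := by
    intro x hx hxc y hxy
    have h1 := hs.adj x y hxy
    have h2 : s x ≠ n := fun h => hxc ((hc x).1 h)
    change n ≤ s x at hx
    change n ≤ s y
    omega
  have hb : ∃ b, b ∉ {x | n ≤ s x} := hs.exists_neg.imp fun b hb => by
    simp only [mem_ofPred_eq]
    omega
  have heq : ∀ x ∈ {x | n ≤ s x}, IsCutVertex G x → x = c := fun x hx hxc =>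
    (hc x).1 ((hmax x hxc).antisymm hx)
  -- For `n = 0` there are vertices of positive level. For `n > 0`, if `c` were alone, every other
  -- vertex would be joined to `v₀` off `c`, and `c` would not be a cut vertex.
  have hne : ∃ x ∈ {x | n ≤ s x}, x ≠ c := by
    by_contra! hall
    have hn0 : 0 < n := by
      by_contra hn0
      obtain ⟨x, hx⟩ := hs.exists_pos
      have := (hc x).2 (hall x (by simp only [mem_ofPred_eq]; omega))
      omega
    refine hcut.2 (preconnected_induce_iff.2 fun a b ha hb => ?_)
    have key : ∀ a, a ≠ c → JoinedOff G {c} a v₀ := fun a ha =>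
      hs.joinedOff (hsc ▸ hn0) _ rfl (by
        rw [hsc]
        by_contra hlt
        exact ha (hall a (not_lt.1 hlt)))
    exact (key a ha).trans (key b hb).symm
  refine ⟨h.isTwoConnected_induce hcX hX hb heq, h.induce hcX hX hne, fun v hv hvX => ?_⟩
  rw [heq v hvX hv]
  exact h.encard_neighborSet_induce_le hcX hX hb

end Level

/-! ### Necessity: the chain of links -/

section Chain

variable {V : Type u} {G : SimpleGraph V} {s : V → ℤ} {v₀ : V}

/-- The levels of the cut vertices. -/
def cutLevels (G : SimpleGraph V) (s : V → ℤ) : Set ℤ := {k | ∃ c, IsCutVertex G c ∧ s c = k}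

/-- The vertices between two consecutive cut vertices, or beyond the last one. -/
def linkVerts (G : SimpleGraph V) (s : V → ℤ) (n : ℤ) : Set V :=
  {x | (n ∈ cutLevels G s → n ≤ s x) ∧ (n + 1 ∈ cutLevels G s → s x ≤ n + 1)}

theorem IsLevel.exists_eq_iff (hs : IsLevel G s v₀) (h : IsNAc G 4) (h0 : IsCutVertex G v₀) {k : ℤ}
    (hk : k ∈ cutLevels G s) : ∃ c, IsCutVertex G c ∧ ∀ z, s z = k ↔ z = c := by
  obtain ⟨w, hw, rfl⟩ := hk
  exact hs.exists_cut h h0 hw (by omega)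

theorem IsLevel.zero_mem (hs : IsLevel G s v₀) (h0 : IsCutVertex G v₀) : 0 ∈ cutLevels G s :=
  ⟨v₀, h0, (hs.zero v₀).2 rfl⟩

theorem IsLevel.mem_of_le_of_le (hs : IsLevel G s v₀) (h : IsNAc G 4) (h0 : IsCutVertex G v₀)
    {a b k : ℤ} (ha : a ∈ cutLevels G s) (hb : b ∈ cutLevels G s) (hak : a ≤ k) (hkb : k ≤ b) :
    k ∈ cutLevels G s := by
  have key : ∀ w, IsCutVertex G w → (0 ≤ k ∧ k ≤ s w ∨ s w ≤ k ∧ k ≤ 0) →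
      k ∈ cutLevels G s := fun w hw hk => by
    obtain ⟨c, hc, hc'⟩ := hs.exists_cut h h0 hw hk
    exact ⟨c, hc, (hc' c).2 rfl⟩
  obtain ⟨x, hx, rfl⟩ := ha
  obtain ⟨y, hy, rfl⟩ := hb
  rcases le_total 0 k with hk | hk
  · exact key y hy (Or.inl ⟨hk, hkb⟩)
  · exact key x hx (Or.inr ⟨hak, hk⟩)

theorem IsLevel.exists_linkVerts_eq (hs : IsLevel G s v₀) (h : IsNAc G 4) (h0 : IsCutVertex G v₀)
    {n : ℤ} (hn : n ∈ cutLevels G s) (hn' : n + 1 ∈ cutLevels G s) :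
    ∃ p q, G.Adj p q ∧ linkVerts G s n = {p, q} := by
  obtain ⟨p, -, hp⟩ := hs.exists_eq_iff h h0 hn
  obtain ⟨q, -, hq⟩ := hs.exists_eq_iff h h0 hn'
  have hsp : s p = n := (hp p).2 rfl
  have hsq : s q = n + 1 := (hq q).2 rfl
  refine ⟨p, q, ?_, ?_⟩
  · rcases le_or_gt 0 n with hn0 | hn0
    · obtain ⟨y, hy, hy'⟩ := hs.pos q (by omega)
      rw [(hp y).1 (by omega)] at hy
      exact hy.symm
    · obtain ⟨y, hy, hy'⟩ := hs.neg p (by omega)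
      rwa [(hq y).1 (by omega)] at hy
  · ext x
    rw [mem_insert_iff, mem_singleton_iff, ← hp, ← hq, linkVerts, mem_ofPred_eq]
    constructor
    · rintro ⟨h1, h2⟩
      have := h1 hn
      have := h2 hn'
      omega
    · intro hx
      exact ⟨fun _ => by omega, fun _ => by omega⟩

theorem IsLevel.isGoodLink_linkVerts (hs : IsLevel G s v₀) (h : IsNAc G 4)
    (h0 : IsCutVertex G v₀) {n : ℤ} (hn : n ∈ cutLevels G s ∨ n + 1 ∈ cutLevels G s) :
    IsGoodLink G ((⊤ : G.Subgraph).induce (linkVerts G s n)) := by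
  have hz := hs.zero_mem h0
  by_cases h1 : n ∈ cutLevels G s <;> by_cases h2 : n + 1 ∈ cutLevels G s
  · obtain ⟨p, q, hpq, he⟩ := hs.exists_linkVerts_eq h h0 h1 h2
    rw [he]
    exact isGoodLink_induce_pair hpq
  · obtain ⟨c, hc, hc'⟩ := hs.exists_eq_iff h h0 h1
    have he : linkVerts G s n = {x | n ≤ s x} := by
      ext x
      simp [linkVerts, h1, h2]
    rw [he]
    refine hs.isGoodLink h hc ?_ hc' fun w hw => ?_
    · by_contra hlt
      exact h2 (hs.mem_of_le_of_le h h0 h1 hz (by omega) (by omega))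
    · by_contra hlt
      exact h2 (hs.mem_of_le_of_le h h0 h1 ⟨w, hw, rfl⟩ (by omega) (by omega))
  · obtain ⟨c, hc, hc'⟩ := hs.exists_eq_iff h h0 h2
    have he : linkVerts G s n = {x | -(n + 1) ≤ -s x} := by
      ext x
      simp [linkVerts, h1, h2]
    rw [he]
    -- The lower end link is the upper one for the reversed sign; since its cut vertex has level `n
    -- + 1`, the index becomes `-(n + 1)`.
    refine hs.symm.isGoodLink h hc (n := -(n + 1)) ?_ (fun z => by rw [← hc']; omega) fun w hw => ?_
    · by_contra hlt
      exact h1 (hs.mem_of_le_of_le h h0 hz h2 (by omega) (by omega))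
    · by_contra hlt
      exact h1 (hs.mem_of_le_of_le h h0 ⟨w, hw, rfl⟩ h2 (by omega) (by omega))
  · exact absurd hn (by simp [h1, h2])

/-- Applied to the ends of an edge, and with `x = y` to a vertex. If neither `s x` nor `s x + 1` is
a cut level, both vertices lie beyond the least or the greatest cut level, because the cut levels
form an interval around 0. -/
theorem IsLevel.exists_mem_linkVerts (hs : IsLevel G s v₀) (h : IsNAc G 4) (h0 : IsCutVertex G v₀)
    {x y : V} (hxy : s x ≤ s y) (hyx : s y ≤ s x + 1) :
    ∃ n, (n ∈ cutLevels G s ∨ n + 1 ∈ cutLevels G s) ∧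
      x ∈ linkVerts G s n ∧ y ∈ linkVerts G s n := by
  have hz := hs.zero_mem h0
  by_cases hm : s x ∈ cutLevels G s ∨ s x + 1 ∈ cutLevels G s
  · exact ⟨s x, hm, ⟨fun _ => le_rfl, fun _ => by omega⟩, ⟨fun _ => hxy, fun _ => hyx⟩⟩
  rw [not_or] at hm
  have hne : s x ≠ 0 := fun h => hm.1 (h ▸ hz)
  have hne' : s x + 1 ≠ 0 := fun h => hm.2 (h ▸ hz)
  rcases lt_or_gt_of_ne hne with hlt | hgt
  · have hb : ∀ k ∈ cutLevels G s, s x + 2 ≤ k := fun k hk => by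
      by_contra hlt'
      exact hm.2 (hs.mem_of_le_of_le h h0 hk hz (by omega) (by omega))
    obtain ⟨n, hn, hmin⟩ := Int.exists_least_of_bdd ⟨_, hb⟩ ⟨0, hz⟩
    -- The end link below the least cut level `n` has index `n - 1`; the one above a greatest cut
    -- level has that level as its index.
    have h1 := hb n hn
    have h2 : n - 1 ∉ cutLevels G s := fun h => by have := hmin _ h; omega
    refine ⟨n - 1, Or.inr (by rwa [sub_add_cancel]), ⟨fun h => absurd h h2, fun _ => by omega⟩,
      ⟨fun h => absurd h h2, fun _ => by omega⟩⟩
  · have hb : ∀ k ∈ cutLevels G s, k ≤ s x := fun k hk => by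
      by_contra hlt'
      exact hm.1 (hs.mem_of_le_of_le h h0 hz hk (by omega) (by omega))
    obtain ⟨n, hn, hmax⟩ := Int.exists_greatest_of_bdd ⟨_, hb⟩ ⟨0, hz⟩
    have h1 := hb n hn
    have h2 : n + 1 ∉ cutLevels G s := fun h => by have := hmax _ h; omega
    exact ⟨n, Or.inl hn, ⟨fun _ => h1, fun h => absurd h h2⟩,
      ⟨fun _ => by omega, fun h => absurd h h2⟩⟩

theorem IsLevel.isChain (hs : IsLevel G s v₀) (h : IsNAc G 4) (h0 : IsCutVertex G v₀) :
    IsChain G {n | n ∈ cutLevels G s ∨ n + 1 ∈ cutLevels G s}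
      (fun n => (⊤ : G.Subgraph).induce (linkVerts G s n)) where
  connected := h.connected
  interval := by
    refine ⟨fun m hm n hn k hk => ?_⟩
    obtain ⟨a, ha, ham⟩ : ∃ a ∈ cutLevels G s, m ≤ a ∧ a ≤ m + 1 := by
      rcases hm with hm | hm
      · exact ⟨m, hm, by omega⟩
      · exact ⟨m + 1, hm, by omega⟩
    obtain ⟨b, hb, hbn⟩ : ∃ b ∈ cutLevels G s, n ≤ b ∧ b ≤ n + 1 := by
      rcases hn with hn | hn
      · exact ⟨n, hn, by omega⟩
      · exact ⟨n + 1, hn, by omega⟩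
    have h1 := hk.1
    have h2 := hk.2
    by_cases hak : a ≤ k
    · exact Or.inl (hs.mem_of_le_of_le h h0 ha hb hak (by omega))
    · obtain rfl : k = m := by omega
      exact hm
  union := by
    refine le_antisymm le_top ?_
    have key : ∀ x y, s x ≤ s y → s y ≤ s x + 1 → ∃ n,
        ∃ _ : n ∈ {n | n ∈ cutLevels G s ∨ n + 1 ∈ cutLevels G s},
          x ∈ linkVerts G s n ∧ y ∈ linkVerts G s n := fun x y hxy hyx => by
      obtain ⟨n, hn, hx, hy⟩ := hs.exists_mem_linkVerts h h0 hxy hyx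
      exact ⟨n, hn, hx, hy⟩
    constructor
    · intro x _
      simp only [SimpleGraph.Subgraph.verts_iSup, mem_iUnion]
      obtain ⟨n, hn, hx, -⟩ := key x x le_rfl (by omega)
      exact ⟨n, hn, hx⟩
    · intro x y hxy
      replace hxy : G.Adj x y := hxy
      simp only [SimpleGraph.Subgraph.iSup_adj]
      have h1 := hs.adj x y hxy
      have h2 := hs.adj y x hxy.symm
      rcases le_total (s x) (s y) with hle | hle
      · obtain ⟨n, hn, hx, hy⟩ := key x y hle (by omega)
        exact ⟨n, hn, hx, hy, hxy⟩
      · obtain ⟨n, hn, hy, hx⟩ := key y x hle (by omega)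
        exact ⟨n, hn, hx, hy, hxy⟩
  consecutive := by
    intro n hn hn'
    -- If both indices occur, the level `n + 1` shared by the two links is a cut level, since the
    -- cut levels form an interval.
    have hK : n + 1 ∈ cutLevels G s := by
      rcases hn with hn | hn
      · rcases hn' with hn' | hn'
        · exact hn'
        · exact hs.mem_of_le_of_le h h0 hn hn' (by omega) (by omega)
      · exact hn
    obtain ⟨c, -, hc⟩ := hs.exists_eq_iff h h0 hK
    refine ⟨c, ?_⟩
    ext x
    rw [mem_singleton_iff, ← hc]
    constructor
    · rintro ⟨h1, h2⟩
      exact (h1.2 hK).antisymm (h2.1 hK)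
    · intro hx
      exact ⟨⟨fun _ => by omega, fun _ => by omega⟩, ⟨fun _ => by omega, fun _ => by omega⟩⟩
  nonconsecutive := by
    intro m hm n hn hmn
    have hK : m + 1 ∈ cutLevels G s ∧ n ∈ cutLevels G s := by
      rcases hm with hm | hm <;> rcases hn with hn | hn <;>
        exact ⟨hs.mem_of_le_of_le h h0 hm hn (by omega) (by omega),
          hs.mem_of_le_of_le h h0 hm hn (by omega) (by omega)⟩
    refine Set.disjoint_left.2 fun x h1 h2 => ?_
    have := h1.2 hK.1
    have := h2.1 hK.2
    omega

theorem IsNAc.exists_isChain (h : IsNAc G 4) :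
    ∃ (J : Set ℤ) (L : ℤ → G.Subgraph), IsChain G J L ∧
      (∀ n ∈ J, IsTwoConnected (L n).coe ∧ IsNAc (L n).coe 4) ∧
      (∀ n ∈ J, n - 1 ∈ J → n + 1 ∈ J → IsSingleEdge (L n)) ∧
      (∀ v : V, IsCutVertex G v → ∀ n ∈ J, v ∈ (L n).verts →
        ((L n).neighborSet v).encard ≤ 2) := by
  by_cases hcut : ∃ v₀, IsCutVertex G v₀
  · obtain ⟨v₀, h0⟩ := hcut
    obtain ⟨s, hs⟩ := h0.exists_isLevel
    refine ⟨_, _, hs.isChain h h0, fun n hn => ?_, fun n hn hn' hn'' => ?_, fun v hv n hn => ?_⟩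
    · exact ⟨(hs.isGoodLink_linkVerts h h0 hn).isTwoConnected,
        (hs.isGoodLink_linkVerts h h0 hn).isNAc⟩
    · have hK : n ∈ cutLevels G s ∧ n + 1 ∈ cutLevels G s := by
        rcases hn' with hn' | hn' <;> rcases hn'' with hn'' | hn'' <;>
          exact ⟨hs.mem_of_le_of_le h h0 hn' hn'' (by omega) (by omega),
            hs.mem_of_le_of_le h h0 hn' hn'' (by omega) (by omega)⟩
      obtain ⟨p, q, hpq, he⟩ := hs.exists_linkVerts_eq h h0 hK.1 hK.2
      exact ⟨p, q, hpq, by rw [he]; exact induce_pair_eq hpq⟩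
    · exact (hs.isGoodLink_linkVerts h h0 hn).encard_le v hv
  -- Without cut vertices the graph is its own only link.
  · have h2 : IsTwoConnected G := ⟨h.connected, fun v => by
      by_contra hv
      exact hcut ⟨v, h.connected, hv⟩⟩
    refine ⟨{0}, fun _ => (⊤ : G.Subgraph).induce univ,
      ⟨h.connected, ordConnected_singleton, ?_, ?_, ?_⟩,
      fun _ _ => ⟨h2.induce_univ, h.induce_univ⟩, ?_, fun v hv => absurd ⟨v, hv⟩ hcut⟩
    · simp only [mem_singleton_iff, iSup_iSup_eq_left]
      ext <;> simp
    · rintro n rfl hn'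
      simp at hn'
    · rintro m rfl n rfl hmn
      omega
    · rintro n rfl hn'
      simp at hn'

end Chain

end GraphArc

/-- A graph is 4-ac iff it is a chain graph all of whose links are 2-connected and 4-ac, whose
interior links (those that are neither first nor last) are single edges, and in which every cut
vertex `v` of the graph has degree at most 2 in every link that contains `v`. -/
theorem mainTheorem6 {V : Type*} (G : SimpleGraph V) :
    GraphArc.IsNAc G 4 ↔
      ∃ (J : Set ℤ) (L : ℤ → G.Subgraph), GraphArc.IsChain G J L ∧
        (∀ n ∈ J, GraphArc.IsTwoConnected (L n).coe ∧ GraphArc.IsNAc (L n).coe 4) ∧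
        (∀ n ∈ J, n - 1 ∈ J → n + 1 ∈ J → GraphArc.IsSingleEdge (L n)) ∧
        (∀ v : V, GraphArc.IsCutVertex G v →
          ∀ n ∈ J, v ∈ (L n).verts → ((L n).neighborSet v).encard ≤ 2) :=
  ⟨fun h => h.exists_isChain,
    fun ⟨_, _, h, h1, h2, h3⟩ => GraphArc.isNAc_of_isChain h h1 h2 h3⟩
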